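/- Let $(M,g)$ be a smooth oriented Riemannian manifold of dimension 4, with Levi-Civita connection $\nabla^g$, and let $\nabla$ be a smooth metric connection on $TM$ with skew torsion $H$, i.e. $\nabla g=0$ and $g(T^\nabla(X,Y),Z)=H(X,Y,Z)$ for a three-form $H$. Put $R^\nabla(X,Y,Z,W)=-g(R^\nabla(X,Y)Z,W)$, where $R^\nabla(X,Y)=[\nabla_X,\nabla_Y]-\nabla_{[X,Y]}$, and let $\mathcal R^\nabla:\Lambda^2\to\Lambda^2$ be the curvature operator, $g(\mathcal R^\nabla(X\wedge Y),Z\wedge W)=R^\nabla(X,Y,Z,W)$ (vectors and covectors are identified by $g$, and $e_i\wedge e_j$, $i<j$, is orthonormal if $(e_i)$ is). Let $\mathrm{Ric}^\nabla(X,Y)=\sum_i R^\nabla(e_i,X,e_i,Y)$, let $s^\nabla$ be its trace and $Z^\nabla$ its symmetric trace-free part; let $*$ be the Hodge star ($\alpha\wedge *\beta=\langle\alpha,\beta\rangle\,\mathrm{vol}$), $d^*=-*d*$, and $S(T)(X,Y)=\tfrac12(T(X,Y)+T(Y,X))$. Let $W^\pm$ be the self-dual and anti-self-dual parts of the Weyl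 operator of $\nabla^g$. Then $\Lambda^2=\Lambda_+\oplus\Lambda_-$ (self-dual and anti-self-dual two-forms) and, at every point, with respect to this splitting, $$\mathcal R^\nabla=\begin{pmatrix} W^+ +\left(\frac{s^\nabla}{12}-\frac{*dH}{4}\right)\mathrm{Id}+\frac14 (d^*H)_+ & Z^\nabla+S(\nabla{*H})+\frac{*dH}{4}\,g\\[2mm] \left(Z^\nabla-S(\nabla{*H})-\frac{*dH}{4}\,g\right)^\dagger & W^-+\left(\frac{s^\nabla}{12}+\frac{*dH}{4}\right)\mathrm{Id}-\frac14 (d^*H)_-\end{pmatrix},$$ with the following identifications. (a) A form $\alpha\in\Lambda_\pm$ acts on $\Lambda_\pm$ as the skew-symmetric endomorphism $\beta\mapsto\pm[\alpha,\beta]$, the commutator of the matrices $(\alpha(e_i,e_j))$, $(\beta(e_i,e_j))$ in an orthonormal basis. Equivalently, for a positively oriented orthonormal basis, $\alpha=\sum a_if_i$ with $f_1=e_1\wedge e_2\pm e_3\wedge e_4$, $f_2=e_1\wedge e_3\mp e_2\wedge e_4$, $f_3=e_1\wedge e_4\pm e_2\wedge e_3$ acts by the matrix $2\begin{pmatrix}0&a_3&-a_2\\-a_3&0&a_1\\a_2&-a_1&0\end{pmatrix}$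 in the basis $(f_1,f_2,f_3)$. (b) A block $B:\Lambda_-\to\Lambda_+$ is identified with a symmetric trace-free 2-tensor by the Ricci contraction of the symmetric endomorphism $L=\begin{pmatrix}0&B\\B^\dagger&0\end{pmatrix}$, i.e. with $(X,Y)\mapsto\sum_i\langle L(e_i\wedge X),e_i\wedge Y\rangle$. The upper right block is the map $\Lambda_-\to\Lambda_+$, and the lower left block $\Lambda_+\to\Lambda_-$ is the transpose $\dagger$ of the map $\Lambda_-\to\Lambda_+$ so identified with the tensor in brackets. -/

import Mathlib

open Bundle Manifold Module
open scoped ContDiff Topology RealInnerProductSpace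

noncomputable section

namespace SkewTorsion

/-! ### Exterior algebra of an oriented Euclidean vector space of dimension four

Throughout, `k`-forms on `V` are the alternating `k`-linear maps `V [⋀^Fin k]→L[ℝ] ℝ`. -/

section Algebra

variable {V : Type*} [NormedAddCommGroup V] [InnerProductSpace ℝ V]

/-- The `2`-form `u ∧ v` attached through the metric to the bivector `u ∧ v`:
`(u ∧ v)(x, y) = g(u, x) g(v, y) - g(u, y) g(v, x)`. -/
def wedge (u v : V) : V [⋀^Fin 2]→L[ℝ] ℝ :=
  ContinuousMultilinearMap.alternatization
    ((ContinuousMultilinearMap.mkPiAlgebra ℝ (Fin 2) ℝ).compContinuousLinearMap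
      ![innerSL ℝ u, innerSL ℝ v])

lemma wedge_apply (u v x y : V) : wedge u v ![x, y] = ⟪u, x⟫ * ⟪v, y⟫ - ⟪u, y⟫ * ⟪v, x⟫ := by
  have h : (Finset.univ : Finset (Equiv.Perm (Fin 2))) = {1, Equiv.swap 0 1} := by decide
  have h' : (1 : Equiv.Perm (Fin 2)) ≠ Equiv.swap 0 1 := by decide
  simp [wedge, ContinuousMultilinearMap.alternatization_apply_apply, Fin.prod_univ_two, h,
    Finset.sum_pair h', sub_eq_add_neg]

variable [Fact (finrank ℝ V = 4)] (o : Orientation ℝ V (Fin 4))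

/-- A positively oriented orthonormal basis of `V`. Everything below that is built from it is a
metric contraction, hence does not depend on its choice. -/
def frame : OrthonormalBasis (Fin 4) ℝ V :=
  o.finOrthonormalBasis (by norm_num) Fact.out

lemma append_update {α : Type*} {k l n : ℕ} (hkl : k + l = n) (u : Fin k → α) [DecidableEq (Fin l)]
    (w : Fin l → α) (i : Fin l) (x : α) :
    Fin.append u (Function.update w i x) ∘ Fin.cast hkl.symm =
      Function.update (Fin.append u w ∘ Fin.cast hkl.symm) (Fin.cast hkl (Fin.natAdd k i)) x := by
  subst hkl
  ext j
  refine Fin.addCases (fun a => ?_) (fun a => ?_) j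
  · have : Fin.castAdd l a ≠ Fin.natAdd k i := by
      intro h
      have := congrArg Fin.val h
      simp at this
      omega
    simp [Function.update_of_ne this]
  · by_cases h : a = i
    · subst h
      simp
    · have : Fin.natAdd k a ≠ Fin.natAdd k i := by simpa using h
      simp [Function.update_of_ne this, Function.update_of_ne h]

/-- The `l`-form `vol(u₁, …, u_k, ·, …, ·)`, where `k + l = 4`. -/
def volContract {k l : ℕ} (hkl : k + l = 4) (u : Fin k → V) : V [⋀^Fin l]→L[ℝ] ℝ :=
  AlternatingMap.mkContinuous
    { toFun := fun w => o.volumeForm (Fin.append u w ∘ Fin.cast hkl.symm)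
      map_update_add' := by
        intro _ w i x y
        simp only [append_update hkl, AlternatingMap.map_update_add]
      map_update_smul' := by
        intro _ w i c x
        simp only [append_update hkl, AlternatingMap.map_update_smul]
      map_eq_zero_of_eq' := by
        intro w i j hw hij
        refine o.volumeForm.map_eq_zero_of_eq _ (i := Fin.cast hkl (Fin.natAdd k i))
          (j := Fin.cast hkl (Fin.natAdd k j)) ?_ ?_
        · simp [hw]
        · simpa using hij }
    (∏ i, ‖u i‖) (by
      intro w
      refine (o.abs_volumeForm_apply_le _).trans (le_of_eq ?_)
      rw [← Fintype.prod_equiv (finCongr hkl)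
        (fun i => ‖Fin.append u w i‖) _ (fun i => by simp), Fin.prod_univ_add]
      simp)

/-- The Hodge star operator `* : Λ^k → Λ^l`, where `k + l = 4`, normalised by
`α ∧ *β = ⟨α, β⟩ vol`:
`*β = (1 / k!) ∑ β(e_{i₁}, …, e_{i_k}) vol(e_{i₁}, …, e_{i_k}, ·, …, ·)`. -/
def hodgeStar {k l : ℕ} (hkl : k + l = 4) : (V [⋀^Fin k]→L[ℝ] ℝ) →ₗ[ℝ] (V [⋀^Fin l]→L[ℝ] ℝ) where
  toFun β := (k.factorial : ℝ)⁻¹ • ∑ f : Fin k → Fin 4,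
    β (fun i => frame o (f i)) • volContract o hkl (fun i => frame o (f i))
  map_add' α β := by simp [add_smul, Finset.sum_add_distrib]
  map_smul' c β := by simp [mul_smul, Finset.smul_sum, smul_comm c]

/-- Self-dual two-forms, `Λ₊`. -/
def selfDual : Submodule ℝ (V [⋀^Fin 2]→L[ℝ] ℝ) :=
  LinearMap.eqLocus (hodgeStar o (k := 2) (l := 2) rfl) LinearMap.id

/-- Anti-self-dual two-forms, `Λ₋`. -/
def antiSelfDual : Submodule ℝ (V [⋀^Fin 2]→L[ℝ] ℝ) :=
  LinearMap.eqLocus (hodgeStar o (k := 2) (l := 2) rfl) (-LinearMap.id)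

/-- The self-dual part `α₊ = (α + *α) / 2` of a two-form. -/
def plusPart : (V [⋀^Fin 2]→L[ℝ] ℝ) →ₗ[ℝ] (V [⋀^Fin 2]→L[ℝ] ℝ) :=
  (2⁻¹ : ℝ) • (LinearMap.id + hodgeStar o rfl)

/-- The anti-self-dual part `α₋ = (α - *α) / 2` of a two-form. -/
def minusPart : (V [⋀^Fin 2]→L[ℝ] ℝ) →ₗ[ℝ] (V [⋀^Fin 2]→L[ℝ] ℝ) :=
  (2⁻¹ : ℝ) • (LinearMap.id - hodgeStar o rfl)

/-- The inner product of two-forms for which the `e_i ∧ e_j`, `i < j`, are orthonormal. -/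
def twoFormInner (α β : V [⋀^Fin 2]→L[ℝ] ℝ) : ℝ :=
  2⁻¹ * ∑ i, ∑ j, α ![frame o i, frame o j] * β ![frame o i, frame o j]

/-- The two-form with components `A(e_i, e_j)`, for a skew-symmetric bilinear `A`. -/
def twoFormOf (A : V → V → ℝ) : V [⋀^Fin 2]→L[ℝ] ℝ :=
  (2⁻¹ : ℝ) • ∑ i, ∑ j, A (frame o i) (frame o j) • wedge (frame o i) (frame o j)

/-- The endomorphism `L` of `Λ²` corresponding, through the metric, to an element `T` of
`Λ² ⊗ Λ²`: it satisfies `⟨L(X ∧ Y), Z ∧ W⟩ = T(X, Y, Z, W)`. -/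
def operatorOf (T : V → V → V → V → ℝ) :
    (V [⋀^Fin 2]→L[ℝ] ℝ) →ₗ[ℝ] (V [⋀^Fin 2]→L[ℝ] ℝ) where
  toFun α := (2⁻¹ : ℝ) • ∑ i, ∑ j, α ![frame o i, frame o j] •
    twoFormOf o (T (frame o i) (frame o j))
  map_add' α β := by simp [add_smul, Finset.sum_add_distrib]
  map_smul' c β := by simp [mul_smul, Finset.smul_sum, smul_comm c]

/-- The transpose `L†` of an endomorphism of `Λ²`, `⟨L† α, β⟩ = ⟨α, L β⟩`. -/
def transposeOp (L : (V [⋀^Fin 2]→L[ℝ] ℝ) →ₗ[ℝ] (V [⋀^Fin 2]→L[ℝ] ℝ)) :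
    (V [⋀^Fin 2]→L[ℝ] ℝ) →ₗ[ℝ] (V [⋀^Fin 2]→L[ℝ] ℝ) where
  toFun α := twoFormOf o fun x y => twoFormInner o α (L (wedge x y))
  map_add' α β := by
    simp [twoFormOf, twoFormInner, add_smul, mul_add, add_mul, Finset.sum_add_distrib]
  map_smul' c β := by
    simp only [twoFormOf, twoFormInner, ContinuousAlternatingMap.smul_apply, smul_eq_mul,
      RingHom.id_apply, Finset.smul_sum, Finset.mul_sum, smul_smul, Finset.sum_smul]
    refine Finset.sum_congr rfl fun i _ => Finset.sum_congr rfl fun j _ =>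
      Finset.sum_congr rfl fun k _ => Finset.sum_congr rfl fun l _ => ?_
    congr 1
    ring

/-- The commutator `[α, β]` of two-forms regarded as skew-symmetric matrices `α_{ij} = α(e_i, e_j)`
in an orthonormal basis. -/
def twoFormBracket (α β : V [⋀^Fin 2]→L[ℝ] ℝ) : V [⋀^Fin 2]→L[ℝ] ℝ :=
  twoFormOf o fun x y =>
    ∑ k, (α ![x, frame o k] * β ![frame o k, y] - β ![x, frame o k] * α ![frame o k, y])

/-- A two-form `α` as an endomorphism of `Λ²`: `α(β) = [*α, β]`. Thus `α ∈ Λ₊` acts on `Λ₊` by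
`β ↦ [α, β]` and `α ∈ Λ₋` acts on `Λ₋` by `β ↦ -[α, β]`. In both cases, in terms of the basis
`f₁ = e₁∧e₂ ± e₃∧e₄`, `f₂ = e₁∧e₃ ∓ e₂∧e₄`, `f₃ = e₁∧e₄ ± e₂∧e₃` of `Λ_±`, the form
`α = a₁ f₁ + a₂ f₂ + a₃ f₃` acts by the skew-symmetric matrix
`2 (0, a₃, -a₂; -a₃, 0, a₁; a₂, -a₁, 0)`. -/
def formAction (α β : V [⋀^Fin 2]→L[ℝ] ℝ) : V [⋀^Fin 2]→L[ℝ] ℝ :=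
  twoFormBracket o (hodgeStar o rfl α) β

/-- The Ricci contraction of an endomorphism of `Λ²`:
`(X, Y) ↦ ∑ i, ⟨L(e_i ∧ X), e_i ∧ Y⟩`. -/
def ricciContraction (L : (V [⋀^Fin 2]→L[ℝ] ℝ) →ₗ[ℝ] (V [⋀^Fin 2]→L[ℝ] ℝ)) (X Y : V) : ℝ :=
  ∑ i, twoFormInner o (L (wedge (frame o i) X)) (wedge (frame o i) Y)

/-- The `2`-tensor corresponding to a block `B : Λ₋ → Λ₊` (extended by zero to `Λ²`): the Ricci
contraction of the symmetric endomorphism `(0, B; B†, 0)` of `Λ² = Λ₊ ⊕ Λ₋`. This is the standard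
isomorphism from `Hom(Λ₋, Λ₊)` to the symmetric trace-free `2`-tensors. -/
def blockTensor (B : (V [⋀^Fin 2]→L[ℝ] ℝ) →ₗ[ℝ] (V [⋀^Fin 2]→L[ℝ] ℝ)) (X Y : V) : ℝ :=
  ricciContraction o (B + transposeOp o B) X Y

end Algebra

/-! ### Oriented Riemannian four-manifolds and their connections -/

section Manifold

variable {M : Type*} [TopologicalSpace M] [ChartedSpace (EuclideanSpace ℝ (Fin 4)) M]

instance (x : M) : Fact (finrank ℝ (TangentSpace (𝓡 4) x) = 4) :=
  ⟨by
    change finrank ℝ (EuclideanSpace ℝ (Fin 4)) = 4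
    simp⟩

/-- A choice of orientation of every tangent space is an orientation of the manifold if it is
locally constant: a frame at `x`, extended with constant coefficients in a chart around `x`, has
the same sign at all points near `x`. -/
def IsOrientation [IsManifold (𝓡 4) ∞ M]
    (o : ∀ x : M, Orientation ℝ (TangentSpace (𝓡 4) x) (Fin 4)) : Prop :=
  ∀ x : M, ∀ᶠ y in 𝓝 x, ∀ (b : Basis (Fin 4) ℝ (TangentSpace (𝓡 4) x))
    (b' : Basis (Fin 4) ℝ (TangentSpace (𝓡 4) y)),
    (∀ i, b' i = FiberBundle.extend (EuclideanSpace ℝ (Fin 4)) (b i) y) →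
      (b.orientation = o x ↔ b'.orientation = o y)

/-- The exterior derivative of a `k`-form on `M`: its value at `x` is computed in the chart
`φ` at `x`, as `φ^* d ((φ⁻¹)^* α)`. -/
def extD {k : ℕ} (α : ∀ x : M, TangentSpace (𝓡 4) x [⋀^Fin k]→L[ℝ] ℝ) (x : M) :
    TangentSpace (𝓡 4) x [⋀^Fin (k + 1)]→L[ℝ] ℝ :=
  (extDeriv (fun z : EuclideanSpace ℝ (Fin 4) =>
    (α ((extChartAt (𝓡 4) x).symm z)).compContinuousLinearMap
      (mfderiv 𝓘(ℝ, EuclideanSpace ℝ (Fin 4)) (𝓡 4) (extChartAt (𝓡 4) x).symm z))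
    (extChartAt (𝓡 4) x x)).compContinuousLinearMap
      (mfderiv (𝓡 4) 𝓘(ℝ, EuclideanSpace ℝ (Fin 4)) (extChartAt (𝓡 4) x) x)

variable [RiemannianBundle (fun x : M => TangentSpace (𝓡 4) x)]
  (o : ∀ x : M, Orientation ℝ (TangentSpace (𝓡 4) x) (Fin 4))

/-- The Hodge star of a field of forms. -/
def starField {k l : ℕ} (hkl : k + l = 4) (α : ∀ x : M, TangentSpace (𝓡 4) x [⋀^Fin k]→L[ℝ] ℝ)
    (x : M) : TangentSpace (𝓡 4) x [⋀^Fin l]→L[ℝ] ℝ :=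
  hodgeStar (o x) hkl (α x)

/-- The codifferential `d^* = - * d *` on `(k+1)`-forms in dimension four. -/
def codiff {k l : ℕ} (h : (k + 1) + l = 4) (h' : (l + 1) + k = 4)
    (α : ∀ x : M, TangentSpace (𝓡 4) x [⋀^Fin (k + 1)]→L[ℝ] ℝ) (x : M) :
    TangentSpace (𝓡 4) x [⋀^Fin k]→L[ℝ] ℝ :=
  -starField o h' (extD (starField o h α)) x

variable [IsManifold (𝓡 4) ∞ M]

/-- The curvature `R(X, Y)Z = ∇_X ∇_Y Z - ∇_Y ∇_X Z - ∇_{[X, Y]} Z` of a connection at a point,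
evaluated on the local extensions of tangent vectors with constant coefficients in the chart at that
point (for a smooth connection the value does not depend on the extensions). -/
def curvature
    (cov : CovariantDerivative (𝓡 4) (EuclideanSpace ℝ (Fin 4))
      (fun x : M => TangentSpace (𝓡 4) x)) (x : M)
    (u v w : TangentSpace (𝓡 4) x) : TangentSpace (𝓡 4) x :=
  letI X : ∀ y : M, TangentSpace (𝓡 4) y := FiberBundle.extend (EuclideanSpace ℝ (Fin 4)) u
  letI Y : ∀ y : M, TangentSpace (𝓡 4) y := FiberBundle.extend (EuclideanSpace ℝ (Fin 4)) v
  letI Z : ∀ y : M, TangentSpace (𝓡 4) y := FiberBundle.extend (EuclideanSpace ℝ (Fin 4)) w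
  cov (fun y => cov Z y (Y y)) x u - cov (fun y => cov Z y (X y)) x v -
    cov Z x (VectorField.mlieBracket (𝓡 4) X Y x)

/-- The curvature as a `(0,4)`-tensor, with the sign for which `R(X, Y, X, Y)` is the sectional
curvature on orthonormal `X, Y` when `cov` is the Levi-Civita connection. -/
def curvatureTensor
    (cov : CovariantDerivative (𝓡 4) (EuclideanSpace ℝ (Fin 4))
      (fun x : M => TangentSpace (𝓡 4) x))
    (x : M) (X Y Z W : TangentSpace (𝓡 4) x) : ℝ :=
  -⟪curvature cov x X Y Z, W⟫

/-- The curvature operator `Λ² → Λ²`, `⟨R(X ∧ Y), Z ∧ W⟩ = R(X, Y, Z, W)`. -/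
def curvatureOperator
    (cov : CovariantDerivative (𝓡 4) (EuclideanSpace ℝ (Fin 4))
      (fun x : M => TangentSpace (𝓡 4) x))
    (x : M) : (TangentSpace (𝓡 4) x [⋀^Fin 2]→L[ℝ] ℝ) →ₗ[ℝ]
      (TangentSpace (𝓡 4) x [⋀^Fin 2]→L[ℝ] ℝ) :=
  operatorOf (o x) (curvatureTensor cov x)

/-- The Ricci tensor `Ric(X, Y) = ∑ i, R(e_i, X, e_i, Y)`. -/
def ricci
    (cov : CovariantDerivative (𝓡 4) (EuclideanSpace ℝ (Fin 4))
      (fun x : M => TangentSpace (𝓡 4) x))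
    (x : M) (X Y : TangentSpace (𝓡 4) x) : ℝ :=
  ∑ i, curvatureTensor cov x (frame (o x) i) X (frame (o x) i) Y

/-- The scalar curvature. -/
def scalar
    (cov : CovariantDerivative (𝓡 4) (EuclideanSpace ℝ (Fin 4))
      (fun x : M => TangentSpace (𝓡 4) x))
    (x : M) : ℝ :=
  ∑ i, ricci o cov x (frame (o x) i) (frame (o x) i)

/-- The symmetrization `S(T)(X, Y) = (T(X, Y) + T(Y, X)) / 2` of a `2`-tensor. -/
def symmetrize {V : Type*} (T : V → V → ℝ) (X Y : V) : ℝ :=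
  (T X Y + T Y X) / 2

/-- The symmetric trace-free part of the Ricci tensor. -/
def tracelessRicci
    (cov : CovariantDerivative (𝓡 4) (EuclideanSpace ℝ (Fin 4))
      (fun x : M => TangentSpace (𝓡 4) x))
    (x : M) (X Y : TangentSpace (𝓡 4) x) : ℝ :=
  symmetrize (ricci o cov x) X Y - scalar o cov x / 4 * ⟪X, Y⟫

/-- The Weyl tensor in dimension four, to be applied to the Levi-Civita connection. -/
def weylTensor
    (cov : CovariantDerivative (𝓡 4) (EuclideanSpace ℝ (Fin 4))
      (fun x : M => TangentSpace (𝓡 4) x))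
    (x : M) (X Y Z W : TangentSpace (𝓡 4) x) : ℝ :=
  curvatureTensor cov x X Y Z W
    - (⟪X, Z⟫ * ricci o cov x Y W - ⟪X, W⟫ * ricci o cov x Y Z
        - ⟪Y, Z⟫ * ricci o cov x X W + ⟪Y, W⟫ * ricci o cov x X Z) / 2
    + scalar o cov x / 6 * (⟪X, Z⟫ * ⟪Y, W⟫ - ⟪X, W⟫ * ⟪Y, Z⟫)

/-- The Weyl operator `Λ² → Λ²`. -/
def weylOperator
    (cov : CovariantDerivative (𝓡 4) (EuclideanSpace ℝ (Fin 4))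
      (fun x : M => TangentSpace (𝓡 4) x))
    (x : M) : (TangentSpace (𝓡 4) x [⋀^Fin 2]→L[ℝ] ℝ) →ₗ[ℝ]
      (TangentSpace (𝓡 4) x [⋀^Fin 2]→L[ℝ] ℝ) :=
  operatorOf (o x) (weylTensor o cov x)

/-- The self-dual part `W⁺` of the Weyl operator. -/
def weylPlus
    (cov : CovariantDerivative (𝓡 4) (EuclideanSpace ℝ (Fin 4))
      (fun x : M => TangentSpace (𝓡 4) x))
    (x : M) : (TangentSpace (𝓡 4) x [⋀^Fin 2]→L[ℝ] ℝ) →ₗ[ℝ]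
      (TangentSpace (𝓡 4) x [⋀^Fin 2]→L[ℝ] ℝ) :=
  plusPart (o x) ∘ₗ weylOperator o cov x ∘ₗ plusPart (o x)

/-- The anti-self-dual part `W⁻` of the Weyl operator. -/
def weylMinus
    (cov : CovariantDerivative (𝓡 4) (EuclideanSpace ℝ (Fin 4))
      (fun x : M => TangentSpace (𝓡 4) x))
    (x : M) : (TangentSpace (𝓡 4) x [⋀^Fin 2]→L[ℝ] ℝ) →ₗ[ℝ]
      (TangentSpace (𝓡 4) x [⋀^Fin 2]→L[ℝ] ℝ) :=
  minusPart (o x) ∘ₗ weylOperator o cov x ∘ₗ minusPart (o x)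

/-- The covariant derivative of a one-form, `(∇_X h)(Y) = X(h(Y)) - h(∇_X Y)`, where the vector `v`
is extended to a vector field `Y` with constant coefficients in the chart at `x`. -/
def covOneForm
    (cov : CovariantDerivative (𝓡 4) (EuclideanSpace ℝ (Fin 4))
      (fun x : M => TangentSpace (𝓡 4) x))
    (h : ∀ x : M, TangentSpace (𝓡 4) x [⋀^Fin 1]→L[ℝ] ℝ) (x : M)
    (u v : TangentSpace (𝓡 4) x) : ℝ :=
  mvfderiv (𝓡 4) (fun y : M => h y ![FiberBundle.extend (EuclideanSpace ℝ (Fin 4)) v y]) x u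
    - h x ![cov (FiberBundle.extend (EuclideanSpace ℝ (Fin 4)) v) x u]

variable [IsContMDiffRiemannianBundle (𝓡 4) ∞ (EuclideanSpace ℝ (Fin 4))
  (fun x : M => TangentSpace (𝓡 4) x)]

instance : IsContMDiffRiemannianBundle (𝓡 4) 1 (EuclideanSpace ℝ (Fin 4))
    (fun x : M => TangentSpace (𝓡 4) x) :=
  IsContMDiffRiemannianBundle.of_le (n := ∞) (by exact_mod_cast le_top)

/-- `cov` is the Levi-Civita connection, i.e. the metric and torsion-free connection. -/
def IsLeviCivita
    (cov : CovariantDerivative (𝓡 4) (EuclideanSpace ℝ (Fin 4))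
      (fun x : M => TangentSpace (𝓡 4) x)) : Prop :=
  cov.IsMetricCompatible ∧ cov.torsion = 0

/-- `cov` is a metric connection with skew torsion `H`: it is metric and its torsion `T` satisfies
`g(T(X, Y), Z) = H(X, Y, Z)` for the three-form `H`. -/
def HasSkewTorsion
    (cov : CovariantDerivative (𝓡 4) (EuclideanSpace ℝ (Fin 4))
      (fun x : M => TangentSpace (𝓡 4) x))
    (H : ∀ x : M, TangentSpace (𝓡 4) x [⋀^Fin 3]→L[ℝ] ℝ) : Prop :=
  cov.IsMetricCompatible ∧
    ∀ (x : M) (X Y Z : TangentSpace (𝓡 4) x), ⟪cov.torsion x X Y, Z⟫ = H x ![X, Y, Z]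

/-- A metric connection with skew torsion differs from the Levi-Civita connection by half of its
torsion. In particular the latter exists. -/
lemma exists_isLeviCivita
    {cov : CovariantDerivative (𝓡 4) (EuclideanSpace ℝ (Fin 4))
      (fun x : M => TangentSpace (𝓡 4) x)}
    {H : ∀ x : M, TangentSpace (𝓡 4) x [⋀^Fin 3]→L[ℝ] ℝ} (h : HasSkewTorsion cov H) :
    ∃ nablaG : CovariantDerivative (𝓡 4) (EuclideanSpace ℝ (Fin 4))
      (fun x : M => TangentSpace (𝓡 4) x),
      IsLeviCivita nablaG := by
  refine ⟨cov.addOneForm fun x => (2⁻¹ : ℝ) • cov.torsion x, ?_, ?_⟩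
  · ext x u v w
    have hT : ⟪cov.torsion x u w, v⟫ + ⟪u, cov.torsion x v w⟫ = 0 := by
      rw [real_inner_comm (cov.torsion x v w) u, h.2, h.2]
      have := (H x).map_swap ![u, w, v] (i := 0) (j := 2) (by decide)
      have e : ![u, w, v] ∘ Equiv.swap (0 : Fin 3) 2 = ![v, w, u] := by
        ext i
        fin_cases i <;> rfl
      rw [e] at this
      simp only [ContinuousAlternatingMap.coe_toAlternatingMap] at this
      linarith
    have hm := DFunLike.congr_fun (DFunLike.congr_fun (DFunLike.congr_fun (congrFun h.1 x) u) v) w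
    rw [CovariantDerivative.derivMetricTensor_apply_eq_extend] at hm ⊢
    simp only [CovariantDerivative.addOneForm, FiberBundle.extend_apply_self,
      _root_.add_apply, _root_.smul_apply, inner_add_left,
      inner_add_right, real_inner_smul_left, real_inner_smul_right,
      _root_.zero_apply, Pi.zero_apply] at hm hT ⊢
    linarith
  · ext1 x
    ext1 u
    ext1 v
    have h1 := cov.torsion_apply_eq_extend u v
    rw [CovariantDerivative.torsion_apply_eq_extend]
    simp only [CovariantDerivative.addOneForm, FiberBundle.extend_apply_self,
      _root_.add_apply, _root_.smul_apply,
      _root_.zero_apply, Pi.zero_apply] at h1 ⊢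
    rw [cov.torsion_antisymm v u]
    have h2 : cov (FiberBundle.extend (EuclideanSpace ℝ (Fin 4)) v) x u
        - cov (FiberBundle.extend (EuclideanSpace ℝ (Fin 4)) u) x v
        - VectorField.mlieBracket (𝓡 4) (FiberBundle.extend (EuclideanSpace ℝ (Fin 4)) u)
          (FiberBundle.extend (EuclideanSpace ℝ (Fin 4)) v) x
        - cov.torsion x u v = 0 := by rw [← h1, sub_self]
    rw [← h2]
    module

end Manifold

end SkewTorsion

end

open SkewTorsion

namespace SkewTorsion

/-! Put `T` for the torsion of `∇`. Since `T` is skew, `∇ = ∇^g + T/2`, so the curvature of `∇` is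
the Riemannian curvature plus terms linear in `∇H` and terms quadratic in `H`. At a point, in an
oriented orthonormal frame, everything is therefore encoded in three arrays: the Riemann tensor `g`,
the dual one-form `t = *H`, and `n = ∇(*H)`, the derivative being taken with `∇` itself.
`curvatureTensor_frame` is this expression of the curvature, `torsionCurvature g t n`.

The other ingredients are read off from `n`: its symmetrization is `S(∇*H)`, minus its trace is
`*dH` (`starField_extD`), and its skew part gives `d^*H` (`codiff_frame`). Writing `dH` and `d*H`
through `∇` produces torsion corrections in principle. In dimension four they vanish, because `H`
contracted with itself over one index has no component with four distinct free indices, and because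
`*H` annihilates every `T(X, Y)`.

What remains is linear algebra on two-forms. On the diagonal blocks the quadratic terms act as
multiples of the identity and are absorbed in the passage from the Riemannian scalar curvature to
that of `∇`; the trace of `n` gives the `*dH` terms, the skew part of `n` the skew endomorphism, and
the trace-free symmetric part of `n` does not contribute. For a mixed block one expands `P₊ R P₋ = ¼
(R - *R* + *R - R*)`: the first two terms contract to the trace-free symmetric Ricci tensor
(`blockTensor_of_skew`), and the last two see only the part of `R` that is skew under exchange of
the two index pairs. The Riemann tensor and the quadratic terms are symmetric under this exchange,
so that part comes from `∇H` alone and equals the trace-free symmetric part of `n`, that is `S(∇*H)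
+ (*dH/4) g` (`pairSkewContraction_torsionCurvature`). Interchanging `Λ₊` and `Λ₋` changes its sign.

The analysis is done with fields of constant coefficients in a chart, whose Lie brackets vanish, and
reduces to derivatives of the scalar functions `christoffel`. The orthonormal frames are chosen
pointwise, without any continuity, so `*H` is differentiated through an identity that involves only
constant fields and their volume (`starComponent_mul_frameVolume`). -/

/-- The Levi-Civita symbol in dimension four. -/
def leviCivitaSymbol (i j k l : Fin 4) : ℤ :=
  -- This is the Vandermonde product of `i, j, k, l`: it vanishes when two indices agree, and for a
  -- permutation it is the sign times `1! 2! 3! = 12`, so the integer division is exact.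
  ((j : ℤ) - i) * ((k : ℤ) - i) * ((l : ℤ) - i) * ((k : ℤ) - j) * ((l : ℤ) - j) * ((l : ℤ) - k) / 12

lemma det_fin_four {R : Type*} [CommRing R] (A : Matrix (Fin 4) (Fin 4) R) : A.det =
    A 0 0 * (A 1 1 * (A 2 2 * A 3 3 - A 2 3 * A 3 2) - A 1 2 * (A 2 1 * A 3 3 - A 2 3 * A 3 1)
      + A 1 3 * (A 2 1 * A 3 2 - A 2 2 * A 3 1))
    - A 0 1 * (A 1 0 * (A 2 2 * A 3 3 - A 2 3 * A 3 2) - A 1 2 * (A 2 0 * A 3 3 - A 2 3 * A 3 0)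
      + A 1 3 * (A 2 0 * A 3 2 - A 2 2 * A 3 0))
    + A 0 2 * (A 1 0 * (A 2 1 * A 3 3 - A 2 3 * A 3 1) - A 1 1 * (A 2 0 * A 3 3 - A 2 3 * A 3 0)
      + A 1 3 * (A 2 0 * A 3 1 - A 2 1 * A 3 0))
    - A 0 3 * (A 1 0 * (A 2 1 * A 3 2 - A 2 2 * A 3 1) - A 1 1 * (A 2 0 * A 3 2 - A 2 2 * A 3 0)
      + A 1 2 * (A 2 0 * A 3 1 - A 2 1 * A 3 0)) := by
  simp [Matrix.det_succ_row_zero, Fin.sum_univ_succ, Fin.succAbove]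
  ring

/-- Working over `ℤ` leaves 256 decidable cases. `volumeForm_frame` carries the result to `ℝ` along
the ring homomorphism. -/
lemma det_single (i j k l : Fin 4) :
    (Matrix.of fun a b : Fin 4 => if a = ![i, j, k, l] b then (1 : ℤ) else 0).det =
      leviCivitaSymbol i j k l := by
  rw [det_fin_four]
  simp only [Matrix.of_apply, leviCivitaSymbol]
  revert i j k l
  decide

/-! ### Forms and operators in a positively oriented orthonormal frame. -/

section Algebra

variable {V : Type*} [NormedAddCommGroup V] [InnerProductSpace ℝ V]

lemma twoForm_swap (α : V [⋀^Fin 2]→L[ℝ] ℝ) (x y : V) : α ![y, x] = -α ![x, y] := by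
  have h := α.toAlternatingMap.map_swap ![x, y] (i := 0) (j := 1) (by decide)
  have e : ![x, y] ∘ Equiv.swap (0 : Fin 2) 1 = ![y, x] := by
    ext i
    fin_cases i <;> rfl
  rwa [e] at h

lemma twoForm_self (α : V [⋀^Fin 2]→L[ℝ] ℝ) (x : V) : α ![x, x] = 0 :=
  α.map_eq_zero_of_eq _ (i := 0) (j := 1) rfl (by decide)

variable [Fact (finrank ℝ V = 4)] (o : Orientation ℝ V (Fin 4))

lemma volumeForm_frame (i j k l : Fin 4) :
    o.volumeForm ![frame o i, frame o j, frame o k, frame o l] = leviCivitaSymbol i j k l := by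
  have ho : (frame o).toBasis.orientation = o :=
    o.finOrthonormalBasis_orientation (by norm_num) Fact.out
  rw [o.volumeForm_robust (frame o) ho, Basis.det_apply, ← det_single]
  change _ = Int.castRingHom ℝ _
  rw [RingHom.map_det]
  congr 1
  ext a b
  fin_cases b <;> simp [Basis.toMatrix_apply, OrthonormalBasis.coe_toBasis_repr_apply, eq_comm]

/-- Unrolls the sum over multi-indices in `hodgeStar` into iterated sums over single indices. -/
lemma sum_fin_succ_arrow {n : ℕ} {β : Type*} [AddCommMonoid β] (F : (Fin (n + 1) → Fin 4) → β) :
    ∑ f, F f = ∑ i, ∑ g : Fin n → Fin 4, F (Matrix.vecCons i g) := by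
  rw [← (Fin.consEquiv fun _ => Fin 4).sum_comp, Fintype.sum_prod_type]
  rfl

lemma volContract_apply {k l : ℕ} (hkl : k + l = 4) (u : Fin k → V) (w : Fin l → V) :
    volContract o hkl u w = o.volumeForm (Fin.append u w ∘ Fin.cast hkl.symm) :=
  rfl

lemma hodgeStar_apply {k l : ℕ} (hkl : k + l = 4) (β : V [⋀^Fin k]→L[ℝ] ℝ) (w : Fin l → V) :
    hodgeStar o hkl β w = (k.factorial : ℝ)⁻¹ * ∑ f : Fin k → Fin 4,
      β (fun i => frame o (f i)) *
        o.volumeForm (Fin.append (fun i => frame o (f i)) w ∘ Fin.cast hkl.symm) := by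
  simp [hodgeStar, volContract_apply]

lemma hodgeStar_two_apply (β : V [⋀^Fin 2]→L[ℝ] ℝ) (i j : Fin 4) :
    hodgeStar o (k := 2) (l := 2) rfl β ![frame o i, frame o j] = 2⁻¹ * ∑ a, ∑ b,
      β ![frame o a, frame o b] * leviCivitaSymbol a b i j := by
  rw [hodgeStar_apply]
  simp only [sum_fin_succ_arrow, Finset.univ_unique, Finset.sum_singleton]
  congr 1
  refine Finset.sum_congr rfl fun a _ => Finset.sum_congr rfl fun b _ => ?_
  rw [← volumeForm_frame o]
  congr 2 <;> ext m <;> fin_cases m <;> rfl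

lemma hodgeStar_three_apply (β : V [⋀^Fin 3]→L[ℝ] ℝ) (i : Fin 4) :
    hodgeStar o (k := 3) (l := 1) rfl β ![frame o i] = 6⁻¹ * ∑ a, ∑ b, ∑ c,
      β ![frame o a, frame o b, frame o c] * leviCivitaSymbol a b c i := by
  rw [hodgeStar_apply]
  simp only [sum_fin_succ_arrow, Finset.univ_unique, Finset.sum_singleton]
  congr 1
  refine Finset.sum_congr rfl fun a _ => Finset.sum_congr rfl fun b _ =>
    Finset.sum_congr rfl fun c _ => ?_
  rw [← volumeForm_frame o]
  congr 2 <;> ext m <;> fin_cases m <;> rfl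

lemma hodgeStar_four_apply (β : V [⋀^Fin 4]→L[ℝ] ℝ) :
    hodgeStar o (k := 4) (l := 0) rfl β ![] = 24⁻¹ * ∑ a, ∑ b, ∑ c, ∑ d,
      β ![frame o a, frame o b, frame o c, frame o d] * leviCivitaSymbol a b c d := by
  rw [hodgeStar_apply]
  simp only [sum_fin_succ_arrow, Finset.univ_unique, Finset.sum_singleton]
  congr 1
  refine Finset.sum_congr rfl fun a _ => Finset.sum_congr rfl fun b _ =>
    Finset.sum_congr rfl fun c _ => Finset.sum_congr rfl fun d _ => ?_
  rw [← volumeForm_frame o]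
  congr 2 <;> ext m <;> fin_cases m <;> rfl

lemma twoForm_ext_frame {α β : V [⋀^Fin 2]→L[ℝ] ℝ}
    (h : ∀ i j, i < j → α ![frame o i, frame o j] = β ![frame o i, frame o j]) : α = β := by
  apply ContinuousAlternatingMap.toAlternatingMap_injective
  refine (frame o).toBasis.ext_alternating fun v hv => ?_
  have e : (fun i => (frame o).toBasis (v i)) = ![frame o (v 0), frame o (v 1)] := by
    ext m; fin_cases m <;> simp
  rw [e]
  rcases lt_trichotomy (v 0) (v 1) with h' | h' | h'
  · exact h _ _ h'
  · exact absurd (hv h') (by decide)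
  · change α _ = β _
    rw [twoForm_swap, h _ _ h', twoForm_swap β]
    simp

lemma wedge_frame (i j k l : Fin 4) : wedge (frame o i) (frame o j) ![frame o k, frame o l] =
    (if i = k then 1 else 0) * (if j = l then 1 else 0)
      - (if i = l then 1 else 0) * (if j = k then 1 else 0) := by
  simp only [wedge_apply, orthonormal_iff_ite.mp (frame o).orthonormal]

/-- No skewness of `A` is needed: the sum against the wedges projects onto the skew part. -/
lemma twoFormOf_frame (A : V → V → ℝ) (i j : Fin 4) :
    twoFormOf o A ![frame o i, frame o j] =
      2⁻¹ * (A (frame o i) (frame o j) - A (frame o j) (frame o i)) := by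
  simp only [twoFormOf, ContinuousAlternatingMap.smul_apply, ContinuousAlternatingMap.sum_apply,
    wedge_frame, smul_eq_mul, mul_sub, Finset.sum_sub_distrib]
  simp

lemma operatorOf_frame (T : V → V → V → V → ℝ) (α : V [⋀^Fin 2]→L[ℝ] ℝ) (k l : Fin 4) :
    operatorOf o T α ![frame o k, frame o l] = 2⁻¹ * ∑ i, ∑ j, α ![frame o i, frame o j] *
      (2⁻¹ * (T (frame o i) (frame o j) (frame o k) (frame o l) -
        T (frame o i) (frame o j) (frame o l) (frame o k))) := by
  simp [operatorOf, twoFormOf_frame]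

lemma twoFormBracket_frame (α β : V [⋀^Fin 2]→L[ℝ] ℝ) (i j : Fin 4) :
    twoFormBracket o α β ![frame o i, frame o j] =
      ∑ k, (α ![frame o i, frame o k] * β ![frame o k, frame o j]
        - β ![frame o i, frame o k] * α ![frame o k, frame o j]) := by
  rw [twoFormBracket, twoFormOf_frame, ← Finset.sum_sub_distrib, Finset.mul_sum]
  refine Finset.sum_congr rfl fun k _ => ?_
  rw [twoForm_swap α (frame o i) (frame o k), twoForm_swap β (frame o i) (frame o k),
    twoForm_swap α (frame o k) (frame o j), twoForm_swap β (frame o k) (frame o j)]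
  ring

lemma twoFormInner_wedge (α : V [⋀^Fin 2]→L[ℝ] ℝ) (i j : Fin 4) :
    twoFormInner o α (wedge (frame o i) (frame o j)) = α ![frame o i, frame o j] := by
  simp only [twoFormInner, wedge_frame, mul_sub, Finset.sum_sub_distrib]
  simp
  rw [twoForm_swap α (frame o i)]
  ring

lemma twoFormInner_comm (α β : V [⋀^Fin 2]→L[ℝ] ℝ) :
    twoFormInner o α β = twoFormInner o β α := by
  simp [twoFormInner, mul_comm]

/-- The wedges of frame vectors are orthonormal up to sign and repetition, so transposition just
exchanges the two index pairs. -/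
lemma transposeOp_wedge (L : (V [⋀^Fin 2]→L[ℝ] ℝ) →ₗ[ℝ] (V [⋀^Fin 2]→L[ℝ] ℝ)) (i j k l : Fin 4) :
    transposeOp o L (wedge (frame o i) (frame o j)) ![frame o k, frame o l] =
      L (wedge (frame o k) (frame o l)) ![frame o i, frame o j] := by
  have h : wedge (frame o l) (frame o k) = - wedge (frame o k) (frame o l) := by
    refine twoForm_ext_frame o fun a b _ => ?_
    rw [ContinuousAlternatingMap.neg_apply, wedge_apply, wedge_apply]
    ring
  have e : transposeOp o L (wedge (frame o i) (frame o j)) =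
      twoFormOf o fun x y => twoFormInner o (wedge (frame o i) (frame o j)) (L (wedge x y)) := rfl
  rw [e, twoFormOf_frame, twoFormInner_comm, twoFormInner_wedge, twoFormInner_comm,
    twoFormInner_wedge, h, map_neg, ContinuousAlternatingMap.neg_apply]
  ring

end Algebra

/-! ### Curvature arrays with four indices. -/

/-- The components of an algebraic curvature tensor. -/
structure IsAlgebraicCurvature (g : Fin 4 → Fin 4 → Fin 4 → Fin 4 → ℝ) : Prop where
  skew_left : ∀ i j k l, g j i k l = -g i j k l
  skew_right : ∀ i j k l, g i j l k = -g i j k l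
  bianchi : ∀ i j k l, g i j k l + g j k i l + g k i j l = 0

namespace IsAlgebraicCurvature

variable {g : Fin 4 → Fin 4 → Fin 4 → Fin 4 → ℝ}

/-- The classical octahedron argument: combine the four Bianchi identities that have each of the
indices in the last slot. -/
lemma pair_symm (hg : IsAlgebraicCurvature g) (i j k l : Fin 4) : g k l i j = g i j k l := by
  linarith [hg.bianchi i j k l, hg.bianchi j k l i, hg.bianchi k l i j, hg.bianchi l i j k,
    hg.skew_left i j k l, hg.skew_right i j k l, hg.skew_left k l i j, hg.skew_right k l i j,
    hg.skew_left j k i l, hg.skew_right j k i l, hg.skew_left k i j l, hg.skew_right k i j l,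
    hg.skew_left l i j k, hg.skew_right l i j k, hg.skew_left j l i k, hg.skew_right j l i k,
    hg.skew_left l j k i, hg.skew_right k i l j, hg.skew_right j k l i, hg.skew_right l i k j,
    hg.skew_left l j i k, hg.skew_right i k j l, hg.skew_left i k j l, hg.skew_right l j i k,
    hg.skew_left k i l j]

/-- Rewriting rules that bring the components of an algebraic curvature tensor to a normal form. -/
lemma rules (hg : IsAlgebraicCurvature g) :
    (∀ k l, g 1 0 k l = -g 0 1 k l) ∧ (∀ k l, g 2 0 k l = -g 0 2 k l) ∧
    (∀ k l, g 3 0 k l = -g 0 3 k l) ∧ (∀ k l, g 2 1 k l = -g 1 2 k l) ∧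
    (∀ k l, g 3 1 k l = -g 1 3 k l) ∧ (∀ k l, g 3 2 k l = -g 2 3 k l) ∧ (∀ i k l, g i i k l = 0) ∧
    (∀ k l, g k l 1 0 = -g k l 0 1) ∧ (∀ k l, g k l 2 0 = -g k l 0 2) ∧
    (∀ k l, g k l 3 0 = -g k l 0 3) ∧ (∀ k l, g k l 2 1 = -g k l 1 2) ∧
    (∀ k l, g k l 3 1 = -g k l 1 3) ∧ (∀ k l, g k l 3 2 = -g k l 2 3) ∧ (∀ i k l, g k l i i = 0) ∧
    g 0 2 0 1 = g 0 1 0 2 ∧ g 0 3 0 1 = g 0 1 0 3 ∧ g 0 3 0 2 = g 0 2 0 3 ∧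
    g 1 2 0 1 = g 0 1 1 2 ∧ g 1 2 0 2 = g 0 2 1 2 ∧ g 1 3 0 1 = g 0 1 1 3 ∧
    g 1 3 0 2 = g 0 2 1 3 ∧ g 1 3 0 3 = g 0 3 1 3 ∧ g 1 3 1 2 = g 1 2 1 3 ∧
    g 2 3 0 1 = g 0 1 2 3 ∧ g 2 3 0 2 = g 0 2 2 3 ∧ g 2 3 0 3 = g 0 3 2 3 ∧
    g 2 3 1 2 = g 1 2 2 3 ∧ g 2 3 1 3 = g 1 3 2 3 ∧ g 0 3 1 2 = g 0 2 1 3 - g 0 1 2 3 ∧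
    g 1 2 0 3 = g 0 2 1 3 - g 0 1 2 3 := by
  have hl : ∀ i k l, g i i k l = 0 := fun i k l => by linarith [hg.skew_left i i k l]
  have hr : ∀ i k l, g k l i i = 0 := fun i k l => by linarith [hg.skew_right k l i i]
  -- Given pair symmetry, this is the only independent Bianchi identity in dimension four; it
  -- eliminates one component.
  have hb : g 0 3 1 2 = g 0 2 1 3 - g 0 1 2 3 := by
    linarith [hg.bianchi 0 1 2 3, hg.pair_symm 0 3 1 2, hg.skew_left 0 2 1 3]
  refine ⟨fun k l => hg.skew_left _ _ k l, fun k l => hg.skew_left _ _ k l,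
    fun k l => hg.skew_left _ _ k l, fun k l => hg.skew_left _ _ k l,
    fun k l => hg.skew_left _ _ k l, fun k l => hg.skew_left _ _ k l, hl,
    fun k l => hg.skew_right k l _ _, fun k l => hg.skew_right k l _ _,
    fun k l => hg.skew_right k l _ _, fun k l => hg.skew_right k l _ _,
    fun k l => hg.skew_right k l _ _, fun k l => hg.skew_right k l _ _, hr, ?_⟩
  rw [hg.pair_symm 0 3 1 2, hb]
  simp [hg.pair_symm]

end IsAlgebraicCurvature

/-- The three-form in dimension four with Hodge dual `t`, in components. -/
noncomputable def threeFormOf (t : Fin 4 → ℝ) (i j k : Fin 4) : ℝ :=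
  ∑ l, leviCivitaSymbol i j k l * t l

/-- The components of the curvature of a metric connection with skew torsion, in terms of the
Riemannian curvature `g`, the Hodge dual `t` of the torsion and the covariant derivative `n` of the
latter. -/
noncomputable def torsionCurvature (g : Fin 4 → Fin 4 → Fin 4 → Fin 4 → ℝ) (t : Fin 4 → ℝ)
    (n : Fin 4 → Fin 4 → ℝ)
    (i j k l : Fin 4) : ℝ :=
  -- The torsion terms have the opposite signs to those in `inner_curvature_skewTorsion`, because
  -- `curvatureTensor` is minus the inner product. The row `n i` is the derivative along the `i`-th
  -- frame vector.
  g i j k l - 2⁻¹ * (threeFormOf (n i) j k l - threeFormOf (n j) i k l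
      + ∑ m, threeFormOf t i j m * threeFormOf t m k l)
    + 4⁻¹ * ∑ m, (threeFormOf t i m l * threeFormOf t j k m
        - threeFormOf t j m l * threeFormOf t i k m)

/-- An evaluation table, used as a rewriting system in the explicit component computations. -/
lemma threeFormOf_rules (t : Fin 4 → ℝ) :
    (∀ i j, threeFormOf t i i j = 0) ∧ (∀ i j, threeFormOf t i j j = 0) ∧
    (∀ i j, threeFormOf t i j i = 0) ∧
    threeFormOf t 0 1 2 = t 3 ∧ threeFormOf t 0 1 3 = -t 2 ∧ threeFormOf t 0 2 1 = -t 3 ∧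
    threeFormOf t 0 2 3 = t 1 ∧ threeFormOf t 0 3 1 = t 2 ∧ threeFormOf t 0 3 2 = -t 1 ∧
    threeFormOf t 1 0 2 = -t 3 ∧ threeFormOf t 1 0 3 = t 2 ∧ threeFormOf t 1 2 0 = t 3 ∧
    threeFormOf t 1 2 3 = -t 0 ∧ threeFormOf t 1 3 0 = -t 2 ∧ threeFormOf t 1 3 2 = t 0 ∧
    threeFormOf t 2 0 1 = t 3 ∧ threeFormOf t 2 0 3 = -t 1 ∧ threeFormOf t 2 1 0 = -t 3 ∧
    threeFormOf t 2 1 3 = t 0 ∧ threeFormOf t 2 3 0 = t 1 ∧ threeFormOf t 2 3 1 = -t 0 ∧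
    threeFormOf t 3 0 1 = -t 2 ∧ threeFormOf t 3 0 2 = t 1 ∧ threeFormOf t 3 1 0 = t 2 ∧
    threeFormOf t 3 1 2 = -t 0 ∧ threeFormOf t 3 2 0 = -t 1 ∧ threeFormOf t 3 2 1 = t 0 := by
  refine ⟨fun i j => ?_, fun i j => ?_, fun i j => ?_, ?_⟩ <;>
    simp [threeFormOf, Fin.sum_univ_four, leviCivitaSymbol]

lemma leviCivitaSymbol_swap_left (i j k l : Fin 4) :
    leviCivitaSymbol j i k l = -leviCivitaSymbol i j k l := by
  revert i j k l
  decide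

lemma leviCivitaSymbol_swap_mid (i j k l : Fin 4) :
    leviCivitaSymbol i k j l = -leviCivitaSymbol i j k l := by
  revert i j k l
  decide

lemma threeFormOf_swap_left (t : Fin 4 → ℝ) (i j k : Fin 4) :
    threeFormOf t j i k = -threeFormOf t i j k := by
  simp only [threeFormOf, leviCivitaSymbol_swap_left i j]
  simp

lemma threeFormOf_swap_right (t : Fin 4 → ℝ) (i j k : Fin 4) :
    threeFormOf t i k j = -threeFormOf t i j k := by
  simp only [threeFormOf, leviCivitaSymbol_swap_mid i j]
  simp

lemma torsionCurvature_skew_left {g : Fin 4 → Fin 4 → Fin 4 → Fin 4 → ℝ}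
    (hg : IsAlgebraicCurvature g) (t : Fin 4 → ℝ) (n : Fin 4 → Fin 4 → ℝ) (i j k l : Fin 4) :
    torsionCurvature g t n j i k l = -torsionCurvature g t n i j k l := by
  simp only [torsionCurvature, hg.skew_left i j, threeFormOf_swap_left t i j, neg_mul,
    Finset.sum_neg_distrib, Finset.sum_sub_distrib]
  ring

lemma torsionCurvature_skew_right {g : Fin 4 → Fin 4 → Fin 4 → Fin 4 → ℝ}
    (hg : IsAlgebraicCurvature g) (t : Fin 4 → ℝ) (n : Fin 4 → Fin 4 → ℝ) (i j k l : Fin 4) :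
    torsionCurvature g t n i j l k = -torsionCurvature g t n i j k l := by
  simp only [torsionCurvature, hg.skew_right i j k, threeFormOf_swap_right _ _ k l, mul_neg,
    Finset.sum_neg_distrib, Finset.sum_sub_distrib]
  -- Exchanging `k` and `l` turns each of the two quadratic sums of the last term into the other.
  have h (a b : Fin 4) : ∑ m, threeFormOf t a m k * threeFormOf t b l m =
      ∑ m, threeFormOf t b m l * threeFormOf t a k m :=
    Finset.sum_congr rfl fun m _ => by
      rw [threeFormOf_swap_right t a k m, threeFormOf_swap_right t b m l]
      ring
  rw [h, h]
  ring

/-- The components of the Ricci tensor. -/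
noncomputable def ricciOf (r : Fin 4 → Fin 4 → Fin 4 → Fin 4 → ℝ) (j k : Fin 4) : ℝ :=
  ∑ i, r i j i k

/-- The scalar curvature in terms of the components of the curvature tensor. -/
noncomputable def scalarOf (r : Fin 4 → Fin 4 → Fin 4 → Fin 4 → ℝ) : ℝ :=
  ∑ i, ricciOf r i i

/-- The Kronecker symbol. -/
noncomputable def kronecker (i j : Fin 4) : ℝ :=
  if i = j then 1 else 0

/-- The components of the Weyl tensor. -/
noncomputable def weylOf (g : Fin 4 → Fin 4 → Fin 4 → Fin 4 → ℝ) (i j k l : Fin 4) : ℝ :=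
  g i j k l - (kronecker i k * ricciOf g j l - kronecker i l * ricciOf g j k
      - kronecker j k * ricciOf g i l + kronecker j l * ricciOf g i k) / 2
    + scalarOf g / 6 * (kronecker i k * kronecker j l - kronecker i l * kronecker j k)

lemma weylOf_skew_left {g : Fin 4 → Fin 4 → Fin 4 → Fin 4 → ℝ}
    (hg : IsAlgebraicCurvature g) (i j k l : Fin 4) : weylOf g j i k l = -weylOf g i j k l := by
  simp only [weylOf, hg.skew_left i j]
  ring

lemma weylOf_skew_right {g : Fin 4 → Fin 4 → Fin 4 → Fin 4 → ℝ}
    (hg : IsAlgebraicCurvature g) (i j k l : Fin 4) : weylOf g i j l k = -weylOf g i j k l := by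
  simp only [weylOf, hg.skew_right i j k]
  ring

/-! ### The splitting of two-forms and the diagonal blocks. -/

section Pointwise

variable {V : Type*} [NormedAddCommGroup V] [InnerProductSpace ℝ V]

lemma twoForm_rules (α : V [⋀^Fin 2]→L[ℝ] ℝ) (e : Fin 4 → V) :
    (∀ i, α ![e i, e i] = 0) ∧ α ![e 1, e 0] = -α ![e 0, e 1] ∧
    α ![e 2, e 0] = -α ![e 0, e 2] ∧ α ![e 3, e 0] = -α ![e 0, e 3] ∧
    α ![e 2, e 1] = -α ![e 1, e 2] ∧ α ![e 3, e 1] = -α ![e 1, e 3] ∧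
    α ![e 3, e 2] = -α ![e 2, e 3] := by
  refine ⟨fun i => twoForm_self α _, ?_, ?_, ?_, ?_, ?_, ?_⟩ <;> exact twoForm_swap α _ _

variable [Fact (finrank ℝ V = 4)] (o : Orientation ℝ V (Fin 4))

lemma hodgeStar_two_rules (β : V [⋀^Fin 2]→L[ℝ] ℝ) :
    hodgeStar o (k := 2) (l := 2) rfl β ![frame o 0, frame o 1] = β ![frame o 2, frame o 3] ∧
    hodgeStar o (k := 2) (l := 2) rfl β ![frame o 0, frame o 2] = -β ![frame o 1, frame o 3] ∧
    hodgeStar o (k := 2) (l := 2) rfl β ![frame o 0, frame o 3] = β ![frame o 1, frame o 2] ∧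
    hodgeStar o (k := 2) (l := 2) rfl β ![frame o 1, frame o 2] = β ![frame o 0, frame o 3] ∧
    hodgeStar o (k := 2) (l := 2) rfl β ![frame o 1, frame o 3] = -β ![frame o 0, frame o 2] ∧
    hodgeStar o (k := 2) (l := 2) rfl β ![frame o 2, frame o 3] = β ![frame o 0, frame o 1] := by
  simp only [hodgeStar_two_apply, Fin.sum_univ_four, twoForm_rules]
  refine ⟨?_, ?_, ?_, ?_, ?_, ?_⟩ <;> simp [leviCivitaSymbol] <;> ring

lemma twoForm_ext_six {α β : V [⋀^Fin 2]→L[ℝ] ℝ}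
    (h01 : α ![frame o 0, frame o 1] = β ![frame o 0, frame o 1])
    (h02 : α ![frame o 0, frame o 2] = β ![frame o 0, frame o 2])
    (h03 : α ![frame o 0, frame o 3] = β ![frame o 0, frame o 3])
    (h12 : α ![frame o 1, frame o 2] = β ![frame o 1, frame o 2])
    (h13 : α ![frame o 1, frame o 3] = β ![frame o 1, frame o 3])
    (h23 : α ![frame o 2, frame o 3] = β ![frame o 2, frame o 3]) : α = β := by
  refine twoForm_ext_frame o fun i j hij => ?_
  fin_cases i <;> fin_cases j <;> first | assumption | exact absurd hij (by decide)

lemma hodgeStar_hodgeStar_two (β : V [⋀^Fin 2]→L[ℝ] ℝ) :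
    hodgeStar o (k := 2) (l := 2) rfl (hodgeStar o (k := 2) (l := 2) rfl β) = β := by
  apply twoForm_ext_six o <;> simp [hodgeStar_two_rules]

lemma plusPart_apply (β : V [⋀^Fin 2]→L[ℝ] ℝ) :
    plusPart o β = (2⁻¹ : ℝ) • (β + hodgeStar o (k := 2) (l := 2) rfl β) :=
  rfl

lemma minusPart_apply (β : V [⋀^Fin 2]→L[ℝ] ℝ) :
    minusPart o β = (2⁻¹ : ℝ) • (β - hodgeStar o (k := 2) (l := 2) rfl β) :=
  rfl

lemma mem_selfDual (β : V [⋀^Fin 2]→L[ℝ] ℝ) :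
    β ∈ selfDual o ↔ hodgeStar o (k := 2) (l := 2) rfl β = β :=
  Iff.rfl

lemma mem_antiSelfDual (β : V [⋀^Fin 2]→L[ℝ] ℝ) :
    β ∈ antiSelfDual o ↔ hodgeStar o (k := 2) (l := 2) rfl β = -β :=
  Iff.rfl

theorem isCompl_selfDual_antiSelfDual : IsCompl (selfDual o) (antiSelfDual o) := by
  refine isCompl_iff.mpr ⟨Submodule.disjoint_def.mpr fun β h h' => ?_,
    codisjoint_iff.mpr (eq_top_iff.mpr fun β _ => ?_)⟩
  · rw [mem_selfDual] at h
    rw [mem_antiSelfDual, h] at h'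
    ext v
    have hv : β v = -β v := congrArg (fun γ : V [⋀^Fin 2]→L[ℝ] ℝ => γ v) h'
    change β v = 0
    linarith
  · refine Submodule.mem_sup.mpr ⟨plusPart o β, ?_, minusPart o β, ?_, ?_⟩
    · rw [mem_selfDual, plusPart_apply, map_smul, map_add, hodgeStar_hodgeStar_two, add_comm]
    · rw [mem_antiSelfDual, minusPart_apply, map_smul, map_sub, hodgeStar_hodgeStar_two]
      module
    · rw [plusPart_apply, minusPart_apply]
      module

/-- Skewness in both pairs folds the sixteen terms into six and cancels the factors `1/2`, which
keeps the component checks below within reach of `ring`. -/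
lemma operatorOf_frame_of_skew {T : V → V → V → V → ℝ} {q : Fin 4 → Fin 4 → Fin 4 → Fin 4 → ℝ}
    (hT : ∀ i j k l, T (frame o i) (frame o j) (frame o k) (frame o l) = q i j k l)
    (hl : ∀ i j k l, q j i k l = -q i j k l) (hr : ∀ i j k l, q i j l k = -q i j k l)
    (α : V [⋀^Fin 2]→L[ℝ] ℝ) (k l : Fin 4) :
    operatorOf o T α ![frame o k, frame o l] =
      α ![frame o 0, frame o 1] * q 0 1 k l + α ![frame o 0, frame o 2] * q 0 2 k l
      + α ![frame o 0, frame o 3] * q 0 3 k l + α ![frame o 1, frame o 2] * q 1 2 k l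
      + α ![frame o 1, frame o 3] * q 1 3 k l + α ![frame o 2, frame o 3] * q 2 3 k l := by
  simp only [operatorOf_frame, hT, hr _ _ k l, Fin.sum_univ_four, twoForm_rules, hl 0 1, hl 0 2,
    hl 0 3, hl 1 2, hl 1 3, hl 2 3]
  ring

end Pointwise

section Pointwise

variable {V : Type*} [NormedAddCommGroup V] [InnerProductSpace ℝ V]
variable [Fact (finrank ℝ V = 4)] (o : Orientation ℝ V (Fin 4))

lemma codiff_rules {cod : V [⋀^Fin 2]→L[ℝ] ℝ} {n : Fin 4 → Fin 4 → ℝ}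
    (hcod : ∀ i j, cod ![frame o i, frame o j] = -∑ k, ∑ l, leviCivitaSymbol k l i j * n k l) :
    cod ![frame o 0, frame o 1] = n 3 2 - n 2 3 ∧ cod ![frame o 0, frame o 2] = n 1 3 - n 3 1 ∧
    cod ![frame o 0, frame o 3] = n 2 1 - n 1 2 ∧ cod ![frame o 1, frame o 2] = n 3 0 - n 0 3 ∧
    cod ![frame o 1, frame o 3] = n 0 2 - n 2 0 ∧ cod ![frame o 2, frame o 3] = n 1 0 - n 0 1 := by
  simp only [hcod, Fin.sum_univ_four]
  refine ⟨?_, ?_, ?_, ?_, ?_, ?_⟩ <;> simp [leviCivitaSymbol] <;> ring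

-- All six components are compared in terms of `g`, `t`, `n`. The array `n` does not enter the
-- scalar curvature; its trace accounts for the `*dH` term and its skew part for the action of the
-- codifferential, while the quadratic terms in `t` are matched by their contribution to the scalar
-- curvature.
set_option maxHeartbeats 2000000 in
theorem plusPart_operatorOf_of_mem_selfDual {g : Fin 4 → Fin 4 → Fin 4 → Fin 4 → ℝ}
    (hg : IsAlgebraicCurvature g) (t : Fin 4 → ℝ) (n : Fin 4 → Fin 4 → ℝ)
    {R W : V → V → V → V → ℝ}
    (hR : ∀ i j k l, R (frame o i) (frame o j) (frame o k) (frame o l) =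
      torsionCurvature g t n i j k l)
    (hW : ∀ i j k l, W (frame o i) (frame o j) (frame o k) (frame o l) = weylOf g i j k l)
    {cod : V [⋀^Fin 2]→L[ℝ] ℝ}
    (hcod : ∀ i j, cod ![frame o i, frame o j] = -∑ k, ∑ l, leviCivitaSymbol k l i j * n k l)
    {α : V [⋀^Fin 2]→L[ℝ] ℝ} (hα : α ∈ selfDual o) :
    plusPart o (operatorOf o R α) =
      plusPart o (operatorOf o W (plusPart o α))
        + (scalarOf (torsionCurvature g t n) / 12 - (-∑ i, n i i) / 4) • α
        + (1 / 4 : ℝ) • formAction o (plusPart o cod) α := by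
  rw [mem_selfDual] at hα
  have hp : plusPart o α = α := by
    rw [plusPart_apply, hα]
    module
  -- A self-dual form is determined by its three components that involve `frame o 0`.
  have h01 : α ![frame o 2, frame o 3] = α ![frame o 0, frame o 1] := by
    rw [← (hodgeStar_two_rules o α).1, hα]
  have h02 : α ![frame o 1, frame o 3] = -α ![frame o 0, frame o 2] := by
    rw [← hα, (hodgeStar_two_rules o α).2.2.2.2.1, hα]
  have h03 : α ![frame o 1, frame o 2] = α ![frame o 0, frame o 3] := by
    rw [← hα, (hodgeStar_two_rules o α).2.2.2.1, hα]
  rw [hp]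
  have hc := codiff_rules o hcod
  apply twoForm_ext_six o <;>
  · simp only [plusPart_apply, formAction, ContinuousAlternatingMap.add_apply,
      ContinuousAlternatingMap.smul_apply, smul_eq_mul, hodgeStar_two_rules, map_add, map_smul,
      hodgeStar_hodgeStar_two,
      twoFormBracket_frame, operatorOf_frame_of_skew o hR (torsionCurvature_skew_left hg t n)
      (torsionCurvature_skew_right hg t n), operatorOf_frame_of_skew o hW (weylOf_skew_left hg)
      (weylOf_skew_right hg), h01, h02, h03, weylOf, scalarOf, ricciOf, torsionCurvature,
      Fin.sum_univ_four, threeFormOf_rules, twoForm_rules, hg.rules, kronecker, hc]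
    simp
    ring
-- The same comparison on the other eigenspace, where the trace of `n` and the codifferential enter
-- with the opposite sign.
set_option maxHeartbeats 2000000 in
theorem minusPart_operatorOf_of_mem_antiSelfDual {g : Fin 4 → Fin 4 → Fin 4 → Fin 4 → ℝ}
    (hg : IsAlgebraicCurvature g) (t : Fin 4 → ℝ) (n : Fin 4 → Fin 4 → ℝ)
    {R W : V → V → V → V → ℝ}
    (hR : ∀ i j k l, R (frame o i) (frame o j) (frame o k) (frame o l) =
      torsionCurvature g t n i j k l)
    (hW : ∀ i j k l, W (frame o i) (frame o j) (frame o k) (frame o l) = weylOf g i j k l)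
    {cod : V [⋀^Fin 2]→L[ℝ] ℝ}
    (hcod : ∀ i j, cod ![frame o i, frame o j] = -∑ k, ∑ l, leviCivitaSymbol k l i j * n k l)
    {α : V [⋀^Fin 2]→L[ℝ] ℝ} (hα : α ∈ antiSelfDual o) :
    minusPart o (operatorOf o R α) =
      minusPart o (operatorOf o W (minusPart o α))
        + (scalarOf (torsionCurvature g t n) / 12 + (-∑ i, n i i) / 4) • α
        - (1 / 4 : ℝ) • formAction o (minusPart o cod) α := by
  rw [mem_antiSelfDual] at hα
  have hp : minusPart o α = α := by
    rw [minusPart_apply, hα]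
    module
  have h (v : Fin 2 → V) : α v = -hodgeStar o (k := 2) (l := 2) rfl α v := by
    rw [hα, ContinuousAlternatingMap.neg_apply, neg_neg]
  have h01 : α ![frame o 2, frame o 3] = -α ![frame o 0, frame o 1] := by
    rw [h, (hodgeStar_two_rules o α).2.2.2.2.2]
  have h02 : α ![frame o 1, frame o 3] = α ![frame o 0, frame o 2] := by
    rw [h, (hodgeStar_two_rules o α).2.2.2.2.1, neg_neg]
  have h03 : α ![frame o 1, frame o 2] = -α ![frame o 0, frame o 3] := by
    rw [h, (hodgeStar_two_rules o α).2.2.2.1]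
  rw [hp]
  have hc := codiff_rules o hcod
  apply twoForm_ext_six o <;>
  · simp only [minusPart_apply, formAction, ContinuousAlternatingMap.add_apply,
      ContinuousAlternatingMap.sub_apply, map_sub,
      ContinuousAlternatingMap.smul_apply, smul_eq_mul, hodgeStar_two_rules, map_smul,
      hodgeStar_hodgeStar_two,
      twoFormBracket_frame, operatorOf_frame_of_skew o hR (torsionCurvature_skew_left hg t n)
      (torsionCurvature_skew_right hg t n), operatorOf_frame_of_skew o hW (weylOf_skew_left hg)
      (weylOf_skew_right hg), h01, h02, h03, weylOf, scalarOf, ricciOf, torsionCurvature,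
      Fin.sum_univ_four, threeFormOf_rules, twoForm_rules, hg.rules, kronecker, hc]
    simp
    ring

/-! ### The off-diagonal blocks. -/

lemma blockTensor_frame (B : (V [⋀^Fin 2]→L[ℝ] ℝ) →ₗ[ℝ] (V [⋀^Fin 2]→L[ℝ] ℝ)) (j k : Fin 4) :
    blockTensor o B (frame o j) (frame o k) =
      ∑ i, (B (wedge (frame o i) (frame o j)) ![frame o i, frame o k]
        + B (wedge (frame o i) (frame o k)) ![frame o i, frame o j]) := by
  simp only [blockTensor, ricciContraction, twoFormInner_wedge, LinearMap.add_apply,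
    ContinuousAlternatingMap.add_apply, transposeOp_wedge]

/-- The block tensor symmetrizes with the transpose, so the lower left block can be computed without
transposing it. -/
lemma blockTensor_transposeOp_frame
    (B : (V [⋀^Fin 2]→L[ℝ] ℝ) →ₗ[ℝ] (V [⋀^Fin 2]→L[ℝ] ℝ)) (j k : Fin 4) :
    blockTensor o (transposeOp o B) (frame o j) (frame o k) =
      blockTensor o B (frame o j) (frame o k) := by
  simp only [blockTensor_frame, transposeOp_wedge]
  exact Finset.sum_congr rfl fun _ _ => add_comm _ _

/-- Twice the components of the Hodge dual of a matrix `f`. -/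
noncomputable def dualComponent (f : Fin 4 → Fin 4 → ℝ) (i k : Fin 4) : ℝ :=
  ∑ a, ∑ b, leviCivitaSymbol i k a b * f a b

lemma dualComponent_rules (f : Fin 4 → Fin 4 → ℝ) :
    (∀ i, dualComponent f i i = 0) ∧ dualComponent f 0 1 = f 2 3 - f 3 2 ∧
    dualComponent f 0 2 = f 3 1 - f 1 3 ∧ dualComponent f 0 3 = f 1 2 - f 2 1 ∧
    dualComponent f 1 0 = f 3 2 - f 2 3 ∧ dualComponent f 1 2 = f 0 3 - f 3 0 ∧
    dualComponent f 1 3 = f 2 0 - f 0 2 ∧ dualComponent f 2 0 = f 1 3 - f 3 1 ∧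
    dualComponent f 2 1 = f 3 0 - f 0 3 ∧ dualComponent f 2 3 = f 0 1 - f 1 0 ∧
    dualComponent f 3 0 = f 2 1 - f 1 2 ∧ dualComponent f 3 1 = f 0 2 - f 2 0 ∧
    dualComponent f 3 2 = f 1 0 - f 0 1 := by
  simp only [dualComponent, Fin.sum_univ_four]
  refine ⟨fun i => ?_, ?_⟩ <;> simp [leviCivitaSymbol, sub_eq_add_neg, add_comm]

/-- The two-tensor attached to the part of a curvature tensor that is skew with respect to the
exchange of both pairs of arguments and exchanges self-dual and anti-self-dual forms. -/
noncomputable def pairSkewContraction (r : Fin 4 → Fin 4 → Fin 4 → Fin 4 → ℝ) (j k : Fin 4) : ℝ :=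
  -- The factor is `1/4` from the two projections times `1/2` from the normalization of
  -- `dualComponent`; the summands are the terms `*R - R*` and their transposes.
  8⁻¹ * ∑ i, (dualComponent (fun a b => r i j a b - r a b i j) i k
    + dualComponent (fun a b => r i k a b - r a b i k) i j)

lemma diag_rules {r : Fin 4 → Fin 4 → Fin 4 → Fin 4 → ℝ} (hl : ∀ i j k l, r j i k l = -r i j k l)
    (hr : ∀ i j k l, r i j l k = -r i j k l) :
    (∀ i k l, r i i k l = 0) ∧ (∀ i k l, r k l i i = 0) :=
  ⟨fun i k l => by linarith [hl i i k l], fun i k l => by linarith [hr k l i i]⟩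

lemma dualComponent_sub (f f' : Fin 4 → Fin 4 → ℝ) (i k : Fin 4) :
    dualComponent (fun a b => f a b - f' a b) i k = dualComponent f i k - dualComponent f' i k := by
  simp only [dualComponent, mul_sub, Finset.sum_sub_distrib]

lemma hodgeStar_frame_eq_dualComponent (β : V [⋀^Fin 2]→L[ℝ] ℝ) (i j : Fin 4) :
    hodgeStar o (k := 2) (l := 2) rfl β ![frame o i, frame o j] =
      2⁻¹ * dualComponent (fun a b => β ![frame o a, frame o b]) i j := by
  have h : ∀ a b i j : Fin 4, leviCivitaSymbol a b i j = leviCivitaSymbol i j a b := by decide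
  simp only [hodgeStar_two_apply, dualComponent, h _ _ i j, mul_comm (β _)]

lemma hodgeStar_wedge_frame (i j : Fin 4) :
    hodgeStar o (k := 2) (l := 2) rfl (wedge (frame o i) (frame o j)) =
      (2⁻¹ : ℝ) • ∑ a, ∑ b, (leviCivitaSymbol i j a b : ℝ) • wedge (frame o a) (frame o b) := by
  have h : ∀ a b i j : Fin 4, leviCivitaSymbol b a i j = leviCivitaSymbol a b j i := by decide
  refine twoForm_ext_frame o fun k l _ => ?_
  rw [hodgeStar_two_apply]
  simp only [ContinuousAlternatingMap.smul_apply, ContinuousAlternatingMap.sum_apply,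
    wedge_frame, smul_eq_mul, mul_sub, sub_mul, Finset.sum_sub_distrib]
  simp [h]

lemma operatorOf_wedge_frame {R : V → V → V → V → ℝ} {r : Fin 4 → Fin 4 → Fin 4 → Fin 4 → ℝ}
    (hR : ∀ i j k l, R (frame o i) (frame o j) (frame o k) (frame o l) = r i j k l)
    (hl : ∀ i j k l, r j i k l = -r i j k l) (hr : ∀ i j k l, r i j l k = -r i j k l)
    (i j k l : Fin 4) :
    operatorOf o R (wedge (frame o i) (frame o j)) ![frame o k, frame o l] = r i j k l := by
  simp only [operatorOf_frame, hR, hr _ _ k l, wedge_frame, sub_mul, Finset.sum_sub_distrib]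
  simp
  rw [hl i j]
  ring

lemma operatorOf_hodgeStar_wedge_frame {R : V → V → V → V → ℝ}
    {r : Fin 4 → Fin 4 → Fin 4 → Fin 4 → ℝ}
    (hR : ∀ i j k l, R (frame o i) (frame o j) (frame o k) (frame o l) = r i j k l)
    (hl : ∀ i j k l, r j i k l = -r i j k l) (hr : ∀ i j k l, r i j l k = -r i j k l)
    (i j k l : Fin 4) :
    operatorOf o R (hodgeStar o (k := 2) (l := 2) rfl (wedge (frame o i) (frame o j)))
      ![frame o k, frame o l] = 2⁻¹ * dualComponent (fun a b => r a b k l) i j := by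
  simp only [hodgeStar_wedge_frame, map_smul, map_sum, ContinuousAlternatingMap.smul_apply,
    ContinuousAlternatingMap.sum_apply, operatorOf_wedge_frame o hR hl hr, smul_eq_mul,
    dualComponent]

/-- The contraction of `*R*` is minus the transposed Einstein tensor, the two uses of
`dualComponent` contributing a factor `4`. Only skewness in each pair enters, so this holds for
connections with torsion, whose Ricci tensor need not be symmetric. -/
lemma dualComponent_dualComponent_contract {r : Fin 4 → Fin 4 → Fin 4 → Fin 4 → ℝ}
    (hl : ∀ i j k l, r j i k l = -r i j k l) (hr : ∀ i j k l, r i j l k = -r i j k l)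
    (j k : Fin 4) :
    ∑ i, dualComponent (fun c d => dualComponent (fun a b => r a b c d) i j) i k =
      2 * scalarOf r * kronecker j k - 4 * ricciOf r k j := by
  simp only [scalarOf, ricciOf, Fin.sum_univ_four]
  fin_cases j <;> fin_cases k <;>
  · simp only [dualComponent_rules, kronecker, Fin.mk_zero, Fin.mk_one, Fin.reduceFinMk,
      diag_rules hl hr, hl 0 1, hl 0 2, hl 0 3, hl 1 2, hl 1 3, hl 2 3,
      hr _ _ 0 1, hr _ _ 0 2, hr _ _ 0 3, hr _ _ 1 2, hr _ _ 1 3, hr _ _ 2 3]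
    simp
    try ring

/-- Expand `P₊ R P₋ = ¼ (R - *R* + *R - R*)`. The terms `R` and `*R*` give the trace-free symmetric
Ricci tensor by `dualComponent_dualComponent_contract`, the other two give `pairSkewContraction`. In
`P₋ R P₊` only the last two change sign. -/
theorem blockTensor_of_skew {R : V → V → V → V → ℝ} {r : Fin 4 → Fin 4 → Fin 4 → Fin 4 → ℝ}
    (hR : ∀ i j k l, R (frame o i) (frame o j) (frame o k) (frame o l) = r i j k l)
    (hl : ∀ i j k l, r j i k l = -r i j k l) (hr : ∀ i j k l, r i j l k = -r i j k l)
    (j k : Fin 4) :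
    blockTensor o (plusPart o ∘ₗ operatorOf o R ∘ₗ minusPart o) (frame o j) (frame o k) =
      ((ricciOf r j k + ricciOf r k j) / 2 - scalarOf r / 4 * kronecker j k)
        + pairSkewContraction r j k ∧
    blockTensor o (minusPart o ∘ₗ operatorOf o R ∘ₗ plusPart o) (frame o j) (frame o k) =
      ((ricciOf r j k + ricciOf r k j) / 2 - scalarOf r / 4 * kronecker j k)
        - pairSkewContraction r j k := by
  have hd := dualComponent_dualComponent_contract hl hr
  have hs : kronecker k j = kronecker j k := by simp only [kronecker, eq_comm]
  have hjk := hd j k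
  have hkj := hd k j
  rw [hs] at hkj
  constructor <;>
  · simp only [blockTensor_frame, LinearMap.comp_apply, plusPart_apply, minusPart_apply, map_add,
      map_sub, map_smul, ContinuousAlternatingMap.add_apply, ContinuousAlternatingMap.sub_apply,
      ContinuousAlternatingMap.smul_apply, smul_eq_mul, hodgeStar_frame_eq_dualComponent,
      operatorOf_wedge_frame o hR hl hr, operatorOf_hodgeStar_wedge_frame o hR hl hr,
      pairSkewContraction, dualComponent_sub]
    have hm (f : Fin 4 → Fin 4 → ℝ) (i k : Fin 4) : dualComponent (fun a b => 2⁻¹ * f a b) i k =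
        2⁻¹ * dualComponent f i k := by
      simp only [dualComponent, Finset.mul_sum]
      exact Finset.sum_congr rfl fun _ _ => Finset.sum_congr rfl fun _ _ => by ring
    simp only [hm, mul_sub, mul_add, ← mul_assoc, Finset.sum_add_distrib, Finset.sum_sub_distrib,
      ← Finset.mul_sum, hjk, hkj, ricciOf]
    ring

/-- The Riemann tensor and the quadratic terms in `t` are invariant under exchange of the index
pairs, so both cancel and only the derivative terms survive. -/
lemma torsionCurvature_sub_pair {g : Fin 4 → Fin 4 → Fin 4 → Fin 4 → ℝ}
    (hg : IsAlgebraicCurvature g) (t : Fin 4 → ℝ) (n : Fin 4 → Fin 4 → ℝ) (i j k l : Fin 4) :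
    torsionCurvature g t n i j k l - torsionCurvature g t n k l i j =
      -2⁻¹ * (threeFormOf (n i) j k l - threeFormOf (n j) i k l
        - threeFormOf (n k) l i j + threeFormOf (n l) k i j) := by
  have cyc (a b c : Fin 4) : threeFormOf t a b c = threeFormOf t c a b := by
    rw [threeFormOf_swap_left t a c b, threeFormOf_swap_right t a b c, neg_neg]
  have h1 : ∑ m, threeFormOf t k l m * threeFormOf t m i j =
      ∑ m, threeFormOf t i j m * threeFormOf t m k l :=
    Finset.sum_congr rfl fun m _ => by rw [cyc k l m, ← cyc i j m, mul_comm]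
  have h2 (a b : Fin 4) : ∑ m, threeFormOf t k m b * threeFormOf t l a m =
      ∑ m, threeFormOf t b k m * threeFormOf t a m l :=
    Finset.sum_congr rfl fun m _ => by rw [cyc k m b, cyc a m l]
  have h3 : ∑ m, threeFormOf t l m j * threeFormOf t k i m =
      ∑ m, threeFormOf t j m l * threeFormOf t i k m :=
    Finset.sum_congr rfl fun m _ => by
      rw [cyc l m j, threeFormOf_swap_right t j l m, threeFormOf_swap_left t k i m]
      ring
  simp only [torsionCurvature, Finset.sum_sub_distrib, h1, h2, h3, hg.pair_symm i j k l,
    mul_comm (threeFormOf t j k _)]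
  ring

/-- After `torsionCurvature_sub_pair` the expression is linear in `n`, and dualizing undoes the
Hodge dual inside `threeFormOf`. The result is the trace-free symmetric part of `n`, which explains
the multiple of the metric that accompanies `S(∇*H)`. -/
theorem pairSkewContraction_torsionCurvature {g : Fin 4 → Fin 4 → Fin 4 → Fin 4 → ℝ}
    (hg : IsAlgebraicCurvature g) (t : Fin 4 → ℝ) (n : Fin 4 → Fin 4 → ℝ) (j k : Fin 4) :
    pairSkewContraction (torsionCurvature g t n) j k =
      (n j k + n k j) / 2 + (-∑ i, n i i) / 4 * kronecker j k := by
  simp only [pairSkewContraction, torsionCurvature_sub_pair hg]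
  fin_cases j <;> fin_cases k <;>
  · simp only [Fin.sum_univ_four, dualComponent_rules, threeFormOf_rules, kronecker, Fin.mk_zero,
    Fin.mk_one,
      Fin.reduceFinMk]
    simp
    ring

end Pointwise

/-! ### Vector fields with constant coefficients in a chart. -/

section ConstantFields

variable {M : Type*} [TopologicalSpace M] [ChartedSpace (EuclideanSpace ℝ (Fin 4)) M]

/-- A vector field that is smooth at a point. -/
abbrev SmoothFieldAt [IsManifold (𝓡 4) ∞ M] (X : ∀ y : M, TangentSpace (𝓡 4) y) (y : M) : Prop :=
  ContMDiffAt (𝓡 4) ((𝓡 4).prod 𝓘(ℝ, EuclideanSpace ℝ (Fin 4))) ∞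
    (fun z => TotalSpace.mk' (EuclideanSpace ℝ (Fin 4)) z (X z)) y

/-- A vector field that is differentiable at a point. -/
abbrev DiffFieldAt [IsManifold (𝓡 4) ∞ M] (X : ∀ y : M, TangentSpace (𝓡 4) y) (y : M) : Prop :=
  MDifferentiableAt (𝓡 4) ((𝓡 4).prod 𝓘(ℝ, EuclideanSpace ℝ (Fin 4)))
    (fun z => TotalSpace.mk' (EuclideanSpace ℝ (Fin 4)) z (X z)) y

lemma eventually_mem_chart_source {x : M} :
    ∀ᶠ y in 𝓝 x, y ∈ (chartAt (EuclideanSpace ℝ (Fin 4)) x).source :=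
  (chartAt (EuclideanSpace ℝ (Fin 4)) x).open_source.mem_nhds (mem_chart_source _ x)

variable [IsManifold (𝓡 4) ∞ M] {x : M}

/-- The vector field with constant coefficients in the chart at `x` that extends the tangent
vector `v` at `x`. -/
noncomputable abbrev constField (v : TangentSpace (𝓡 4) x) : ∀ y : M, TangentSpace (𝓡 4) y :=
  FiberBundle.extend (EuclideanSpace ℝ (Fin 4)) v

/-- The coefficients of a tangent vector at `x` in the chart at `x`. -/
def modelVector (v : TangentSpace (𝓡 4) x) : EuclideanSpace ℝ (Fin 4) := v

/-- The constant vector field on the model space. -/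
def modelField (v : EuclideanSpace ℝ (Fin 4)) (z : EuclideanSpace ℝ (Fin 4)) :
    TangentSpace 𝓘(ℝ, EuclideanSpace ℝ (Fin 4)) z := v

lemma constField_eq_symmL (v : TangentSpace (𝓡 4) x) {y : M}
    (hy : y ∈ (chartAt (EuclideanSpace ℝ (Fin 4)) x).source) :
    constField v y =
      (trivializationAt (EuclideanSpace ℝ (Fin 4)) (TangentSpace (𝓡 4)) x).symmL ℝ y
        (modelVector v) := by
  -- The trivialization centred at `x` is the identity on the fibre over `x`, because the derivative
  -- of the chart at its own centre is.
  have h : (trivializationAt (EuclideanSpace ℝ (Fin 4)) (TangentSpace (𝓡 4)) x ⟨x, v⟩).2 =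
      modelVector v := by
    have h1 := TangentBundle.continuousLinearMapAt_trivializationAt (I := 𝓡 4)
      (mem_chart_source (EuclideanSpace ℝ (Fin 4)) x)
    rw [mfderiv_extChartAt_self] at h1
    have h2 := congrArg (fun L => L v) h1
    rw [Trivialization.continuousLinearMapAt_apply, Trivialization.coe_linearMapAt_of_mem] at h2
    · exact h2
    · exact FiberBundle.mem_baseSet_trivializationAt' x
  rw [Trivialization.symmL_apply _ (by simpa using hy)]
  simp only [FiberBundle.extend, h]

lemma constField_add (v w : TangentSpace (𝓡 4) x) {y : M}
    (hy : y ∈ (chartAt (EuclideanSpace ℝ (Fin 4)) x).source) :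
    constField (v + w) y = constField v y + constField w y := by
  simp only [constField_eq_symmL _ hy]
  exact map_add _ _ _

lemma constField_smul (c : ℝ) (v : TangentSpace (𝓡 4) x) {y : M}
    (hy : y ∈ (chartAt (EuclideanSpace ℝ (Fin 4)) x).source) :
    constField (c • v) y = c • constField v y := by
  simp only [constField_eq_symmL _ hy]
  exact map_smul _ _ _

lemma eventually_smoothFieldAt_constField (v : TangentSpace (𝓡 4) x) :
    ∀ᶠ y in 𝓝 x, SmoothFieldAt (constField v) y := by
  obtain ⟨s, hs, h⟩ := FiberBundle.exists_contMDiffOn_extend (k := ∞) (𝓡 4)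
    (EuclideanSpace ℝ (Fin 4)) v
  filter_upwards [eventually_mem_nhds_iff.mpr hs] with y hy
  exact h.contMDiffAt hy

lemma SmoothFieldAt.diffFieldAt {X : ∀ y : M, TangentSpace (𝓡 4) y} {y : M}
    (h : SmoothFieldAt X y) : DiffFieldAt X y :=
  h.mdifferentiableAt (by simp)

lemma diffFieldAt_constField (v : TangentSpace (𝓡 4) x) : DiffFieldAt (constField v) x :=
  FiberBundle.mdifferentiableAt_extend ..

lemma smoothFieldAt_constField (v : TangentSpace (𝓡 4) x) : SmoothFieldAt (constField v) x :=
  FiberBundle.contMDiffAt_extend ..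

lemma eventually_diffFieldAt_constField (v : TangentSpace (𝓡 4) x) :
    ∀ᶠ y in 𝓝 x, DiffFieldAt (constField v) y :=
  (eventually_smoothFieldAt_constField v).mono fun _ h => h.diffFieldAt

lemma mfderiv_extChartAt_constField (v : TangentSpace (𝓡 4) x) {y : M}
    (hy : y ∈ (chartAt (EuclideanSpace ℝ (Fin 4)) x).source) :
    mfderiv (𝓡 4) 𝓘(ℝ, EuclideanSpace ℝ (Fin 4)) (extChartAt (𝓡 4) x) y (constField v y) =
      modelField (modelVector v) (extChartAt (𝓡 4) x y) := by
  rw [constField_eq_symmL v hy]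
  exact (DFunLike.congr_fun (TangentBundle.continuousLinearMapAt_trivializationAt (I := 𝓡 4) hy)
    _).symm.trans (Trivialization.continuousLinearMapAt_symmL _ (by simpa using hy) _)

/-- Presents the constant field as a pullback, so that naturality of the Lie bracket applies to it.
-/
lemma mpullback_modelField (v : TangentSpace (𝓡 4) x) {y : M}
    (hy : y ∈ (chartAt (EuclideanSpace ℝ (Fin 4)) x).source) :
    VectorField.mpullback (𝓡 4) 𝓘(ℝ, EuclideanSpace ℝ (Fin 4)) (extChartAt (𝓡 4) x)
      (modelField (modelVector v)) y = constField v y := by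
  rw [VectorField.mpullback_apply, ← mfderiv_extChartAt_constField v hy]
  obtain ⟨e, he⟩ := isInvertible_mfderiv_extChartAt (I := 𝓡 4) (x := x) (y := y) (by simpa using hy)
  rw [← he, ContinuousLinearMap.inverse_equiv]
  exact e.symm_apply_apply _

lemma mlieBracket_modelField (v w z : EuclideanSpace ℝ (Fin 4)) :
    VectorField.mlieBracket 𝓘(ℝ, EuclideanSpace ℝ (Fin 4)) (modelField v) (modelField w) z = 0 := by
  rw [← VectorField.mlieBracketWithin_univ, VectorField.mlieBracketWithin_eq_lieBracketWithin]
  change fderivWithin ℝ (fun _ : EuclideanSpace ℝ (Fin 4) => w) Set.univ z v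
    - fderivWithin ℝ (fun _ : EuclideanSpace ℝ (Fin 4) => v) Set.univ z w = 0
  simp

/-- Coordinate fields commute. This removes every bracket term from the torsion and the curvature,
and it holds near `x` and not only at `x`, so the resulting identities may be differentiated. -/
lemma eventually_mlieBracket_constField (v w : TangentSpace (𝓡 4) x) :
    ∀ᶠ y in 𝓝 x, VectorField.mlieBracket (𝓡 4) (constField v) (constField w) y = 0 := by
  filter_upwards [eventually_eventually_nhds.mpr (eventually_mem_chart_source (x := x)),
    eventually_mem_chart_source (x := x)] with y hy hy'
  have h (v : TangentSpace (𝓡 4) x) : constField v =ᶠ[𝓝 y] VectorField.mpullback (𝓡 4)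
      𝓘(ℝ, EuclideanSpace ℝ (Fin 4)) (extChartAt (𝓡 4) x) (modelField (modelVector v)) :=
    hy.mono fun z hz => (mpullback_modelField v hz).symm
  have hc (u z : EuclideanSpace ℝ (Fin 4)) :
      MDifferentiableAt 𝓘(ℝ, EuclideanSpace ℝ (Fin 4))
        (𝓘(ℝ, EuclideanSpace ℝ (Fin 4)).prod 𝓘(ℝ, EuclideanSpace ℝ (Fin 4)))
        (fun z' => TotalSpace.mk' (EuclideanSpace ℝ (Fin 4)) z' (modelField u z')) z :=
    (contMDiffAt_vectorSpace_iff_contDiffAt (n := 1) (V := modelField u)).mpr contDiffAt_const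
      |>.mdifferentiableAt one_ne_zero
  have : IsManifold (𝓡 4) (minSmoothness ℝ 2) M := by
    rw [minSmoothness_of_isRCLikeNormedField]
    infer_instance
  rw [(h v).mlieBracket_vectorField_eq (h w), ← VectorField.mpullback_mlieBracket (n := 2) (hc _ _)
    (hc _ _) (contMDiffAt_extChartAt' hy') (by rw [minSmoothness_of_isRCLikeNormedField]),
    VectorField.mpullback_apply, mlieBracket_modelField, map_zero]

end ConstantFields

/-! ### Derivatives of functions read in a chart. -/

section Derivatives

variable {M : Type*} [TopologicalSpace M] [ChartedSpace (EuclideanSpace ℝ (Fin 4)) M]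
variable {x : M}

lemma two_le_infty : (2 : WithTop ℕ∞) ≤ ∞ :=
  WithTop.coe_le_coe.mpr (le_top : (2 : ℕ∞) ≤ ⊤)

lemma one_le_infty : (1 : WithTop ℕ∞) ≤ ∞ :=
  WithTop.coe_le_coe.mpr (le_top : (1 : ℕ∞) ≤ ⊤)

lemma eventually_eq_comp_extChartAt_symm {α : Type*} (g : M → α) {y : M}
    (hy : y ∈ (chartAt (EuclideanSpace ℝ (Fin 4)) x).source) :
    g =ᶠ[𝓝 y] (g ∘ (extChartAt (𝓡 4) x).symm) ∘ extChartAt (𝓡 4) x := by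
  filter_upwards [(chartAt (EuclideanSpace ℝ (Fin 4)) x).open_source.mem_nhds hy] with z hz
  rw [Function.comp_apply, Function.comp_apply, (extChartAt (𝓡 4) x).left_inv (by simpa using hz)]

lemma _root_.Filter.EventuallyEq.mvfderiv_eq {F : Type*} [NormedAddCommGroup F] [NormedSpace ℝ F]
    {f g : M → F} (h : f =ᶠ[𝓝 x] g) (v : TangentSpace (𝓡 4) x) :
    mvfderiv (𝓡 4) f x v = mvfderiv (𝓡 4) g x v := by
  change NormedSpace.fromTangentSpace (f x) (mfderiv (𝓡 4) 𝓘(ℝ, F) f x v) =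
    NormedSpace.fromTangentSpace (g x) (mfderiv (𝓡 4) 𝓘(ℝ, F) g x v)
  exact DFunLike.congr_fun h.mfderiv_eq v

variable [IsManifold (𝓡 4) ∞ M]

lemma constField_self (v : TangentSpace (𝓡 4) x) : constField v x = v :=
  FiberBundle.extend_apply_self _ _

lemma mdifferentiableAt_extChartAt_symm {y : M}
    (hy : y ∈ (chartAt (EuclideanSpace ℝ (Fin 4)) x).source) :
    MDifferentiableAt 𝓘(ℝ, EuclideanSpace ℝ (Fin 4)) (𝓡 4) (extChartAt (𝓡 4) x).symm
      (extChartAt (𝓡 4) x y) := by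
  have h := mdifferentiableWithinAt_extChartAt_symm (I := 𝓡 4) (x := x)
    ((extChartAt (𝓡 4) x).map_source (x := y) (by simpa using hy))
  simpa [mdifferentiableWithinAt_univ] using h

lemma differentiableAt_comp_extChartAt_symm {F : Type*} [NormedAddCommGroup F] [NormedSpace ℝ F]
    {g : M → F} {y : M} (hy : y ∈ (chartAt (EuclideanSpace ℝ (Fin 4)) x).source)
    (hg : MDifferentiableAt (𝓡 4) 𝓘(ℝ, F) g y) :
    DifferentiableAt ℝ (g ∘ (extChartAt (𝓡 4) x).symm) (extChartAt (𝓡 4) x y) := by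
  rw [← mdifferentiableAt_iff_differentiableAt]
  refine MDifferentiableAt.comp (I' := 𝓡 4) _ ?_ (mdifferentiableAt_extChartAt_symm hy)
  rwa [(extChartAt (𝓡 4) x).left_inv (by simpa using hy)]

lemma mvfderiv_constField {F : Type*} [NormedAddCommGroup F] [NormedSpace ℝ F] {g : M → F} {y : M}
    (hy : y ∈ (chartAt (EuclideanSpace ℝ (Fin 4)) x).source)
    (hg : MDifferentiableAt (𝓡 4) 𝓘(ℝ, F) g y) (v : TangentSpace (𝓡 4) x) :
    mvfderiv (𝓡 4) g y (constField v y) =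
      fderiv ℝ (g ∘ (extChartAt (𝓡 4) x).symm) (extChartAt (𝓡 4) x y) (modelVector v) := by
  have h1 := (differentiableAt_comp_extChartAt_symm hy hg).hasFDerivAt.hasMFDerivAt
  have h2 := (mdifferentiableAt_extChartAt (I := 𝓡 4) hy).hasMFDerivAt
  have h3 := (h1.comp y h2).congr_of_eventuallyEq (eventually_eq_comp_extChartAt_symm g hy)
  rw [mvfderiv, h3.mfderiv]
  change fderiv ℝ (g ∘ (extChartAt (𝓡 4) x).symm) (extChartAt (𝓡 4) x y)
    (mfderiv (𝓡 4) 𝓘(ℝ, EuclideanSpace ℝ (Fin 4)) (extChartAt (𝓡 4) x) y (constField v y)) = _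
  rw [mfderiv_extChartAt_constField v hy]
  rfl

lemma mvfderiv_apply_eq_fderiv {F : Type*} [NormedAddCommGroup F] [NormedSpace ℝ F] {g : M → F}
    (hg : MDifferentiableAt (𝓡 4) 𝓘(ℝ, F) g x) (v : TangentSpace (𝓡 4) x) :
    mvfderiv (𝓡 4) g x v =
      fderiv ℝ (g ∘ (extChartAt (𝓡 4) x).symm) (extChartAt (𝓡 4) x x) (modelVector v) := by
  rw [← mvfderiv_constField (mem_chart_source _ x) hg, constField_self]

lemma contDiffAt_comp_extChartAt_symm {g : M → ℝ} (hg : ContMDiffAt (𝓡 4) 𝓘(ℝ, ℝ) ∞ g x) :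
    ContDiffAt ℝ ∞ (g ∘ (extChartAt (𝓡 4) x).symm) (extChartAt (𝓡 4) x x) := by
  rw [← contMDiffAt_iff_contDiffAt]
  have h := contMDiffOn_extChartAt_symm (I := 𝓡 4) (n := ∞) x
  have h' := h.contMDiffAt (extChartAt_target_mem_nhds (I := 𝓡 4) x)
  refine ContMDiffAt.comp (I' := 𝓡 4) _ ?_ h'
  rwa [(extChartAt (𝓡 4) x).left_inv (by simp)]

/-- Second derivatives along fields with constant coefficients commute. -/
lemma mvfderiv_mvfderiv_comm {g : M → ℝ} (hg : ContMDiffAt (𝓡 4) 𝓘(ℝ, ℝ) ∞ g x)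
    (u v : TangentSpace (𝓡 4) x) :
    mvfderiv (𝓡 4) (fun y => mvfderiv (𝓡 4) g y (constField v y)) x u =
      mvfderiv (𝓡 4) (fun y => mvfderiv (𝓡 4) g y (constField u y)) x v := by
  set φ := extChartAt (𝓡 4) x
  have hs := contDiffAt_comp_extChartAt_symm hg
  have hd : DifferentiableAt ℝ (fderiv ℝ (g ∘ φ.symm)) (φ x) :=
    (hs.fderiv_right (m := 1) (by rw [one_add_one_eq_two]; exact two_le_infty)).differentiableAt
      one_ne_zero
  -- In the chart, an iterated derivative along constant fields is a second Fréchet derivative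
  -- evaluated on fixed vectors, hence symmetric.
  have key (u v : TangentSpace (𝓡 4) x) :
      mvfderiv (𝓡 4) (fun y => mvfderiv (𝓡 4) g y (constField v y)) x u =
        fderiv ℝ (fderiv ℝ (g ∘ φ.symm)) (φ x) (modelVector u) (modelVector v) := by
    have hg' : ∀ᶠ y in 𝓝 x, ContMDiffAt (𝓡 4) 𝓘(ℝ, ℝ) 1 g y :=
      (contMDiffAt_iff_contMDiffAt_nhds (by simp)).mp (hg.of_le one_le_infty)
    have h1 : (fun y => mvfderiv (𝓡 4) g y (constField v y)) =ᶠ[𝓝 x]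
        (fun z => fderiv ℝ (g ∘ φ.symm) z (modelVector v)) ∘ φ := by
      filter_upwards [hg', eventually_mem_chart_source (x := x)] with y hy hy'
      exact mvfderiv_constField hy' (hy.mdifferentiableAt one_ne_zero) v
    have hd' : DifferentiableAt ℝ (fun z => fderiv ℝ (g ∘ φ.symm) z (modelVector v)) (φ x) :=
      hd.clm_apply (differentiableAt_const _)
    have h2 : MDifferentiableAt (𝓡 4) 𝓘(ℝ, ℝ)
        ((fun z => fderiv ℝ (g ∘ φ.symm) z (modelVector v)) ∘ φ) x :=
      MDifferentiableAt.comp (I' := 𝓘(ℝ, EuclideanSpace ℝ (Fin 4))) _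
        hd'.mdifferentiableAt (mdifferentiableAt_extChartAt (mem_chart_source _ x))
    have h3 : ((fun z => fderiv ℝ (g ∘ φ.symm) z (modelVector v)) ∘ φ) ∘ φ.symm =ᶠ[𝓝 (φ x)]
        (fun z => fderiv ℝ (g ∘ φ.symm) z (modelVector v)) := by
      filter_upwards [extChartAt_target_mem_nhds (I := 𝓡 4) x] with z hz
      rw [Function.comp_apply, Function.comp_apply, (extChartAt (𝓡 4) x).right_inv hz]
    rw [h1.mvfderiv_eq, mvfderiv_apply_eq_fderiv h2, h3.fderiv_eq,
      fderiv_clm_apply hd (differentiableAt_const _)]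
    simp
  rw [key, key]
  exact (hs.isSymmSndFDerivAt (by
    rw [minSmoothness_of_isRCLikeNormedField]; exact two_le_infty)).eq _ _

end Derivatives

/-! ### Smooth and metric connections on constant fields. -/

section Connections

variable {M : Type*} [TopologicalSpace M] [ChartedSpace (EuclideanSpace ℝ (Fin 4)) M]
  [IsManifold (𝓡 4) ∞ M] {x : M}

section Smoothness

variable (cov : CovariantDerivative (𝓡 4) (EuclideanSpace ℝ (Fin 4))
  (fun x : M => TangentSpace (𝓡 4) x))

/-- The derivative of a field with constant coefficients along such a field. -/
noncomputable def covConst (v w : TangentSpace (𝓡 4) x) (y : M) : TangentSpace (𝓡 4) y :=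
  cov (constField w) y (constField v y)

lemma covConst_self (v w : TangentSpace (𝓡 4) x) :
    covConst cov v w x = cov (constField w) x v := by
  rw [covConst, constField_self]

lemma cov_congr {X Y : ∀ y : M, TangentSpace (𝓡 4) y} {y : M} (hX : DiffFieldAt X y)
    (hY : DiffFieldAt Y y) (h : ∀ᶠ z in 𝓝 y, X z = Y z) : cov X y = cov Y y :=
  cov.isCovariantDerivativeOnUniv.congr_of_eventuallyEq hX hY Filter.univ_mem h

lemma DiffFieldAt.congr {X Y : ∀ y : M, TangentSpace (𝓡 4) y} {y : M} (hX : DiffFieldAt X y)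
    (h : ∀ᶠ z in 𝓝 y, Y z = X z) : DiffFieldAt Y y :=
  MDifferentiableAt.congr_of_eventuallyEq hX (h.mono fun z hz => by simp only [hz])

lemma cov_congr_of_diffFieldAt {X Y : ∀ y : M, TangentSpace (𝓡 4) y} {y : M} (hX : DiffFieldAt X y)
    (h : ∀ᶠ z in 𝓝 y, Y z = X z) : cov Y y = cov X y :=
  cov_congr cov (hX.congr h) hX h

/-- The derivatives of constant fields of a smooth connection are smooth. -/
lemma smoothFieldAt_covConst [T2Space M]
    [hc : CovariantDerivative.ContMDiffCovariantDerivative cov ∞] (v w : TangentSpace (𝓡 4) x) :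
    SmoothFieldAt (covConst cov v w) x := by
  obtain ⟨s, hs, hw⟩ := FiberBundle.exists_contMDiffOn_extend (k := ∞) (𝓡 4)
    (EuclideanSpace ℝ (Fin 4)) w
  obtain ⟨u, hus, hu, hxu⟩ := mem_nhds_iff.mp hs
  -- Smoothness of the connection is applied to a field that is smooth everywhere, whereas
  -- `constField w` is smooth only near `x`. A bump function equal to one near `x` cuts it off
  -- without changing its covariant derivative there.
  obtain ⟨f, -, hf⟩ := (SmoothBumpFunction.nhds_basis_tsupport (I := 𝓡 4) x).mem_iff.mp
    (hu.mem_nhds hxu)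
  have hsm := (f.contMDiff.contMDiffOn (s := u)).smul_section_of_tsupport hu hf (hw.mono hus)
  have hcov := (hc.contMDiff.contMDiff (σ := (f : M → ℝ) • constField w)
    hsm.contMDiffOn).contMDiffAt (Filter.univ_mem (f := 𝓝 x))
  have happ := hcov.clm_bundle_apply (smoothFieldAt_constField v)
  refine happ.congr_of_eventuallyEq ?_
  filter_upwards [eventually_eventually_nhds.mpr f.eventuallyEq_one,
    eventually_diffFieldAt_constField w] with y hy hwy
  have : cov ((f : M → ℝ) • constField w) y = cov (constField w) y := by
    refine cov_congr_of_diffFieldAt cov hwy (hy.mono fun z hz => ?_)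
    rw [Pi.smul_apply', hz, Pi.one_apply, one_smul]
  rw [covConst, ← this]

lemma eventually_torsion_constField (v w : TangentSpace (𝓡 4) x) :
    ∀ᶠ y in 𝓝 x, cov.torsion y (constField v y) (constField w y) =
      covConst cov v w y - covConst cov w v y := by
  filter_upwards [eventually_mlieBracket_constField v w, eventually_diffFieldAt_constField v,
    eventually_diffFieldAt_constField w] with y h hv hw
  rw [cov.torsion_apply hv hw, h, sub_zero]
  rfl

end Smoothness

section Metric

variable [RiemannianBundle (fun x : M => TangentSpace (𝓡 4) x)]
  [IsContMDiffRiemannianBundle (𝓡 4) ∞ (EuclideanSpace ℝ (Fin 4))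
    (fun x : M => TangentSpace (𝓡 4) x)]

lemma SmoothFieldAt.inner {X Y : ∀ y : M, TangentSpace (𝓡 4) y} (hX : SmoothFieldAt X x)
    (hY : SmoothFieldAt Y x) : ContMDiffAt (𝓡 4) 𝓘(ℝ, ℝ) ∞ (fun y => ⟪X y, Y y⟫) x :=
  ContMDiffAt.inner_bundle hX hY

lemma DiffFieldAt.inner {X Y : ∀ y : M, TangentSpace (𝓡 4) y} {y : M} (hX : DiffFieldAt X y)
    (hY : DiffFieldAt Y y) : MDifferentiableAt (𝓡 4) 𝓘(ℝ, ℝ) (fun y => ⟪X y, Y y⟫) y :=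
  MDifferentiableAt.inner_bundle hX hY

variable {cov : CovariantDerivative (𝓡 4) (EuclideanSpace ℝ (Fin 4))
  (fun x : M => TangentSpace (𝓡 4) x)}

lemma mvfderiv_inner (hm : cov.IsMetricCompatible) {X Y : ∀ y : M, TangentSpace (𝓡 4) y} {y : M}
    (hX : DiffFieldAt X y) (hY : DiffFieldAt Y y) (u : TangentSpace (𝓡 4) y) :
    mvfderiv (𝓡 4) (fun y => ⟪X y, Y y⟫) y u = ⟪cov X y u, Y y⟫ + ⟪X y, cov Y y u⟫ := by
  have h := hm.mvfderiv_inner_eq (constField u) hX hY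
  simpa only [constField_self] using h

/-- The Christoffel symbols of the first kind with respect to constant fields. -/
noncomputable def christoffel (cov : CovariantDerivative (𝓡 4) (EuclideanSpace ℝ (Fin 4))
    (fun x : M => TangentSpace (𝓡 4) x)) (v w z : TangentSpace (𝓡 4) x) (y : M) : ℝ :=
  ⟪covConst cov v w y, constField z y⟫

lemma mvfderiv_christoffel (hm : cov.IsMetricCompatible) {v w : TangentSpace (𝓡 4) x}
    (h : DiffFieldAt (covConst cov v w) x) (u z : TangentSpace (𝓡 4) x) :
    mvfderiv (𝓡 4) (christoffel cov v w z) x u =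
      ⟪cov (covConst cov v w) x u, z⟫ + ⟪covConst cov v w x, covConst cov u z x⟫ := by
  have := mvfderiv_inner hm h (diffFieldAt_constField z) u
  rw [constField_self] at this
  rw [covConst_self cov u z, ← this]
  rfl

lemma mdifferentiableAt_christoffel {v w : TangentSpace (𝓡 4) x}
    (h : DiffFieldAt (covConst cov v w) x) (z : TangentSpace (𝓡 4) x) :
    MDifferentiableAt (𝓡 4) 𝓘(ℝ, ℝ) (christoffel cov v w z) x :=
  h.inner (diffFieldAt_constField z)

/-- The curvature tensor in terms of Christoffel symbols. -/
theorem inner_curvature (hm : cov.IsMetricCompatible)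
    (h : ∀ v w : TangentSpace (𝓡 4) x, DiffFieldAt (covConst cov v w) x)
    (u v w z : TangentSpace (𝓡 4) x) :
    ⟪curvature cov x u v w, z⟫ =
      mvfderiv (𝓡 4) (christoffel cov v w z) x u - mvfderiv (𝓡 4) (christoffel cov u w z) x v
        - ⟪covConst cov v w x, covConst cov u z x⟫ + ⟪covConst cov u w x, covConst cov v z x⟫ := by
  have hb := (eventually_mlieBracket_constField u v).self_of_nhds
  have e : curvature cov x u v w = cov (covConst cov v w) x u - cov (covConst cov u w) x v
      - cov (constField w) x
        (VectorField.mlieBracket (𝓡 4) (constField u) (constField v) x) := rfl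
  rw [e, hb, map_zero, sub_zero, inner_sub_left, mvfderiv_christoffel hm (h v w),
    mvfderiv_christoffel hm (h u w)]
  ring

lemma eventually_mvfderiv_inner_constField (hm : cov.IsMetricCompatible)
    (v w z : TangentSpace (𝓡 4) x) :
    ∀ᶠ y in 𝓝 x, mvfderiv (𝓡 4) (fun y => ⟪constField w y, constField z y⟫) y (constField v y) =
      christoffel cov v w z y + christoffel cov v z w y := by
  filter_upwards [eventually_diffFieldAt_constField w, eventually_diffFieldAt_constField z]
    with y hw hz
  rw [mvfderiv_inner hm hw hz, christoffel, christoffel, covConst, covConst,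
    real_inner_comm (constField w y)]

/-- The curvature of a metric connection is skew-symmetric in the last two arguments. -/
theorem inner_curvature_skew (hm : cov.IsMetricCompatible)
    (h : ∀ v w : TangentSpace (𝓡 4) x, DiffFieldAt (covConst cov v w) x)
    (u v w z : TangentSpace (𝓡 4) x) :
    ⟪curvature cov x u v z, w⟫ = -⟪curvature cov x u v w, z⟫ := by
  have key (u v : TangentSpace (𝓡 4) x) :
      mvfderiv (𝓡 4) (christoffel cov v w z) x u + mvfderiv (𝓡 4) (christoffel cov v z w) x u =
        mvfderiv (𝓡 4) (fun y => mvfderiv (𝓡 4) (fun y => ⟪constField w y, constField z y⟫) y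
          (constField v y)) x u := by
    have e := Filter.EventuallyEq.mvfderiv_eq (eventually_mvfderiv_inner_constField hm v w z) u
    rw [e, mvfderiv_fun_add (mdifferentiableAt_christoffel (h v w) z)
      (mdifferentiableAt_christoffel (h v z) w)]
    rfl
  -- By `key`, the symmetrized derivatives of the Christoffel symbols are second derivatives of the
  -- metric coefficients, and these commute.
  have hs := mvfderiv_mvfderiv_comm
    ((smoothFieldAt_constField w).inner (smoothFieldAt_constField z)) u v
  rw [← key u v, ← key v u] at hs
  rw [inner_curvature hm h, inner_curvature hm h, real_inner_comm (covConst cov u w x),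
    real_inner_comm (covConst cov u z x) (covConst cov v w x)]
  linarith

end Metric

end Connections

/-! ### Comparison of the curvature with that of the Levi-Civita connection. -/

section SkewTorsionConnections

variable {M : Type*} [TopologicalSpace M] [ChartedSpace (EuclideanSpace ℝ (Fin 4)) M]
  [IsManifold (𝓡 4) ∞ M] {x : M}
  {nabla nablaG : CovariantDerivative (𝓡 4) (EuclideanSpace ℝ (Fin 4))
    (fun x : M => TangentSpace (𝓡 4) x)}
  {H : ∀ x : M, TangentSpace (𝓡 4) x [⋀^Fin 3]→L[ℝ] ℝ}

lemma threeForm_swap_left {V : Type*} [NormedAddCommGroup V] [NormedSpace ℝ V]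
    (α : V [⋀^Fin 3]→L[ℝ] ℝ) (u v w : V) : α ![v, u, w] = -α ![u, v, w] := by
  have h := α.toAlternatingMap.map_swap ![u, v, w] (i := 0) (j := 1) (by decide)
  have e : ![u, v, w] ∘ Equiv.swap (0 : Fin 3) 1 = ![v, u, w] := by
    ext i
    fin_cases i <;> rfl
  rwa [e] at h

lemma threeForm_swap_right {V : Type*} [NormedAddCommGroup V] [NormedSpace ℝ V]
    (α : V [⋀^Fin 3]→L[ℝ] ℝ) (u v w : V) : α ![u, w, v] = -α ![u, v, w] := by
  have h := α.toAlternatingMap.map_swap ![u, v, w] (i := 1) (j := 2) (by decide)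
  have e : ![u, v, w] ∘ Equiv.swap (1 : Fin 3) 2 = ![u, w, v] := by
    ext i
    fin_cases i <;> rfl
  rwa [e] at h

/-- The components of a three-form on fields with constant coefficients. -/
noncomputable def constComponent (H : ∀ x : M, TangentSpace (𝓡 4) x [⋀^Fin 3]→L[ℝ] ℝ)
    (v w z : TangentSpace (𝓡 4) x) (y : M) : ℝ :=
  H y ![constField v y, constField w y, constField z y]

lemma constComponent_self (v w z : TangentSpace (𝓡 4) x) :
    constComponent H v w z x = H x ![v, w, z] := by
  rw [constComponent, constField_self, constField_self, constField_self]

lemma torsion_eq_covConst (u v : TangentSpace (𝓡 4) x) :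
    nabla.torsion x u v = covConst nabla u v x - covConst nabla v u x := by
  have := (eventually_torsion_constField nabla u v).self_of_nhds
  rwa [constField_self, constField_self] at this

variable
  [RiemannianBundle (fun x : M => TangentSpace (𝓡 4) x)]
  [IsContMDiffRiemannianBundle (𝓡 4) ∞ (EuclideanSpace ℝ (Fin 4))
    (fun x : M => TangentSpace (𝓡 4) x)]

/-- The Levi-Civita connection is `∇ - T / 2` for every metric connection `∇` with skew torsion
`T`. -/
theorem leviCivita_apply (hH : HasSkewTorsion nabla H) (hG : IsLeviCivita nablaG)
    {X : ∀ y : M, TangentSpace (𝓡 4) y} (hX : DiffFieldAt X x) (u : TangentSpace (𝓡 4) x) :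
    nablaG X x u = nabla X x u - (2⁻¹ : ℝ) • nabla.torsion x u (X x) := by
  set A := nabla.isCovariantDerivativeOnUniv.difference nablaG.isCovariantDerivativeOnUniv x with hA
  have hd {Y : ∀ y : M, TangentSpace (𝓡 4) y} (hY : DiffFieldAt Y x) (u : TangentSpace (𝓡 4) x) :
      A (Y x) u = nabla Y x u - nablaG Y x u := by
    rw [hA, IsCovariantDerivativeOn.difference_apply _ _ (Set.mem_univ x) hY]
    rfl
  have hc (v u : TangentSpace (𝓡 4) x) :
      A v u = nabla (constField v) x u - nablaG (constField v) x u := by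
    have := hd (diffFieldAt_constField v) u
    rwa [constField_self] at this
  have hskew (u v w : TangentSpace (𝓡 4) x) : ⟪A v u, w⟫ = -⟪A w u, v⟫ := by
    have h1 := mvfderiv_inner hH.1 (diffFieldAt_constField v) (diffFieldAt_constField w) u
    have h2 := mvfderiv_inner hG.1 (diffFieldAt_constField v) (diffFieldAt_constField w) u
    rw [constField_self, constField_self] at h1 h2
    rw [hc, hc, inner_sub_left, inner_sub_left, real_inner_comm v, real_inner_comm v]
    linarith
  have htor (u v : TangentSpace (𝓡 4) x) : A v u - A u v = nabla.torsion x u v := by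
    have h1 := nabla.torsion_apply (diffFieldAt_constField u) (diffFieldAt_constField v)
    have h2 := nablaG.torsion_apply (diffFieldAt_constField u) (diffFieldAt_constField v)
    rw [hG.2] at h2
    rw [constField_self, constField_self] at h1 h2
    have h3 : nablaG (constField v) x u - nablaG (constField u) x v
      - VectorField.mlieBracket (𝓡 4) (constField u) (constField v) x = 0 := h2.symm
    have h4 : VectorField.mlieBracket (𝓡 4) (constField u) (constField v) x =
      nablaG (constField v) x u - nablaG (constField u) x v := (sub_eq_zero.mp h3).symm
    rw [h1, h4, hc, hc]
    abel
  have hT (u v w : TangentSpace (𝓡 4) x) : ⟪A v u, w⟫ - ⟪A u v, w⟫ = H x ![u, v, w] := by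
    rw [← inner_sub_left, htor, hH.2]
  -- The Koszul argument: the difference tensor `A` is skew in its value slot because both
  -- connections are metric, and its antisymmetrization is the torsion. Three cyclic copies of these
  -- relations determine `A`.
  have key (u v w : TangentSpace (𝓡 4) x) : ⟪A v u, w⟫ = 2⁻¹ * H x ![u, v, w] := by
    have e1 := threeForm_swap_left (H x) u v w
    have e2 := threeForm_swap_right (H x) u v w
    have e3 := threeForm_swap_right (H x) v u w
    have e4 := threeForm_swap_left (H x) u w v
    linarith [hT u v w, hT v w u, hT w u v, hskew u v w, hskew v w u, hskew w u v]
  have : A (X x) u = (2⁻¹ : ℝ) • nabla.torsion x u (X x) := by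
    refine ext_inner_right ℝ fun w => ?_
    rw [key, real_inner_smul_left, hH.2]
  rw [← this, hd hX]
  abel

/-- On constant fields the torsion is the antisymmetrization of `covConst nabla`, so subtracting
half of it leaves the symmetrization. -/
lemma eventually_covConst_leviCivita (hH : HasSkewTorsion nabla H) (hG : IsLeviCivita nablaG)
    (v w : TangentSpace (𝓡 4) x) :
    ∀ᶠ y in 𝓝 x, covConst nablaG v w y =
      (2⁻¹ : ℝ) • (covConst nabla v w y + covConst nabla w v y) := by
  filter_upwards [eventually_torsion_constField nabla v w, eventually_diffFieldAt_constField w]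
    with y hy hw
  rw [covConst, leviCivita_apply hH hG hw, hy, covConst]
  module

lemma covConst_leviCivita (hH : HasSkewTorsion nabla H) (hG : IsLeviCivita nablaG)
    (v w : TangentSpace (𝓡 4) x) :
    covConst nablaG v w x = (2⁻¹ : ℝ) • (covConst nabla v w x + covConst nabla w v x) :=
  (eventually_covConst_leviCivita hH hG v w).self_of_nhds

/-- The regularity of the Levi-Civita connection is not a hypothesis; it is inherited from `nabla`.
-/
lemma diffFieldAt_covConst_leviCivita (hH : HasSkewTorsion nabla H) (hG : IsLeviCivita nablaG)
    (h : ∀ v w : TangentSpace (𝓡 4) x, DiffFieldAt (covConst nabla v w) x)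
    (v w : TangentSpace (𝓡 4) x) : DiffFieldAt (covConst nablaG v w) x := by
  refine DiffFieldAt.congr (X := (2⁻¹ : ℝ) • (covConst nabla v w + covConst nabla w v)) ?_
    (eventually_covConst_leviCivita hH hG v w)
  exact MDifferentiableAt.smul_section (f := fun _ => (2⁻¹ : ℝ)) mdifferentiableAt_const
    (mdifferentiableAt_add_section (h v w) (h w v))

lemma eventually_christoffel_leviCivita (hH : HasSkewTorsion nabla H) (hG : IsLeviCivita nablaG)
    (v w z : TangentSpace (𝓡 4) x) :
    ∀ᶠ y in 𝓝 x, christoffel nablaG v w z y =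
      2⁻¹ * (christoffel nabla v w z y + christoffel nabla w v z y) := by
  filter_upwards [eventually_covConst_leviCivita hH hG v w] with y hy
  rw [christoffel, hy, real_inner_smul_left, inner_add_left, christoffel, christoffel]

/-- Since `H` is the torsion, its components are Christoffel symbols. Its differentiability
therefore follows from that of the connection. -/
lemma eventually_constComponent (hH : HasSkewTorsion nabla H) (v w z : TangentSpace (𝓡 4) x) :
    ∀ᶠ y in 𝓝 x, constComponent H v w z y =
      christoffel nabla v w z y - christoffel nabla w v z y := by
  filter_upwards [eventually_torsion_constField nabla v w] with y hy
  rw [constComponent, ← hH.2, hy, inner_sub_left, christoffel, christoffel]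

lemma mdifferentiableAt_constComponent (hH : HasSkewTorsion nabla H)
    (h : ∀ v w : TangentSpace (𝓡 4) x, DiffFieldAt (covConst nabla v w) x)
    (v w z : TangentSpace (𝓡 4) x) :
    MDifferentiableAt (𝓡 4) 𝓘(ℝ, ℝ) (constComponent H v w z) x :=
  ((mdifferentiableAt_christoffel (h v w) z).sub
    (mdifferentiableAt_christoffel (h w v) z)).congr_of_eventuallyEq
    (eventually_constComponent hH v w z)

lemma mvfderiv_constComponent (hH : HasSkewTorsion nabla H)
    (h : ∀ v w : TangentSpace (𝓡 4) x, DiffFieldAt (covConst nabla v w) x)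
    (u v w z : TangentSpace (𝓡 4) x) :
    mvfderiv (𝓡 4) (constComponent H v w z) x u =
      mvfderiv (𝓡 4) (christoffel nabla v w z) x u
        - mvfderiv (𝓡 4) (christoffel nabla w v z) x u := by
  rw [Filter.EventuallyEq.mvfderiv_eq (eventually_constComponent hH v w z) u,
    mvfderiv_fun_sub (mdifferentiableAt_christoffel (h v w) z)
      (mdifferentiableAt_christoffel (h w v) z)]
  rfl

lemma mvfderiv_christoffel_leviCivita (hH : HasSkewTorsion nabla H) (hG : IsLeviCivita nablaG)
    (h : ∀ v w : TangentSpace (𝓡 4) x, DiffFieldAt (covConst nabla v w) x)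
    (u v w z : TangentSpace (𝓡 4) x) :
    mvfderiv (𝓡 4) (christoffel nablaG v w z) x u =
      2⁻¹ * (mvfderiv (𝓡 4) (christoffel nabla v w z) x u
        + mvfderiv (𝓡 4) (christoffel nabla w v z) x u) := by
  have h1 := mdifferentiableAt_christoffel (h v w) z
  have h2 := mdifferentiableAt_christoffel (h w v) z
  have h12 : MDifferentiableAt (𝓡 4) 𝓘(ℝ, ℝ)
    (fun y => christoffel nabla v w z y + christoffel nabla w v z y) x := h1.add h2
  rw [Filter.EventuallyEq.mvfderiv_eq (eventually_christoffel_leviCivita hH hG v w z) u,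
    mvfderiv_fun_mul (f := fun _ => (2⁻¹ : ℝ)) mdifferentiableAt_const h12,
    mvfderiv_const]
  have : mvfderiv (𝓡 4) (fun y => christoffel nabla v w z y + christoffel nabla w v z y) x =
    mvfderiv (𝓡 4) (christoffel nabla v w z) x + mvfderiv (𝓡 4) (christoffel nabla w v z) x :=
      mvfderiv_fun_add h1 h2
  rw [this]
  simp [mul_add]

/-- The covariant derivative of the three-form `H`. -/
noncomputable def covThreeForm (nabla : CovariantDerivative (𝓡 4) (EuclideanSpace ℝ (Fin 4))
    (fun x : M => TangentSpace (𝓡 4) x)) (H : ∀ x : M, TangentSpace (𝓡 4) x [⋀^Fin 3]→L[ℝ] ℝ)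
    (u v w z : TangentSpace (𝓡 4) x) : ℝ :=
  mvfderiv (𝓡 4) (constComponent H v w z) x u - H x ![covConst nabla u v x, w, z]
    - H x ![v, covConst nabla u w x, z] - H x ![v, w, covConst nabla u z x]

/-- The curvature of a metric connection with skew torsion in terms of the Riemannian curvature. -/
theorem inner_curvature_skewTorsion (hH : HasSkewTorsion nabla H) (hG : IsLeviCivita nablaG)
    (h : ∀ v w : TangentSpace (𝓡 4) x, DiffFieldAt (covConst nabla v w) x)
    (u v w z : TangentSpace (𝓡 4) x) :
    ⟪curvature nabla x u v w, z⟫ = ⟪curvature nablaG x u v w, z⟫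
      + 2⁻¹ * (covThreeForm nabla H u v w z - covThreeForm nabla H v u w z
        + H x ![nabla.torsion x u v, w, z])
      - 4⁻¹ * (H x ![u, nabla.torsion x v w, z] - H x ![v, nabla.torsion x u w, z]) := by
  -- Everything is to be written through Christoffel symbols of `nabla`. The three variants handle a
  -- connection term `c` standing in the first, middle or last slot of `H`.
  have hr (a b c : TangentSpace (𝓡 4) x) : H x ![c, a, b] =
      ⟪covConst nabla a b x, c⟫ - ⟪covConst nabla b a x, c⟫ := by
    rw [threeForm_swap_left, threeForm_swap_right, neg_neg, ← hH.2, torsion_eq_covConst,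
      inner_sub_left]
  have hm (a b c : TangentSpace (𝓡 4) x) : H x ![a, c, b] =
      -⟪covConst nabla a b x, c⟫ + ⟪covConst nabla b a x, c⟫ := by
    rw [threeForm_swap_left, hr]
    ring
  have hl (a b c : TangentSpace (𝓡 4) x) : H x ![a, b, c] =
      ⟪covConst nabla a b x, c⟫ - ⟪covConst nabla b a x, c⟫ := by
    rw [← hH.2, torsion_eq_covConst, inner_sub_left]
  simp only [inner_curvature hH.1 h, inner_curvature hG.1 (diffFieldAt_covConst_leviCivita hH hG h),
    mvfderiv_christoffel_leviCivita hH hG h, covThreeForm, mvfderiv_constComponent hH h]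
  rw [hr w z, hr w z, hr w z, hm v z, hm u z, hm u z, hm v z, hl v w, hl u w]
  simp only [torsion_eq_covConst, covConst_leviCivita hH hG, real_inner_smul_left,
    real_inner_smul_right, inner_add_left, inner_add_right, inner_sub_right]
  set k := fun a b : TangentSpace (𝓡 4) x => covConst nabla a b x
  -- The two sides now agree up to the order of the factors in inner products of connection terms.
  have c (a b a' b' : TangentSpace (𝓡 4) x) := real_inner_comm (k a b) (k a' b')
  linarith [c u v w z, c v u w z, c u v z w, c v u z w, c u w v z, c w u v z, c u w z v,
    c w u z v, c v w u z, c w v u z, c v w z u, c w v z u]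

lemma inner_curvature_swap (hm : nabla.IsMetricCompatible)
    (h : ∀ v w : TangentSpace (𝓡 4) x, DiffFieldAt (covConst nabla v w) x)
    (u v w z : TangentSpace (𝓡 4) x) :
    ⟪curvature nabla x v u w, z⟫ = -⟪curvature nabla x u v w, z⟫ := by
  rw [inner_curvature hm h, inner_curvature hm h]
  ring

/-- The first Bianchi identity. -/
theorem inner_curvature_leviCivita_bianchi (hH : HasSkewTorsion nabla H) (hG : IsLeviCivita nablaG)
    (h : ∀ v w : TangentSpace (𝓡 4) x, DiffFieldAt (covConst nabla v w) x)
    (u v w z : TangentSpace (𝓡 4) x) :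
    ⟪curvature nablaG x u v w, z⟫ + ⟪curvature nablaG x v w u, z⟫
      + ⟪curvature nablaG x w u v, z⟫ = 0 := by
  simp only [inner_curvature hG.1 (diffFieldAt_covConst_leviCivita hH hG h),
    mvfderiv_christoffel_leviCivita hH hG h]
  rw [covConst_leviCivita hH hG w v, covConst_leviCivita hH hG v u, covConst_leviCivita hH hG u w,
    covConst_leviCivita hH hG v w, covConst_leviCivita hH hG u v, covConst_leviCivita hH hG w u,
    add_comm (covConst nabla w v x), add_comm (covConst nabla v u x),
    add_comm (covConst nabla u w x)]
  ring

end SkewTorsionConnections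

/-! ### The exterior derivative on constant fields. -/

section ExteriorDerivative

/-- A field of alternating forms on a finite-dimensional space is differentiable if its components
are. -/
lemma differentiableAt_of_forall_apply {E V : Type*} [NormedAddCommGroup E] [NormedSpace ℝ E]
    [NormedAddCommGroup V] [NormedSpace ℝ V] [FiniteDimensional ℝ V] {k : ℕ}
    {η : E → V [⋀^Fin k]→L[ℝ] ℝ} {z : E}
    (h : ∀ v : Fin k → V, DifferentiableAt ℝ (fun y => η y v) z) : DifferentiableAt ℝ η z := by
  let b := Module.finBasis ℝ V
  let L : (V [⋀^Fin k]→L[ℝ] ℝ) →ₗ[ℝ] ((Fin k → Fin (finrank ℝ V)) → ℝ) :=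
    { toFun := fun α f => α fun i => b (f i)
      map_add' := fun _ _ => rfl
      map_smul' := fun _ _ => rfl }
  have hL : Function.Injective L := fun α β hαβ => by
    apply ContinuousAlternatingMap.toContinuousMultilinearMap_injective
    apply ContinuousMultilinearMap.toMultilinearMap_injective
    exact Basis.ext_multilinear (fun _ => b) fun f => congrFun hαβ f
  -- A linear left inverse of the evaluation on basis vectors recovers the form from finitely many
  -- components.
  obtain ⟨g, hg⟩ := L.exists_leftInverse_of_injective (LinearMap.ker_eq_bot.mpr hL)
  have e : η = fun y => g.toContinuousLinearMap (L (η y)) := by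
    ext1 y
    exact (DFunLike.congr_fun hg (η y)).symm
  rw [e]
  exact (ContinuousLinearMap.differentiableAt _).comp z
    (differentiableAt_pi.mpr fun f => h fun i => b (f i))

variable {M : Type*} [TopologicalSpace M] [ChartedSpace (EuclideanSpace ℝ (Fin 4)) M]
  [IsManifold (𝓡 4) ∞ M] {x : M}

lemma mfderiv_extChartAt_symm_modelVector (v : TangentSpace (𝓡 4) x) {z : EuclideanSpace ℝ (Fin 4)}
    (hz : z ∈ (extChartAt (𝓡 4) x).target) :
    mfderiv 𝓘(ℝ, EuclideanSpace ℝ (Fin 4)) (𝓡 4) (extChartAt (𝓡 4) x).symm z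
      (modelField (modelVector v) z) = constField v ((extChartAt (𝓡 4) x).symm z) := by
  obtain ⟨y, hy, rfl⟩ : ∃ y ∈ (chartAt (EuclideanSpace ℝ (Fin 4)) x).source,
      extChartAt (𝓡 4) x y = z :=
    ⟨(extChartAt (𝓡 4) x).symm z, by simpa using (extChartAt (𝓡 4) x).map_target hz,
      (extChartAt (𝓡 4) x).right_inv hz⟩
  have hy' : y ∈ (extChartAt (𝓡 4) x).source := by simpa using hy
  have h := mfderivWithin_extChartAt_symm_comp_mfderiv_extChartAt' (I := 𝓡 4) hy'
  rw [ModelWithCorners.range_eq_univ, mfderivWithin_univ] at h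
  rw [← mfderiv_extChartAt_constField v hy, (extChartAt (𝓡 4) x).left_inv hy']
  exact DFunLike.congr_fun h (constField v y)

/-- The exterior derivative in terms of fields with constant coefficients. -/
theorem extD_apply {k : ℕ} {α : ∀ x : M, TangentSpace (𝓡 4) x [⋀^Fin k]→L[ℝ] ℝ}
    (h : ∀ v : Fin k → TangentSpace (𝓡 4) x,
      MDifferentiableAt (𝓡 4) 𝓘(ℝ, ℝ) (fun y => α y fun i => constField (v i) y) x)
    (v : Fin (k + 1) → TangentSpace (𝓡 4) x) :
    extD α x v = ∑ i : Fin (k + 1), (-1) ^ i.val *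
      mvfderiv (𝓡 4) (fun y => α y fun j => constField (i.removeNth v j) y) x (v i) := by
  let η : EuclideanSpace ℝ (Fin 4) → EuclideanSpace ℝ (Fin 4) [⋀^Fin k]→L[ℝ] ℝ := fun z =>
    (α ((extChartAt (𝓡 4) x).symm z)).compContinuousLinearMap
      (mfderiv 𝓘(ℝ, EuclideanSpace ℝ (Fin 4)) (𝓡 4) (extChartAt (𝓡 4) x).symm z)
  -- The inverse chart carries fixed model vectors to constant fields, so only derivatives of
  -- components occur and there is no bracket term.
  have key (v : Fin k → TangentSpace (𝓡 4) x) :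
      (fun z => η z fun i => modelVector (v i)) =ᶠ[𝓝 (extChartAt (𝓡 4) x x)]
        (fun y => α y fun i => constField (v i) y) ∘ (extChartAt (𝓡 4) x).symm := by
    filter_upwards [extChartAt_target_mem_nhds (I := 𝓡 4) x] with z hz
    change α _ (fun i => _) = α _ (fun i => _)
    congr 1
    ext1 i
    exact mfderiv_extChartAt_symm_modelVector (v i) hz
  have hd : DifferentiableAt ℝ η (extChartAt (𝓡 4) x x) := by
    refine differentiableAt_of_forall_apply fun v => ?_
    exact (key v).differentiableAt_iff.mpr
      (differentiableAt_comp_extChartAt_symm (mem_chart_source _ x) (h v))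
  have hv (v : TangentSpace (𝓡 4) x) :
      mfderiv (𝓡 4) 𝓘(ℝ, EuclideanSpace ℝ (Fin 4)) (extChartAt (𝓡 4) x) x v = modelVector v := by
    rw [mfderiv_extChartAt_self]
    rfl
  have e : extD α x v = extDeriv η (extChartAt (𝓡 4) x x) fun i => modelVector (v i) := by
    change extDeriv η _ (fun i => _) = _
    congr 1
    ext1 i
    exact hv (v i)
  rw [e, extDeriv_apply hd]
  refine Finset.sum_congr rfl fun i _ => ?_
  rw [mvfderiv_apply_eq_fderiv (h _), ← (key (i.removeNth v)).fderiv_eq, zsmul_eq_mul]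
  push_cast
  rfl

end ExteriorDerivative

/-! ### The Hodge star on three- and four-forms. -/

lemma alternating_three_rules {d : Fin 4 → Fin 4 → Fin 4 → ℝ} (hl : ∀ i j k, d j i k = -d i j k)
    (hr : ∀ i j k, d i k j = -d i j k) :
    (∀ i j, d i i j = 0) ∧ (∀ i j, d i j j = 0) ∧ (∀ i j, d i j i = 0) ∧
    d 0 2 1 = -d 0 1 2 ∧ d 0 3 1 = -d 0 1 3 ∧ d 0 3 2 = -d 0 2 3 ∧ d 1 0 2 = -d 0 1 2 ∧ d 1
    0 3 = -d 0 1 3 ∧ d 1 2 0 = d 0 1 2 ∧ d 1 3 0 = d 0 1 3 ∧ d 1 3 2 = -d 1 2 3 ∧ d 2 0 1 =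
    d 0 1 2 ∧ d 2 0 3 = -d 0 2 3 ∧ d 2 1 0 = -d 0 1 2 ∧ d 2 1 3 = -d 1 2 3 ∧ d 2 3 0 = d 0 2
    3 ∧ d 2 3 1 = d 1 2 3 ∧ d 3 0 1 = d 0 1 3 ∧ d 3 0 2 = d 0 2 3 ∧ d 3 1 0 = -d 0 1 3 ∧ d 3
    1 2 = d 1 2 3 ∧ d 3 2 0 = -d 0 2 3 ∧ d 3 2 1 = -d 1 2 3 := by
  have h1 (i j) : d i i j = 0 := by linarith [hl i i j]
  have h2 (i j) : d i j j = 0 := by linarith [hr i j j]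
  refine ⟨h1, h2, fun i j => by rw [hr i i j, h1, neg_zero], ?_⟩
  have h3 (i j k) : d j k i = d i j k := by rw [hr, hl, neg_neg]
  have h4 (i j k) : d k i j = d i j k := by rw [hl, hr, neg_neg]
  have h5 (i j k) : d k j i = -d i j k := by rw [hl, h3]
  refine ⟨?_, ?_, ?_, ?_, ?_, ?_, ?_, ?_, ?_, ?_, ?_, ?_, ?_, ?_, ?_, ?_, ?_, ?_, ?_, ?_⟩ <;>
    first | exact hl _ _ _ | exact hr _ _ _ | exact h3 _ _ _ | exact h4 _ _ _ | exact h5 _ _ _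

/-- Four entries determine an alternating array with three indices in dimension four; `t` lists them
with the signs of the Hodge star. It serves both for `H` and for its covariant derivative. -/
lemma eq_threeFormOf {d : Fin 4 → Fin 4 → Fin 4 → ℝ} (hl : ∀ i j k, d j i k = -d i j k)
    (hr : ∀ i j k, d i k j = -d i j k) {t : Fin 4 → ℝ} (h0 : t 0 = -d 1 2 3) (h1 : t 1 = d 0 2 3)
    (h2 : t 2 = -d 0 1 3) (h3 : t 3 = d 0 1 2) (i j k : Fin 4) : d i j k = threeFormOf t i j k := by
  obtain ⟨a1, a2, a3, a⟩ := alternating_three_rules hl hr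
  obtain ⟨b1, b2, b3, b⟩ := threeFormOf_rules t
  rw [h0, h1, h2, h3] at b
  fin_cases i <;> fin_cases j <;> fin_cases k <;>
    simp only [Fin.zero_eta, Fin.mk_one, Fin.reduceFinMk, a1, a2, a3, b1, b2, b3, a, b, neg_neg]

section HodgeDual

variable {V : Type*} [NormedAddCommGroup V] [InnerProductSpace ℝ V]
  [Fact (finrank ℝ V = 4)] (o : Orientation ℝ V (Fin 4))

lemma vec_four_frame : (fun i => frame o i) = ![frame o 0, frame o 1, frame o 2, frame o 3] := by
  ext1 i
  fin_cases i <;> rfl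

/-- Every four-form is a multiple of the volume form. -/
lemma fourForm_apply (β : V [⋀^Fin 4]→L[ℝ] ℝ) (v : Fin 4 → V) :
    β v = β (fun i => frame o i) * o.volumeForm v := by
  have ho : (frame o).toBasis.orientation = o :=
    o.finOrthonormalBasis_orientation (by norm_num) Fact.out
  have h := β.toAlternatingMap.eq_smul_basis_det (frame o).toBasis
  rw [← o.volumeForm_robust (frame o) ho] at h
  have h' := DFunLike.congr_fun h v
  simpa using h'

lemma hodgeStar_four_eq (β : V [⋀^Fin 4]→L[ℝ] ℝ) :
    hodgeStar o (k := 4) (l := 0) rfl β ![] = β ![frame o 0, frame o 1, frame o 2, frame o 3] := by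
  rw [hodgeStar_four_apply, ← vec_four_frame]
  have e (a b c d : Fin 4) : β ![frame o a, frame o b, frame o c, frame o d] *
      leviCivitaSymbol a b c d = β (fun i => frame o i) *
        ((leviCivitaSymbol a b c d * leviCivitaSymbol a b c d : ℤ) : ℝ) := by
    rw [fourForm_apply o β, volumeForm_frame]
    push_cast
    ring
  simp only [e, ← Finset.mul_sum, ← Int.cast_sum]
  -- Each of the 24 permutations contributes one, which cancels the factor `1/4!` of the star.
  have h : ∑ a, ∑ b, ∑ c, ∑ d, leviCivitaSymbol a b c d * leviCivitaSymbol a b c d = 24 := by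
    rfl
  rw [h]
  push_cast
  ring

lemma hodgeStar_three_frame (β : V [⋀^Fin 3]→L[ℝ] ℝ) :
    hodgeStar o (k := 3) (l := 1) rfl β ![frame o 0] = -β ![frame o 1, frame o 2, frame o 3] ∧
    hodgeStar o (k := 3) (l := 1) rfl β ![frame o 1] = β ![frame o 0, frame o 2, frame o 3] ∧
    hodgeStar o (k := 3) (l := 1) rfl β ![frame o 2] = -β ![frame o 0, frame o 1, frame o 3] ∧
    hodgeStar o (k := 3) (l := 1) rfl β ![frame o 3] = β ![frame o 0, frame o 1, frame o 2] := by
  let d (i j k : Fin 4) : ℝ := β ![frame o i, frame o j, frame o k]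
  obtain ⟨a1, a2, a3, a⟩ := alternating_three_rules (d := d)
    (fun _ _ _ => threeForm_swap_left _ _ _ _)
    (fun _ _ _ => threeForm_swap_right _ _ _ _)
  have h (i : Fin 4) : hodgeStar o (k := 3) (l := 1) rfl β ![frame o i] =
      6⁻¹ * ∑ a, ∑ b, ∑ c, d a b c * leviCivitaSymbol a b c i := hodgeStar_three_apply o β i
  simp only [h, Fin.sum_univ_four, a1, a2, a3, a]
  change _ = -d 1 2 3 ∧ _ = d 0 2 3 ∧ _ = -d 0 1 3 ∧ _ = d 0 1 2
  refine ⟨?_, ?_, ?_, ?_⟩ <;> simp [leviCivitaSymbol] <;> ring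

lemma threeForm_frame (β : V [⋀^Fin 3]→L[ℝ] ℝ) (a b c : Fin 4) :
    β ![frame o a, frame o b, frame o c] =
      threeFormOf (fun l => hodgeStar o (k := 3) (l := 1) rfl β ![frame o l]) a b c := by
  obtain ⟨h0, h1, h2, h3⟩ := hodgeStar_three_frame o β
  exact eq_threeFormOf (d := fun i j k => β ![frame o i, frame o j, frame o k])
    (fun _ _ _ => threeForm_swap_left _ _ _ _) (fun _ _ _ => threeForm_swap_right _ _ _ _)
    h0 h1 h2 h3 a b c

lemma oneForm_apply_eq_sum (β : V [⋀^Fin 1]→L[ℝ] ℝ) (w : V) :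
    β ![w] = ∑ i, ⟪frame o i, w⟫ * β ![frame o i] := by
  let f := (ContinuousAlternatingMap.ofSubsingleton ℝ V ℝ (0 : Fin 1)).symm β
  have h (v : V) : β ![v] = f v := by
    change _ = β _
    congr 1
    ext i
    fin_cases i
    rfl
  simp only [h]
  conv_lhs => rw [← (frame o).sum_repr' w, map_sum]
  simp

/-- The Hodge dual of a three-form is determined by its exterior product with one-forms. -/
theorem hodgeStar_three_mul_volumeForm (β : V [⋀^Fin 3]→L[ℝ] ℝ) (a b c d w : V) :
    hodgeStar o (k := 3) (l := 1) rfl β ![w] * o.volumeForm ![a, b, c, d] =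
      -(⟪a, w⟫ * β ![b, c, d]) + ⟪b, w⟫ * β ![a, c, d] - ⟪c, w⟫ * β ![a, b, d]
        + ⟪d, w⟫ * β ![a, b, c] := by
  -- `F` is the exterior product of the one-form dual to `w` with `β`. As a four-form it is a
  -- multiple of the volume form, and evaluation on the frame shows that the factor is `-(*β)(w)`.
  let F := ContinuousAlternatingMap.alternatizeUncurryFin ((innerSL ℝ w).smulRight β)
  have hF (a b c d : V) : F ![a, b, c, d] =
      ⟪a, w⟫ * β ![b, c, d] - ⟪b, w⟫ * β ![a, c, d] + ⟪c, w⟫ * β ![a, b, d]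
        - ⟪d, w⟫ * β ![a, b, c] := by
    rw [ContinuousAlternatingMap.alternatizeUncurryFin_apply]
    have e0 : Fin.removeNth 0 ![a, b, c, d] = ![b, c, d] := by ext i; fin_cases i <;> rfl
    have e1 : Fin.removeNth 1 ![a, b, c, d] = ![a, c, d] := by ext i; fin_cases i <;> rfl
    have e2 : Fin.removeNth 2 ![a, b, c, d] = ![a, b, d] := by ext i; fin_cases i <;> rfl
    have e3 : Fin.removeNth 3 ![a, b, c, d] = ![a, b, c] := by ext i; fin_cases i <;> rfl
    simp [Fin.sum_univ_four, e0, e1, e2, e3, real_inner_comm w]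
    ring
  have h := fourForm_apply o F ![a, b, c, d]
  rw [vec_four_frame, hF, hF] at h
  obtain ⟨h0, h1, h2, h3⟩ := hodgeStar_three_frame o β
  rw [oneForm_apply_eq_sum o, Fin.sum_univ_four, h0, h1, h2, h3]
  linarith

lemma volumeForm_frame_update (v : V) :
    o.volumeForm ![v, frame o 1, frame o 2, frame o 3] = ⟪v, frame o 0⟫ ∧
    o.volumeForm ![frame o 0, v, frame o 2, frame o 3] = ⟪v, frame o 1⟫ ∧
    o.volumeForm ![frame o 0, frame o 1, v, frame o 3] = ⟪v, frame o 2⟫ ∧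
    o.volumeForm ![frame o 0, frame o 1, frame o 2, v] = ⟪v, frame o 3⟫ := by
  have ho : (frame o).toBasis.orientation = o :=
    o.finOrthonormalBasis_orientation (by norm_num) Fact.out
  simp only [o.volumeForm_robust (frame o) ho, Basis.det_apply, det_fin_four, Basis.toMatrix_apply,
    OrthonormalBasis.coe_toBasis_repr_apply, OrthonormalBasis.repr_apply_apply]
  simp [orthonormal_iff_ite.mp (frame o).orthonormal, real_inner_comm v]

/-- The square of the volume form is the Gram determinant. -/
lemma volumeForm_sq (v : Fin 4 → V) :
    o.volumeForm v ^ 2 = (Matrix.of fun i j => ⟪v i, v j⟫).det := by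
  have ho : (frame o).toBasis.orientation = o :=
    o.finOrthonormalBasis_orientation (by norm_num) Fact.out
  have h : (Matrix.of fun i j => ⟪v i, v j⟫) =
      ((frame o).toBasis.toMatrix v).transpose * (frame o).toBasis.toMatrix v := by
    ext i j
    simp only [Matrix.of_apply, Matrix.mul_apply, Matrix.transpose_apply, Basis.toMatrix_apply,
      OrthonormalBasis.coe_toBasis_repr_apply, OrthonormalBasis.repr_apply_apply]
    rw [← (frame o).sum_inner_mul_inner (v i) (v j)]
    simp only [real_inner_comm]
  rw [h, Matrix.det_mul, Matrix.det_transpose, o.volumeForm_robust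
    (frame o) ho, Basis.det_apply, sq]

end HodgeDual

/-! ### Differentiability of the volume form and of the Hodge dual. -/

/-- Jacobi's formula at the identity matrix. -/
lemma fderiv_det_of_eq_one {E n : Type*} [NormedAddCommGroup E] [NormedSpace ℝ E] [Fintype n]
    [DecidableEq n] {A : E → Matrix n n ℝ} {z : E} (hA : ∀ i j, DifferentiableAt ℝ (fun y => A y i
      j) z)
    (h1 : A z = 1) :
    HasFDerivAt (fun y => (A y).det) (∑ i, fderiv ℝ (fun y => A y i i) z) z := by
  simp only [Matrix.det_apply']
  have h (σ : Equiv.Perm n) := (HasFDerivAt.finsetProd (u := Finset.univ)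
    (fun i _ => (hA (σ i) i).hasFDerivAt)).const_mul ((Equiv.Perm.sign σ : ℤ) : ℝ)
  refine (HasFDerivAt.fun_sum fun σ _ => h σ).congr_fderiv ?_
  rw [Finset.sum_eq_single 1]
  · simp only [Equiv.Perm.sign_one, Equiv.Perm.one_apply, h1, Matrix.one_apply_eq]
    simp
  · intro σ _ hσ
    have : ∀ i, ∏ j ∈ Finset.univ.erase i, A z (σ j) j = 0 := by
      intro i
      -- A nontrivial permutation moves at least two points, so a vanishing off-diagonal entry
      -- remains after the differentiated factor is removed.
      obtain ⟨j, hj, hji⟩ : ∃ j, σ j ≠ j ∧ j ≠ i := by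
        obtain ⟨j, hj⟩ : ∃ j, σ j ≠ j := by
          by_contra! hc
          exact hσ (Equiv.ext hc)
        by_cases hji : j = i
        · subst hji
          exact ⟨σ j, fun h => hj (σ.injective h), hj⟩
        · exact ⟨j, hj, hji⟩
      refine Finset.prod_eq_zero (i := j) (by simp [hji]) ?_
      rw [h1, Matrix.one_apply_ne hj]
    simp [this]
  · simp

section HodgeDualField

variable {M : Type*} [TopologicalSpace M] [ChartedSpace (EuclideanSpace ℝ (Fin 4)) M]
  {x : M}

lemma mdifferentiableAt_of_comp_extChartAt_symm [IsManifold (𝓡 4) ∞ M] {g : M → ℝ}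
    (h : DifferentiableAt ℝ (g ∘ (extChartAt (𝓡 4) x).symm) (extChartAt (𝓡 4) x x)) :
    MDifferentiableAt (𝓡 4) 𝓘(ℝ, ℝ) g x := by
  have h2 : MDifferentiableAt (𝓡 4) 𝓘(ℝ, ℝ)
      ((g ∘ (extChartAt (𝓡 4) x).symm) ∘ extChartAt (𝓡 4) x) x :=
    MDifferentiableAt.comp (I' := 𝓘(ℝ, EuclideanSpace ℝ (Fin 4))) _
      h.mdifferentiableAt (mdifferentiableAt_extChartAt (mem_chart_source _ x))
  exact h2.congr_of_eventuallyEq (eventually_eq_comp_extChartAt_symm g (mem_chart_source _ x))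

variable [RiemannianBundle (fun x : M => TangentSpace (𝓡 4) x)] [IsManifold (𝓡 4) ∞ M]
  {o : ∀ x : M, Orientation ℝ (TangentSpace (𝓡 4) x) (Fin 4)}

/-- The volume of the parallelepiped spanned by the constant fields that extend an oriented
orthonormal basis at `x`. -/
noncomputable def frameVolume (o : ∀ x : M, Orientation ℝ (TangentSpace (𝓡 4) x) (Fin 4))
    (x y : M) : ℝ :=
  (o y).volumeForm fun i => constField (frame (o x) i) y

/-- The Gram matrix of the constant fields that extend an orthonormal basis at `x`. -/
noncomputable def frameGram (o : ∀ x : M, Orientation ℝ (TangentSpace (𝓡 4) x) (Fin 4)) (x y : M) :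
    Matrix (Fin 4) (Fin 4) ℝ :=
  Matrix.of fun i j => ⟪constField (frame (o x) i) y, constField (frame (o x) j) y⟫

lemma frameGram_self : frameGram o x x = 1 := by
  ext i j
  simp only [frameGram, constField_self, Matrix.of_apply, Matrix.one_apply,
    orthonormal_iff_ite.mp (frame (o x)).orthonormal]

/-- Here the local constancy of the orientation enters; it fixes the sign of the square root in
`eventually_frameVolume_eq`. -/
lemma eventually_frameVolume_pos (ho : IsOrientation o) : ∀ᶠ y in 𝓝 x, 0 < frameVolume o x y := by
  filter_upwards [ho x, eventually_mem_chart_source (x := x)] with y hy hys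
  have hyb : y ∈ (trivializationAt (EuclideanSpace ℝ (Fin 4)) (TangentSpace (𝓡 4)) x).baseSet := by
    simpa using hys
  let e := ((trivializationAt (EuclideanSpace ℝ (Fin 4))
    (TangentSpace (𝓡 4)) x).continuousLinearEquivAt ℝ y hyb).symm.toLinearEquiv
  let b : Basis (Fin 4) ℝ (EuclideanSpace ℝ (Fin 4)) := (frame (o x)).toBasis
  have hb (i : Fin 4) : b.map e i = constField (frame (o x) i) y := by
    have hi : b i = modelVector (frame (o x) i) := congrFun (frame (o x)).coe_toBasis i
    rw [constField_eq_symmL _ hys, Basis.map_apply, hi, Trivialization.symmL_apply _ hyb]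
    rfl
  have hor (y : M) : (frame (o y)).toBasis.orientation = o y :=
    (o y).finOrthonormalBasis_orientation (by norm_num) Fact.out
  have h := (hy (frame (o x)).toBasis (b.map e) fun i => by
    rw [hb, OrthonormalBasis.coe_toBasis]).mp (hor x)
  rw [← hor y, eq_comm, Basis.orientation_eq_iff_det_pos] at h
  rw [frameVolume, (o y).volumeForm_robust (frame (o y)) (hor y)]
  simpa only [← hb] using h

/-- The square of the volume is the Gram determinant and the volume is positive near `x`. The
right-hand side does not involve the frames at `y`, so it can be differentiated. -/
lemma eventually_frameVolume_eq (ho : IsOrientation o) :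
    ∀ᶠ y in 𝓝 x, frameVolume o x y = √(frameGram o x y).det := by
  filter_upwards [eventually_frameVolume_pos ho] with y hy
  rw [← Real.sqrt_sq hy.le, frameVolume, volumeForm_sq]
  rfl

lemma frameVolume_self (ho : IsOrientation o) : frameVolume o x x = 1 := by
  rw [(eventually_frameVolume_eq ho).self_of_nhds, frameGram_self, Matrix.det_one, Real.sqrt_one]

variable
  {H : ∀ x : M, TangentSpace (𝓡 4) x [⋀^Fin 3]→L[ℝ] ℝ}

/-- The Hodge dual of a three-form on constant fields. -/
noncomputable def starComponent (o : ∀ x : M, Orientation ℝ (TangentSpace (𝓡 4) x) (Fin 4))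
    (H : ∀ x : M, TangentSpace (𝓡 4) x [⋀^Fin 3]→L[ℝ] ℝ) (w : TangentSpace (𝓡 4) x) (y : M) : ℝ :=
  starField o (k := 3) (l := 1) rfl H y ![constField w y]

/-- The exterior product of a one-form and a three-form on constant fields. -/
noncomputable def wedgeComponent (o : ∀ x : M, Orientation ℝ (TangentSpace (𝓡 4) x) (Fin 4))
    (H : ∀ x : M, TangentSpace (𝓡 4) x [⋀^Fin 3]→L[ℝ] ℝ) (w : TangentSpace (𝓡 4) x)
      (i j k l : Fin 4)
    (y : M) : ℝ :=
  ⟪constField (frame (o x) i) y, constField w y⟫ *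
    constComponent H (frame (o x) j) (frame (o x) k) (frame (o x) l) y

/-- The star at `y` is defined through a frame at `y` that need not vary continuously. This identity
determines `*H` from constant fields alone, which makes it accessible to differentiation. -/
lemma starComponent_mul_frameVolume (w : TangentSpace (𝓡 4) x) (y : M) :
    starComponent o H w y * frameVolume o x y =
      -(wedgeComponent o H w 0 1 2 3 y) + wedgeComponent o H w 1 0 2 3 y
        - wedgeComponent o H w 2 0 1 3 y + wedgeComponent o H w 3 0 1 2 y := by
  have e : (fun i => constField (frame (o x) i) y) =
      ![constField (frame (o x) 0) y, constField (frame (o x) 1) y, constField (frame (o x) 2) y,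
        constField (frame (o x) 3) y] := by
    ext1 i
    fin_cases i <;> rfl
  have h := hodgeStar_three_mul_volumeForm (o y) (H y) (constField (frame (o x) 0) y)
    (constField (frame (o x) 1) y) (constField (frame (o x) 2) y) (constField (frame (o x) 3) y)
    (constField w y)
  rw [← e] at h
  simp only [starComponent, starField, frameVolume, wedgeComponent, constComponent]
  refine Eq.trans ?_ (h.trans ?_) <;> congr 1

variable [IsContMDiffRiemannianBundle (𝓡 4) ∞ (EuclideanSpace ℝ (Fin 4))
    (fun x : M => TangentSpace (𝓡 4) x)]

/-- The Gram matrix is the identity at `x`, so the derivative of its determinant is a trace, and the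
square root contributes the factor `1/2`. -/
lemma hasFDerivAt_frameVolume (ho : IsOrientation o) :
    HasFDerivAt (frameVolume o x ∘ (extChartAt (𝓡 4) x).symm)
      ((1 / 2 : ℝ) • ∑ i, fderiv ℝ ((fun y => ⟪constField (frame (o x) i) y,
        constField (frame (o x) i) y⟫) ∘ (extChartAt (𝓡 4) x).symm) (extChartAt (𝓡 4) x x))
      (extChartAt (𝓡 4) x x) := by
  have hx : (extChartAt (𝓡 4) x).symm (extChartAt (𝓡 4) x x) = x := by simp
  have h1 : frameGram o x ((extChartAt (𝓡 4) x).symm (extChartAt (𝓡 4) x x)) = 1 := by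
    rw [hx, frameGram_self]
  have h2 := (fderiv_det_of_eq_one (A := fun z => frameGram o x ((extChartAt (𝓡 4) x).symm z))
    (fun i j => differentiableAt_comp_extChartAt_symm (mem_chart_source _ x)
      ((diffFieldAt_constField (frame (o x) i)).inner
        (diffFieldAt_constField (frame (o x) j)))) h1).sqrt (by rw [h1]; simp)
  rw [h1, Matrix.det_one, Real.sqrt_one, mul_one] at h2
  refine h2.congr_of_eventuallyEq ?_
  have hc : Filter.Tendsto (extChartAt (𝓡 4) x).symm (𝓝 (extChartAt (𝓡 4) x x)) (𝓝 x) := by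
    have := continuousAt_extChartAt_symm (I := 𝓡 4) x
    rwa [ContinuousAt, hx] at this
  exact hc.eventually (eventually_frameVolume_eq ho)

lemma mdifferentiableAt_frameVolume (ho : IsOrientation o) :
    MDifferentiableAt (𝓡 4) 𝓘(ℝ, ℝ) (frameVolume o x) x :=
  mdifferentiableAt_of_comp_extChartAt_symm (hasFDerivAt_frameVolume ho).differentiableAt

variable {nabla : CovariantDerivative (𝓡 4) (EuclideanSpace ℝ (Fin 4))
    (fun x : M => TangentSpace (𝓡 4) x)}

lemma mvfderiv_inner_constField (hm : nabla.IsMetricCompatible) (u v w : TangentSpace (𝓡 4) x) :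
    mvfderiv (𝓡 4) (fun y => ⟪constField v y, constField w y⟫) x u =
      ⟪covConst nabla u v x, w⟫ + ⟪v, covConst nabla u w x⟫ := by
  rw [mvfderiv_inner hm (diffFieldAt_constField v) (diffFieldAt_constField w), constField_self,
    constField_self, covConst_self, covConst_self]

/-- In other words, a metric connection leaves the volume form parallel. -/
lemma mvfderiv_frameVolume (ho : IsOrientation o) (hm : nabla.IsMetricCompatible)
    (u : TangentSpace (𝓡 4) x) : mvfderiv (𝓡 4) (frameVolume o x) x u =
      ∑ i, ⟪covConst nabla u (frame (o x) i) x, frame (o x) i⟫ := by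
  rw [mvfderiv_apply_eq_fderiv (mdifferentiableAt_frameVolume ho),
    (hasFDerivAt_frameVolume ho).fderiv]
  simp only [_root_.smul_apply, _root_.sum_apply, smul_eq_mul,
    ← mvfderiv_apply_eq_fderiv ((diffFieldAt_constField (frame (o x) _)).inner
        (diffFieldAt_constField (frame (o x) _)))]
  rw [Finset.mul_sum]
  refine Finset.sum_congr rfl fun i _ => ?_
  rw [mvfderiv_inner_constField hm, real_inner_comm (frame (o x) i)]
  ring

lemma mdifferentiableAt_wedgeComponent (hH : HasSkewTorsion nabla H)
    (h : ∀ v w : TangentSpace (𝓡 4) x, DiffFieldAt (covConst nabla v w) x)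
    (w : TangentSpace (𝓡 4) x) (i j k l : Fin 4) :
    MDifferentiableAt (𝓡 4) 𝓘(ℝ, ℝ) (wedgeComponent o H w i j k l) x :=
  ((diffFieldAt_constField _).inner (diffFieldAt_constField _)).mul
    (mdifferentiableAt_constComponent hH h _ _ _)

lemma mvfderiv_wedgeComponent (hH : HasSkewTorsion nabla H)
    (h : ∀ v w : TangentSpace (𝓡 4) x, DiffFieldAt (covConst nabla v w) x)
    (u w : TangentSpace (𝓡 4) x) (i j k l : Fin 4) :
    mvfderiv (𝓡 4) (wedgeComponent o H w i j k l) x u =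
      ⟪frame (o x) i, w⟫ * mvfderiv (𝓡 4) (constComponent H (frame (o x) j) (frame (o x) k)
        (frame (o x) l)) x u +
      (⟪covConst nabla u (frame (o x) i) x, w⟫ + ⟪frame (o x) i, covConst nabla u w x⟫) *
        H x ![frame (o x) j, frame (o x) k, frame (o x) l] := by
  have e := mvfderiv_fun_mul ((diffFieldAt_constField (frame (o x) i)).inner
    (diffFieldAt_constField w)) (mdifferentiableAt_constComponent hH h (frame (o x) j)
      (frame (o x) k) (frame (o x) l))
  have e' := DFunLike.congr_fun e u
  refine e'.trans ?_
  rw [_root_.add_apply, _root_.smul_apply, _root_.smul_apply, mvfderiv_inner_constField hH.1,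
    constField_self, constField_self, constComponent_self, smul_eq_mul, smul_eq_mul]
  ring

end HodgeDualField

/-! ### The covariant derivative of the Hodge dual. -/

section HodgeDualDerivative

variable {M : Type*} [TopologicalSpace M] [ChartedSpace (EuclideanSpace ℝ (Fin 4)) M]
  {x : M} [RiemannianBundle (fun x : M => TangentSpace (𝓡 4) x)] [IsManifold (𝓡 4) ∞ M]
  {o : ∀ x : M, Orientation ℝ (TangentSpace (𝓡 4) x) (Fin 4)}
  {nabla : CovariantDerivative (𝓡 4) (EuclideanSpace ℝ (Fin 4))
    (fun x : M => TangentSpace (𝓡 4) x)}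
  {H : ∀ x : M, TangentSpace (𝓡 4) x [⋀^Fin 3]→L[ℝ] ℝ}

lemma covOneForm_eq_starComponent (u w : TangentSpace (𝓡 4) x) :
    covOneForm nabla (starField o (k := 3) (l := 1) rfl H) x u w =
      mvfderiv (𝓡 4) (starComponent o H w) x u
        - starField o (k := 3) (l := 1) rfl H x ![covConst nabla u w x] := by
  have e : starComponent o H w = fun y => starField o (k := 3) (l := 1) rfl H y
      ![FiberBundle.extend (EuclideanSpace ℝ (Fin 4)) w y] := by
    ext1 y
    simp only [starComponent]
  simp only [covConst_self, covOneForm, e]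

variable [IsContMDiffRiemannianBundle (𝓡 4) ∞ (EuclideanSpace ℝ (Fin 4))
    (fun x : M => TangentSpace (𝓡 4) x)]

lemma mdifferentiableAt_starComponent (ho : IsOrientation o) (hH : HasSkewTorsion nabla H)
    (h : ∀ v w : TangentSpace (𝓡 4) x, DiffFieldAt (covConst nabla v w) x)
    (w : TangentSpace (𝓡 4) x) : MDifferentiableAt (𝓡 4) 𝓘(ℝ, ℝ) (starComponent o H w) x := by
  have hw (i j k l : Fin 4) := mdifferentiableAt_wedgeComponent (o := o) hH h w i j k l
  have hr : MDifferentiableAt (𝓡 4) 𝓘(ℝ, ℝ) (fun y => -(wedgeComponent o H w 0 1 2 3 y)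
      + wedgeComponent o H w 1 0 2 3 y - wedgeComponent o H w 2 0 1 3 y
      + wedgeComponent o H w 3 0 1 2 y) x :=
    (((hw 0 1 2 3).neg.add (hw 1 0 2 3)).sub (hw 2 0 1 3)).add (hw 3 0 1 2)
  have hi : MDifferentiableAt (𝓡 4) 𝓘(ℝ, ℝ) (fun y => (frameVolume o x y)⁻¹) x := by
    have hd : DifferentiableAt ℝ (fun r : ℝ => r⁻¹) (frameVolume o x x) :=
      differentiableAt_inv (by rw [frameVolume_self ho]; exact one_ne_zero)
    exact MDifferentiableAt.comp (I' := 𝓘(ℝ, ℝ)) x hd.mdifferentiableAt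
      (mdifferentiableAt_frameVolume ho)
  refine (hr.mul hi).congr_of_eventuallyEq ?_
  filter_upwards [eventually_frameVolume_pos (x := x) ho] with y hy
  rw [Pi.mul_apply, ← starComponent_mul_frameVolume, mul_assoc, mul_inv_cancel₀ hy.ne', mul_one]

/-- Apply the Leibniz rule to `starComponent_mul_frameVolume`; the volume equals one at `x`, and its
derivative is the trace subtracted at the end. -/
lemma mvfderiv_starComponent (ho : IsOrientation o) (hH : HasSkewTorsion nabla H)
    (h : ∀ v w : TangentSpace (𝓡 4) x, DiffFieldAt (covConst nabla v w) x)
    (u w : TangentSpace (𝓡 4) x) :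
    mvfderiv (𝓡 4) (starComponent o H w) x u =
      -(mvfderiv (𝓡 4) (wedgeComponent o H w 0 1 2 3) x u)
      + mvfderiv (𝓡 4) (wedgeComponent o H w 1 0 2 3) x u
      - mvfderiv (𝓡 4) (wedgeComponent o H w 2 0 1 3) x u
      + mvfderiv (𝓡 4) (wedgeComponent o H w 3 0 1 2) x u
      - starField o (k := 3) (l := 1) rfl H x ![w] *
        ∑ i, ⟪covConst nabla u (frame (o x) i) x, frame (o x) i⟫ := by
  have hw (i j k l : Fin 4) := mdifferentiableAt_wedgeComponent (o := o) hH h w i j k l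
  have e1 := mvfderiv_fun_mul (mdifferentiableAt_starComponent ho hH h w)
    (mdifferentiableAt_frameVolume (x := x) ho)
  have e2 : (fun y => starComponent o H w y * frameVolume o x y) =
      fun y => -(wedgeComponent o H w 0 1 2 3 y)
        + wedgeComponent o H w 1 0 2 3 y - wedgeComponent o H w 2 0 1 3 y
        + wedgeComponent o H w 3 0 1 2 y := funext fun y => starComponent_mul_frameVolume w y
  have h1 : MDifferentiableAt (𝓡 4) 𝓘(ℝ, ℝ) (fun y => -(wedgeComponent o H w 0 1 2 3 y)) x :=
    (hw 0 1 2 3).neg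
  have h2 : MDifferentiableAt (𝓡 4) 𝓘(ℝ, ℝ) (fun y => -(wedgeComponent o H w 0 1 2 3 y)
      + wedgeComponent o H w 1 0 2 3 y) x := h1.add (hw 1 0 2 3)
  have h3 : MDifferentiableAt (𝓡 4) 𝓘(ℝ, ℝ) (fun y => -(wedgeComponent o H w 0 1 2 3 y)
      + wedgeComponent o H w 1 0 2 3 y - wedgeComponent o H w 2 0 1 3 y) x := h2.sub (hw 2 0 1 3)
  have e3 : mvfderiv (𝓡 4) (fun y => -(wedgeComponent o H w 0 1 2 3 y)) x =
    -mvfderiv (𝓡 4) (wedgeComponent o H w 0 1 2 3) x := mvfderiv_fun_neg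
  rw [e2, mvfderiv_fun_add h3 (hw 3 0 1 2), mvfderiv_fun_sub h2 (hw 2 0 1 3),
    mvfderiv_fun_add h1 (hw 1 0 2 3), e3, frameVolume_self ho] at e1
  have e4 := DFunLike.congr_fun e1 u
  simp only [_root_.add_apply, _root_.sub_apply, _root_.neg_apply, _root_.smul_apply, smul_eq_mul,
    mvfderiv_frameVolume ho hH.1] at e4
  have e5 : starComponent o H w x = starField o (k := 3) (l := 1) rfl H x ![w] := by
    rw [starComponent, constField_self]
  rw [e5] at e4
  linarith

/-- The covariant derivative commutes with the Hodge star. -/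
theorem covOneForm_starField (ho : IsOrientation o) (hH : HasSkewTorsion nabla H)
    (h : ∀ v w : TangentSpace (𝓡 4) x, DiffFieldAt (covConst nabla v w) x)
    (u w : TangentSpace (𝓡 4) x) :
    covOneForm nabla (starField o (k := 3) (l := 1) rfl H) x u w =
      -(⟪frame (o x) 0, w⟫ * covThreeForm nabla H u (frame (o x) 1) (frame (o x) 2) (frame (o x) 3))
      + ⟪frame (o x) 1, w⟫ * covThreeForm nabla H u (frame (o x) 0) (frame (o x) 2) (frame (o x) 3)
      - ⟪frame (o x) 2, w⟫ * covThreeForm nabla H u (frame (o x) 0) (frame (o x) 1) (frame (o x) 3)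
      + ⟪frame (o x) 3, w⟫ *
        covThreeForm nabla H u (frame (o x) 0) (frame (o x) 1) (frame (o x) 2) := by
  rw [covOneForm_eq_starComponent, mvfderiv_starComponent ho hH h]
  simp only [mvfderiv_wedgeComponent hH h, covThreeForm]
  have key (a b c d w : TangentSpace (𝓡 4) x) :
      starField o (k := 3) (l := 1) rfl H x ![w] * (o x).volumeForm ![a, b, c, d] =
      -(⟪a, w⟫ * H x ![b, c, d]) + ⟪b, w⟫ * H x ![a, c, d] - ⟪c, w⟫ * H x ![a, b, d]
        + ⟪d, w⟫ * H x ![a, b, c] := by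
    simp only [starField]
    refine Eq.trans ?_ (Eq.trans (hodgeStar_three_mul_volumeForm (o x) (H x) a b c d w) ?_) <;>
      congr 1
  have hv (v : TangentSpace (𝓡 4) x) := volumeForm_frame_update (o x) v
  -- Replacing one frame vector at a time by its covariant derivative, `k0` to `k3` cancel the
  -- derivative of the volume, while `k4` accounts for the derivative of `w`.
  have k0 := key (covConst nabla u (frame (o x) 0) x) (frame (o x) 1) (frame (o x) 2)
    (frame (o x) 3) w
  have k1 := key (frame (o x) 0) (covConst nabla u (frame (o x) 1) x) (frame (o x) 2)
    (frame (o x) 3) w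
  have k2 := key (frame (o x) 0) (frame (o x) 1) (covConst nabla u (frame (o x) 2) x)
    (frame (o x) 3) w
  have k3 := key (frame (o x) 0) (frame (o x) 1) (frame (o x) 2)
    (covConst nabla u (frame (o x) 3) x) w
  have k4 := key (frame (o x) 0) (frame (o x) 1) (frame (o x) 2) (frame (o x) 3)
    (covConst nabla u w x)
  rw [(hv _).1] at k0
  rw [(hv _).2.1] at k1
  rw [(hv _).2.2.1] at k2
  rw [(hv _).2.2.2] at k3
  rw [(hv _).1, real_inner_self_eq_norm_sq, (frame (o x)).norm_eq_one, one_pow, mul_one] at k4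
  rw [k4, Fin.sum_univ_four, mul_add, mul_add, mul_add, k0, k1, k2, k3]
  ring

end HodgeDualDerivative

lemma mvfderiv_neg_apply {M : Type*} [TopologicalSpace M]
    [ChartedSpace (EuclideanSpace ℝ (Fin 4)) M] {x : M} (f : M → ℝ) (u : TangentSpace (𝓡 4) x) :
    mvfderiv (𝓡 4) (fun y => -f y) x u = -mvfderiv (𝓡 4) f x u := by
  have e : mvfderiv (𝓡 4) (fun y => -f y) x = -mvfderiv (𝓡 4) f x := mvfderiv_fun_neg
  rw [e, _root_.neg_apply]

lemma threeForm_sub_left {V : Type*} [NormedAddCommGroup V] [NormedSpace ℝ V]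
    (α : V [⋀^Fin 3]→L[ℝ] ℝ) (u v w z : V) : α ![u - v, w, z] = α ![u, w, z] - α ![v, w, z] := by
  simp

/-! ### The torsion and the curvature in an orthonormal frame. -/

section TorsionDual

variable {M : Type*} [TopologicalSpace M] [ChartedSpace (EuclideanSpace ℝ (Fin 4)) M]
  {x : M} [RiemannianBundle (fun x : M => TangentSpace (𝓡 4) x)]
  (o : ∀ x : M, Orientation ℝ (TangentSpace (𝓡 4) x) (Fin 4))
  {H : ∀ x : M, TangentSpace (𝓡 4) x [⋀^Fin 3]→L[ℝ] ℝ}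

/-- The components of the Hodge dual of a three-form. -/
noncomputable def torsionDual (H : ∀ x : M, TangentSpace (𝓡 4) x [⋀^Fin 3]→L[ℝ] ℝ) (x : M)
    (l : Fin 4) : ℝ :=
  starField o (k := 3) (l := 1) rfl H x ![frame (o x) l]

lemma threeForm_frame_eq (i j k : Fin 4) : H x ![frame (o x) i, frame (o x) j, frame (o x) k] =
    threeFormOf (torsionDual o H x) i j k := by
  have e : torsionDual o H x = fun l => starField o (k := 3) (l := 1) rfl H x ![frame (o x) l] := by
    ext1 l
    rw [torsionDual]
  rw [e]
  simp only [starField]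
  refine Eq.trans ?_ (Eq.trans (threeForm_frame (o x) (H x) i j k) ?_) <;> congr 1

end TorsionDual

section Components

variable {M : Type*} [TopologicalSpace M] [ChartedSpace (EuclideanSpace ℝ (Fin 4)) M]
  {x : M} [IsManifold (𝓡 4) ∞ M]
  {nabla nablaG : CovariantDerivative (𝓡 4) (EuclideanSpace ℝ (Fin 4))
    (fun x : M => TangentSpace (𝓡 4) x)}
  {H : ∀ x : M, TangentSpace (𝓡 4) x [⋀^Fin 3]→L[ℝ] ℝ}

variable [RiemannianBundle (fun x : M => TangentSpace (𝓡 4) x)]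

lemma covThreeForm_swap_left (u v w z : TangentSpace (𝓡 4) x) :
    covThreeForm nabla H u w v z = -covThreeForm nabla H u v w z := by
  have e : constComponent H w v z = fun y => -constComponent H v w z y :=
    by
    ext1 y
    rw [constComponent, constComponent, threeForm_swap_left]
  rw [covThreeForm, covThreeForm, e, mvfderiv_neg_apply,
    threeForm_swap_left _ (covConst nabla u v x) w z, threeForm_swap_left _ v
      (covConst nabla u w x),
    threeForm_swap_left _ v w]
  ring

lemma covThreeForm_swap_right (u v w z : TangentSpace (𝓡 4) x) :
    covThreeForm nabla H u v z w = -covThreeForm nabla H u v w z := by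
  have e : constComponent H v z w = fun y => -constComponent H v w z y :=
    by
    ext1 y
    rw [constComponent, constComponent, threeForm_swap_right]
  rw [covThreeForm, covThreeForm, e, mvfderiv_neg_apply,
    threeForm_swap_right _ v (covConst nabla u w x) z,
    threeForm_swap_right _ v w, threeForm_swap_right _ (covConst nabla u v x)]
  ring

variable  (o : ∀ x : M, Orientation ℝ (TangentSpace (𝓡 4) x) (Fin 4))

/-- The components of the covariant derivative of the Hodge dual of a three-form. -/
noncomputable def torsionDualDeriv (nabla : CovariantDerivative (𝓡 4) (EuclideanSpace ℝ (Fin 4))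
    (fun x : M => TangentSpace (𝓡 4) x)) (H : ∀ x : M, TangentSpace (𝓡 4) x [⋀^Fin 3]→L[ℝ] ℝ) (x :
      M)
    (k l : Fin 4) : ℝ :=
  covOneForm nabla (starField o (k := 3) (l := 1) rfl H) x (frame (o x) k) (frame (o x) l)

variable [IsContMDiffRiemannianBundle (𝓡 4) ∞ (EuclideanSpace ℝ (Fin 4))
    (fun x : M => TangentSpace (𝓡 4) x)] {o}

/-- Expand `T(u, v)` in the frame; its coefficients are `H(u, v, e_m)`. -/
lemma threeForm_torsion (hH : HasSkewTorsion nabla H) (u v : TangentSpace (𝓡 4) x) (k l : Fin 4) :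
    H x ![nabla.torsion x u v, frame (o x) k, frame (o x) l] =
      ∑ m, H x ![u, v, frame (o x) m] * H x ![frame (o x) m, frame (o x) k, frame (o x) l] := by
  have e (w : TangentSpace (𝓡 4) x) : H x ![w, frame (o x) k, frame (o x) l] =
      ⟪nabla.torsion x (frame (o x) k) (frame (o x) l), w⟫ := by
    rw [hH.2, threeForm_swap_left, threeForm_swap_right, neg_neg]
  rw [e, ← (frame (o x)).sum_inner_mul_inner]
  refine Finset.sum_congr rfl fun m _ => ?_
  rw [← e, real_inner_comm, hH.2, mul_comm]

lemma threeForm_torsion_frame (hH : HasSkewTorsion nabla H) (i j k l : Fin 4) :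
    H x ![nabla.torsion x (frame (o x) i) (frame (o x) j), frame (o x) k, frame (o x) l] =
      ∑ m, threeFormOf (torsionDual o H x) i j m * threeFormOf (torsionDual o H x) m k l := by
  rw [threeForm_torsion hH]
  simp only [threeForm_frame_eq]

lemma threeForm_torsion_frame_mid (hH : HasSkewTorsion nabla H) (i j k l : Fin 4) :
    H x ![frame (o x) k, nabla.torsion x (frame (o x) i) (frame (o x) j), frame (o x) l] =
      ∑ m, threeFormOf (torsionDual o H x) k m l * threeFormOf (torsionDual o H x) i j m := by
  rw [threeForm_swap_left, threeForm_torsion_frame hH, ← Finset.sum_neg_distrib]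
  refine Finset.sum_congr rfl fun m _ => ?_
  rw [threeFormOf_swap_left _ m]
  ring

/-- Because `∇` commutes with the star, `∇_{e_a} H` has the dual `∇_{e_a}(*H)`, which is the row `a`
of `torsionDualDeriv`. -/
lemma covThreeForm_frame (ho : IsOrientation o) (hH : HasSkewTorsion nabla H)
    (h : ∀ v w : TangentSpace (𝓡 4) x, DiffFieldAt (covConst nabla v w) x) (a i j k : Fin 4) :
    covThreeForm nabla H (frame (o x) a) (frame (o x) i) (frame (o x) j) (frame (o x) k) =
      threeFormOf (torsionDualDeriv o nabla H x a) i j k := by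
  refine eq_threeFormOf (d := fun i j k =>
    covThreeForm nabla H (frame (o x) a) (frame (o x) i) (frame (o x) j) (frame (o x) k))
    (fun _ _ _ => covThreeForm_swap_left _ _ _ _) (fun _ _ _ => covThreeForm_swap_right _ _ _ _)
    ?_ ?_ ?_ ?_ i j k <;>
  simp [torsionDualDeriv, covOneForm_starField ho hH h, orthonormal_iff_ite.mp (frame (o
    x)).orthonormal]

/-- The curvature of a metric connection with skew torsion in an orthonormal frame. -/
theorem curvatureTensor_frame (ho : IsOrientation o) (hH : HasSkewTorsion nabla H)
    (hG : IsLeviCivita nablaG)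
    (h : ∀ v w : TangentSpace (𝓡 4) x, DiffFieldAt (covConst nabla v w) x) (i j k l : Fin 4) :
    curvatureTensor nabla x (frame (o x) i) (frame (o x) j) (frame (o x) k) (frame (o x) l) =
      torsionCurvature (fun i j k l => curvatureTensor nablaG x (frame (o x) i) (frame (o x) j)
        (frame (o x) k) (frame (o x) l)) (torsionDual o H x) (torsionDualDeriv o nabla H x) i j k l
          := by
  rw [torsionCurvature, curvatureTensor, inner_curvature_skewTorsion hH hG h, covThreeForm_frame ho
    hH h,
    covThreeForm_frame ho hH h, threeForm_torsion_frame hH, threeForm_torsion_frame_mid hH,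
    threeForm_torsion_frame_mid hH, curvatureTensor, Finset.sum_sub_distrib]
  ring

lemma isAlgebraicCurvature_leviCivita (hH : HasSkewTorsion nabla H) (hG : IsLeviCivita nablaG)
    (h : ∀ v w : TangentSpace (𝓡 4) x, DiffFieldAt (covConst nabla v w) x) :
    IsAlgebraicCurvature (fun i j k l => curvatureTensor nablaG x (frame (o x) i) (frame (o x) j)
        (frame (o x) k) (frame (o x) l)) where
  skew_left i j k l := by
    rw [curvatureTensor, curvatureTensor,
      inner_curvature_swap hG.1 (diffFieldAt_covConst_leviCivita hH hG h)]
  skew_right i j k l := by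
    rw [curvatureTensor, curvatureTensor,
      inner_curvature_skew hG.1 (diffFieldAt_covConst_leviCivita hH hG h)]
  bianchi i j k l := by
    have := inner_curvature_leviCivita_bianchi hH hG h (frame (o x) i) (frame (o x) j)
      (frame (o x) k) (frame (o x) l)
    simp only [curvatureTensor]
    linarith

end Components

/-! ### The exterior derivative and the codifferential of the torsion through its Hodge dual. -/

section Duals

variable {M : Type*} [TopologicalSpace M] [ChartedSpace (EuclideanSpace ℝ (Fin 4)) M]
  {x : M} [IsManifold (𝓡 4) ∞ M]
  {nabla nablaG : CovariantDerivative (𝓡 4) (EuclideanSpace ℝ (Fin 4))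
    (fun x : M => TangentSpace (𝓡 4) x)}
  {H : ∀ x : M, TangentSpace (𝓡 4) x [⋀^Fin 3]→L[ℝ] ℝ}
  [RiemannianBundle (fun x : M => TangentSpace (𝓡 4) x)]
  {o : ∀ x : M, Orientation ℝ (TangentSpace (𝓡 4) x) (Fin 4)}
  [IsContMDiffRiemannianBundle (𝓡 4) ∞ (EuclideanSpace ℝ (Fin 4))
    (fun x : M => TangentSpace (𝓡 4) x)]

/-- The four free indices are distinct, and a nonzero summand would need an `m` different from all
of them. In dimension four there is none. -/
lemma sum_threeFormOf_mul_threeFormOf (t : Fin 4 → ℝ) :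
    ∑ m, threeFormOf t 0 1 m * threeFormOf t m 2 3 = 0 ∧
    ∑ m, threeFormOf t 0 2 m * threeFormOf t m 1 3 = 0 ∧
    ∑ m, threeFormOf t 0 3 m * threeFormOf t m 1 2 = 0 ∧
    ∑ m, threeFormOf t 1 2 m * threeFormOf t m 0 3 = 0 ∧
    ∑ m, threeFormOf t 1 3 m * threeFormOf t m 0 2 = 0 ∧
    ∑ m, threeFormOf t 2 3 m * threeFormOf t m 0 1 = 0 := by
  obtain ⟨b1, b2, b3, b⟩ := threeFormOf_rules t
  simp [Fin.sum_univ_four, b1, b2, b3]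

/-- The exterior derivative of the torsion is minus the divergence of its Hodge dual. -/
theorem starField_extD (ho : IsOrientation o) (hH : HasSkewTorsion nabla H)
    (h : ∀ v w : TangentSpace (𝓡 4) x, DiffFieldAt (covConst nabla v w) x) :
    starField o (k := 4) (l := 0) rfl (extD H) x ![] = -∑ i, torsionDualDeriv o nabla H x i i := by
  have hd (v : Fin 3 → TangentSpace (𝓡 4) x) : (fun y => H y fun i => constField (v i) y) =
      constComponent H (v 0) (v 1) (v 2) := by
    ext1 y
    rw [constComponent]
    congr 1
    ext1 i
    fin_cases i <;> rfl
  have h1 := extD_apply (α := H) (x := x) (fun v => by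
    rw [hd]
    exact mdifferentiableAt_constComponent hH h _ _ _)
  have h2 : starField o (k := 4) (l := 0) rfl (extD H) x ![] =
      extD H x ![frame (o x) 0, frame (o x) 1, frame (o x) 2, frame (o x) 3] := by
    simp only [starField]
    refine Eq.trans ?_ (Eq.trans (hodgeStar_four_eq (o x) (extD H x)) ?_) <;> congr 1
  have hc := covThreeForm_frame (x := x) ho hH h
  have c0 := hc 0 1 2 3
  have c1 := hc 1 0 2 3
  have c2 := hc 2 0 1 3
  have c3 := hc 3 0 1 2
  have ht := threeForm_torsion_frame (x := x) (o := o) hH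
  -- Between the alternating sums of partial and of covariant derivatives of `H` stand six terms
  -- `H(T(e_i, e_j), e_k, e_l)`, and all of them vanish.
  obtain ⟨s1, s2, s3, s4, s5, s6⟩ := sum_threeFormOf_mul_threeFormOf (torsionDual o H x)
  have t1 := (ht 0 1 2 3).trans s1
  have t2 := (ht 0 2 1 3).trans s2
  have t3 := (ht 0 3 1 2).trans s3
  have t4 := (ht 1 2 0 3).trans s4
  have t5 := (ht 1 3 0 2).trans s5
  have t6 := (ht 2 3 0 1).trans s6
  simp only [torsion_eq_covConst, threeForm_sub_left] at t1 t2 t3 t4 t5 t6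
  obtain ⟨r0, r1, r2, r3⟩ : (threeFormOf (torsionDualDeriv o nabla H x 0) 1 2 3 =
      -torsionDualDeriv o nabla H x 0 0) ∧ (threeFormOf (torsionDualDeriv o nabla H x 1) 0 2 3 =
      torsionDualDeriv o nabla H x 1 1) ∧ (threeFormOf (torsionDualDeriv o nabla H x 2) 0 1 3 =
      -torsionDualDeriv o nabla H x 2 2) ∧ (threeFormOf (torsionDualDeriv o nabla H x 3) 0 1 2 =
      torsionDualDeriv o nabla H x 3 3) := by
    simp [threeFormOf_rules]
  rw [r0, covThreeForm] at c0
  rw [r1, covThreeForm] at c1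
  rw [r2, covThreeForm] at c2
  rw [r3, covThreeForm] at c3
  have m2 (a k c : TangentSpace (𝓡 4) x) : H x ![a, k, c] = -H x ![k, a, c] :=
    threeForm_swap_left _ _ _ _
  have m3 (a b k : TangentSpace (𝓡 4) x) : H x ![a, b, k] = H x ![k, a, b] := by
    rw [threeForm_swap_right, threeForm_swap_left, neg_neg]
  have hs (r₀ r₁ r₂ r₃ : ℝ) : (-1) ^ (0 : Fin 4).val * r₀ + (-1) ^ (1 : Fin 4).val * r₁
      + (-1) ^ (2 : Fin 4).val * r₂ + (-1) ^ (3 : Fin 4).val * r₃ = r₀ - r₁ + r₂ - r₃ := by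
    norm_num
    ring
  have h3 : extD H x ![frame (o x) 0, frame (o x) 1, frame (o x) 2, frame (o x) 3] =
      mvfderiv (𝓡 4) (constComponent H (frame (o x) 1) (frame (o x) 2) (frame (o x) 3)) x
        (frame (o x) 0)
      - mvfderiv (𝓡 4) (constComponent H (frame (o x) 0) (frame (o x) 2) (frame (o x) 3)) x
        (frame (o x) 1)
      + mvfderiv (𝓡 4) (constComponent H (frame (o x) 0) (frame (o x) 1) (frame (o x) 3)) x
        (frame (o x) 2)
      - mvfderiv (𝓡 4) (constComponent H (frame (o x) 0) (frame (o x) 1) (frame (o x) 2)) x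
        (frame (o x) 3) := by
    rw [h1, Fin.sum_univ_four, hs]
    simp only [hd]
    rfl
  rw [h2, h3, Fin.sum_univ_four]
  generalize frame (o x) 0 = e0 at *
  generalize frame (o x) 1 = e1 at *
  generalize frame (o x) 2 = e2 at *
  generalize frame (o x) 3 = e3 at *
  set k := fun a b : TangentSpace (𝓡 4) x => covConst nabla a b x
  linarith [m2 e1 (k e0 e2) e3, m3 e1 e2 (k e0 e3), m2 e0 (k e1 e2) e3, m3 e0 e2 (k e1 e3),
    m2 e0 (k e2 e1) e3, m3 e0 e1 (k e2 e3), m2 e0 (k e3 e1) e2, m3 e0 e1 (k e3 e2)]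

lemma sum_threeFormOf_mul_self (t : Fin 4 → ℝ) (i j : Fin 4) :
    ∑ m, threeFormOf t i j m * t m = 0 := by
  obtain ⟨b1, b2, b3, b⟩ := threeFormOf_rules t
  fin_cases i <;> fin_cases j <;> simp [Fin.sum_univ_four, b1, b2, b3, b] <;> ring

/-- The components of `T(e_i, e_j)` pair with `t` into a Levi-Civita symbol contracted with `t`
twice. Hence `d(*H)` is the antisymmetrized `∇(*H)` without torsion correction. -/
lemma starField_torsion (hH : HasSkewTorsion nabla H) (i j : Fin 4) :
    starField o (k := 3) (l := 1) rfl H x ![nabla.torsion x (frame (o x) i) (frame (o x) j)] = 0 :=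
      by
  have h := oneForm_apply_eq_sum (o x) (starField o (k := 3) (l := 1) rfl H x)
    (nabla.torsion x (frame (o x) i) (frame (o x) j))
  refine Eq.trans (Eq.trans ?_ h) (Eq.trans ?_ (sum_threeFormOf_mul_self (torsionDual o H x) i j))
  · congr 1
  · refine Finset.sum_congr rfl fun m _ => ?_
    rw [← threeForm_frame_eq, ← hH.2, real_inner_comm, torsionDual]

lemma oneForm_sub {V : Type*} [NormedAddCommGroup V] [NormedSpace ℝ V]
    (α : V [⋀^Fin 1]→L[ℝ] ℝ) (u v : V) : α ![u - v] = α ![u] - α ![v] := by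
  simp

lemma extD_starField_frame (ho : IsOrientation o) (hH : HasSkewTorsion nabla H)
    (h : ∀ v w : TangentSpace (𝓡 4) x, DiffFieldAt (covConst nabla v w) x) (i j : Fin 4) :
    extD (starField o (k := 3) (l := 1) rfl H) x ![frame (o x) i, frame (o x) j] =
      torsionDualDeriv o nabla H x i j - torsionDualDeriv o nabla H x j i := by
  have hd (v : Fin 1 → TangentSpace (𝓡 4) x) : (fun y => starField o (k := 3) (l := 1) rfl H y
      fun i => constField (v i) y) = starComponent o H (v 0) := by
    ext1 y
    rw [starComponent]
    congr 1
    ext1 i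
    fin_cases i
    rfl
  have h1 := extD_apply (α := starField o (k := 3) (l := 1) rfl H) (x := x) (fun v => by
    rw [hd]
    exact mdifferentiableAt_starComponent ho hH h _) ![frame (o x) i, frame (o x) j]
  have ht := starField_torsion (x := x) (o := o) hH i j
  have hs (r₀ r₁ : ℝ) : (-1) ^ (0 : Fin 2).val * r₀ + (-1) ^ (1 : Fin 2).val * r₁ = r₀ - r₁ := by
    norm_num
    ring
  have h2 : extD (starField o (k := 3) (l := 1) rfl H) x ![frame (o x) i, frame (o x) j] =
      mvfderiv (𝓡 4) (starComponent o H (frame (o x) j)) x (frame (o x) i)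
        - mvfderiv (𝓡 4) (starComponent o H (frame (o x) i)) x (frame (o x) j) := by
    rw [h1, Fin.sum_univ_two, hs]
    simp only [hd]
    rfl
  have h3 := oneForm_sub (starField o (k := 3) (l := 1) rfl H x)
    (covConst nabla (frame (o x) i) (frame (o x) j) x)
    (covConst nabla (frame (o x) j) (frame (o x) i) x)
  rw [torsion_eq_covConst] at ht
  rw [h2, torsionDualDeriv, torsionDualDeriv, covOneForm_eq_starComponent,
    covOneForm_eq_starComponent]
  linarith

/-- The codifferential of the torsion is the dual of the antisymmetrized derivative of its Hodge
dual. -/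
theorem codiff_frame (ho : IsOrientation o) (hH : HasSkewTorsion nabla H)
    (h : ∀ v w : TangentSpace (𝓡 4) x, DiffFieldAt (covConst nabla v w) x) (i j : Fin 4) :
    codiff o (k := 2) (l := 1) rfl rfl H x ![frame (o x) i, frame (o x) j] =
      -∑ k, ∑ l, leviCivitaSymbol k l i j * torsionDualDeriv o nabla H x k l := by
  have h1 := hodgeStar_two_apply (o x) (extD (starField o (k := 3) (l := 1) rfl H) x) i j
  have h2 : codiff o (k := 2) (l := 1) rfl rfl H x ![frame (o x) i, frame (o x) j] =
      -hodgeStar (o x) (k := 2) (l := 2) rfl (extD (starField o (k := 3) (l := 1) rfl H) x)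
        ![frame (o x) i, frame (o x) j] := by
    simp only [codiff, starField]
    rfl
  -- The symbol is skew in `k, l`, so both halves of `d(*H)` contribute equally, and this factor two
  -- cancels the `1/2` of the star.
  have hs : ∑ k, ∑ l, leviCivitaSymbol k l i j * torsionDualDeriv o nabla H x l k =
      -∑ k, ∑ l, leviCivitaSymbol k l i j * torsionDualDeriv o nabla H x k l := by
    rw [Finset.sum_comm]
    simp only [← Finset.sum_neg_distrib]
    refine Finset.sum_congr rfl fun k _ => Finset.sum_congr rfl fun l _ => ?_
    rw [leviCivitaSymbol_swap_left]
    push_cast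
    ring
  have h3 : ∑ k, ∑ l, extD (starField o (k := 3) (l := 1) rfl H) x ![frame (o x) k, frame (o x) l]
      * leviCivitaSymbol k l i j =
      ∑ k, ∑ l, leviCivitaSymbol k l i j * torsionDualDeriv o nabla H x k l
        - ∑ k, ∑ l, leviCivitaSymbol k l i j * torsionDualDeriv o nabla H x l k := by
    simp only [← Finset.sum_sub_distrib]
    refine Finset.sum_congr rfl fun k _ => Finset.sum_congr rfl fun l _ => ?_
    rw [extD_starField_frame ho hH h]
    ring
  rw [hs] at h3
  refine h2.trans (neg_inj.mpr (Eq.trans ?_ (h1.trans ?_)))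
  · congr 1
  · refine (congrArg (2⁻¹ * ·) h3).trans ?_
    ring

end Duals

/-! ### Bilinearity, to pass from the frame to arbitrary vectors. -/

/-- A bilinear function. -/
def IsBilin {V : Type*} [AddCommGroup V] [Module ℝ V] (F : V → V → ℝ) : Prop :=
  ∃ B : V →ₗ[ℝ] V →ₗ[ℝ] ℝ, ∀ u v, F u v = B u v

namespace IsBilin

variable {V : Type*} [AddCommGroup V] [Module ℝ V] {F G : V → V → ℝ}

lemma of_forall (h1 : ∀ u u' v, F (u + u') v = F u v + F u' v)
    (h2 : ∀ (c : ℝ) u v, F (c • u) v = c * F u v) (h3 : ∀ u v v', F u (v + v') = F u v + F u v')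
    (h4 : ∀ (c : ℝ) u v, F u (c • v) = c * F u v) : IsBilin F :=
  ⟨LinearMap.mk₂ ℝ F h1 h2 h3 h4, fun _ _ => rfl⟩

lemma add (hF : IsBilin F) (hG : IsBilin G) : IsBilin fun u v => F u v + G u v := by
  obtain ⟨A, hA⟩ := hF
  obtain ⟨B, hB⟩ := hG
  exact ⟨A + B, fun u v => by simp [hA, hB]⟩

lemma const_mul (hF : IsBilin F) (c : ℝ) : IsBilin fun u v => c * F u v := by
  obtain ⟨A, hA⟩ := hF
  exact ⟨c • A, fun u v => by simp [hA]⟩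

lemma sub (hF : IsBilin F) (hG : IsBilin G) : IsBilin fun u v => F u v - G u v := by
  obtain ⟨A, hA⟩ := hF
  obtain ⟨B, hB⟩ := hG
  exact ⟨A - B, fun u v => by simp [hA, hB]⟩

lemma sum {ι : Type*} [Fintype ι] {F : ι → V → V → ℝ} (hF : ∀ i, IsBilin (F i)) :
    IsBilin fun u v => ∑ i, F i u v := by
  choose A hA using hF
  exact ⟨∑ i, A i, fun u v => by simp [hA, LinearMap.sum_apply]⟩

lemma symmetrize (hF : IsBilin F) : IsBilin (SkewTorsion.symmetrize F) := by
  obtain ⟨A, hA⟩ := hF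
  exact ⟨(2⁻¹ : ℝ) • (A + A.flip), fun u v => by
    simp [SkewTorsion.symmetrize, hA]
    ring⟩

lemma ext_basis {ι : Type*} (hF : IsBilin F) (hG : IsBilin G) (b : Basis ι ℝ V)
    (h : ∀ i j, F (b i) (b j) = G (b i) (b j)) (u v : V) : F u v = G u v := by
  obtain ⟨A, hA⟩ := hF
  obtain ⟨B, hB⟩ := hG
  have : A = B := LinearMap.ext_basis b b fun i j => by rw [← hA, ← hB, h]
  rw [hA, hB, this]

end IsBilin

section Algebra

variable {V : Type*} [NormedAddCommGroup V] [InnerProductSpace ℝ V]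

lemma isBilin_inner : IsBilin fun u v : V => ⟪u, v⟫ :=
  .of_forall (fun _ _ _ => inner_add_left _ _ _) (fun _ _ _ => real_inner_smul_left _ _ _)
    (fun _ _ _ => inner_add_right _ _ _) (fun _ _ _ => real_inner_smul_right _ _ _)

lemma wedge_add (u v w : V) : wedge u (v + w) = wedge u v + wedge u w := by
  ext m
  have e : m = ![m 0, m 1] := by ext i; fin_cases i <;> rfl
  rw [e, ContinuousAlternatingMap.add_apply, wedge_apply, wedge_apply, wedge_apply,
    inner_add_left, inner_add_left]
  ring

lemma wedge_smul (c : ℝ) (u v : V) : wedge u (c • v) = c • wedge u v := by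
  ext m
  have e : m = ![m 0, m 1] := by ext i; fin_cases i <;> rfl
  rw [e, ContinuousAlternatingMap.smul_apply, wedge_apply, wedge_apply, real_inner_smul_left,
    real_inner_smul_left, smul_eq_mul]
  ring

lemma oneForm_add (α : V [⋀^Fin 1]→L[ℝ] ℝ) (u v : V) : α ![u + v] = α ![u] + α ![v] := by
  have e (w : V) : Function.update ![u] 0 w = ![w] := by
    ext i
    fin_cases i
    simp
  have h := α.toAlternatingMap.map_update_add ![u] 0 u v
  rw [e, e, e] at h
  exact h

lemma oneForm_smul (α : V [⋀^Fin 1]→L[ℝ] ℝ) (c : ℝ) (v : V) : α ![c • v] = c * α ![v] := by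
  have e (w : V) : Function.update ![v] 0 w = ![w] := by
    ext i
    fin_cases i
    simp
  have h := α.toAlternatingMap.map_update_smul ![v] 0 c v
  rw [e, e] at h
  exact h

variable [Fact (finrank ℝ V = 4)] (o : Orientation ℝ V (Fin 4))

lemma inner_frame (i j : Fin 4) : ⟪frame o i, frame o j⟫ = kronecker i j := by
  rw [orthonormal_iff_ite.mp (frame o).orthonormal, kronecker]

lemma isBilin_twoFormInner : IsBilin (twoFormInner o) := by
  refine .of_forall (fun α α' β => ?_) (fun c α β => ?_) (fun α β β' => ?_) (fun c α β => ?_) <;>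
    simp only [twoFormInner, ContinuousAlternatingMap.add_apply,
      ContinuousAlternatingMap.smul_apply, smul_eq_mul, add_mul, mul_add, Finset.sum_add_distrib,
      Finset.mul_sum]
  · exact Finset.sum_congr rfl fun _ _ => Finset.sum_congr rfl fun _ _ => by ring
  · exact Finset.sum_congr rfl fun _ _ => Finset.sum_congr rfl fun _ _ => by ring

lemma isBilin_blockTensor (B : (V [⋀^Fin 2]→L[ℝ] ℝ) →ₗ[ℝ] (V [⋀^Fin 2]→L[ℝ] ℝ)) :
    IsBilin (blockTensor o B) := by
  obtain ⟨A, hA⟩ := isBilin_twoFormInner o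
  refine IsBilin.sum (F := fun i u v =>
    twoFormInner o ((B + transposeOp o B) (wedge (frame o i) u)) (wedge (frame o i) v))
    fun i => .of_forall (fun u u' v => ?_) (fun c u v => ?_) (fun u v v' => ?_)
    (fun c u v => ?_) <;> simp only [hA, wedge_add, wedge_smul, map_add, map_smul] <;> rfl

end Algebra

/-! ### Frame components and bilinearity of the curvature quantities. -/

section Tensors

variable {M : Type*} [TopologicalSpace M] [ChartedSpace (EuclideanSpace ℝ (Fin 4)) M]
  {x : M} [IsManifold (𝓡 4) ∞ M]
  {nabla nablaG : CovariantDerivative (𝓡 4) (EuclideanSpace ℝ (Fin 4))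
    (fun x : M => TangentSpace (𝓡 4) x)}
  {H : ∀ x : M, TangentSpace (𝓡 4) x [⋀^Fin 3]→L[ℝ] ℝ}

lemma eventually_covConst_add (u v w : TangentSpace (𝓡 4) x) :
    ∀ᶠ y in 𝓝 x, covConst nabla (u + v) w y = covConst nabla u w y + covConst nabla v w y := by
  filter_upwards [eventually_mem_chart_source (x := x)] with y hy
  rw [covConst, constField_add _ _ hy, map_add]
  rfl

lemma eventually_covConst_smul (c : ℝ) (v w : TangentSpace (𝓡 4) x) :
    ∀ᶠ y in 𝓝 x, covConst nabla (c • v) w y = c • covConst nabla v w y := by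
  filter_upwards [eventually_mem_chart_source (x := x)] with y hy
  rw [covConst, constField_smul _ _ hy, map_smul]
  rfl

variable [RiemannianBundle (fun x : M => TangentSpace (𝓡 4) x)]
  {o : ∀ x : M, Orientation ℝ (TangentSpace (𝓡 4) x) (Fin 4)}

lemma ricci_frame {r : Fin 4 → Fin 4 → Fin 4 → Fin 4 → ℝ}
    (hr : ∀ i j k l, curvatureTensor nabla x (frame (o x) i) (frame (o x) j) (frame (o x) k)
      (frame (o x) l) = r i j k l) (j k : Fin 4) :
    ricci o nabla x (frame (o x) j) (frame (o x) k) = ricciOf r j k := by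
  simp only [ricci, ricciOf, hr]

lemma scalar_eq_scalarOf {r : Fin 4 → Fin 4 → Fin 4 → Fin 4 → ℝ}
    (hr : ∀ i j k l, curvatureTensor nabla x (frame (o x) i) (frame (o x) j) (frame (o x) k)
      (frame (o x) l) = r i j k l) :
    scalar o nabla x = scalarOf r := by
  simp only [scalar, scalarOf, ricci_frame hr]

lemma weylTensor_frame {r : Fin 4 → Fin 4 → Fin 4 → Fin 4 → ℝ}
    (hr : ∀ i j k l, curvatureTensor nabla x (frame (o x) i) (frame (o x) j) (frame (o x) k)
      (frame (o x) l) = r i j k l) (i j k l : Fin 4) :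
    weylTensor o nabla x (frame (o x) i) (frame (o x) j) (frame (o x) k) (frame (o x) l) =
      weylOf r i j k l := by
  simp only [weylTensor, weylOf, hr, ricci_frame hr, scalar_eq_scalarOf hr, inner_frame]

variable
  [IsContMDiffRiemannianBundle (𝓡 4) ∞ (EuclideanSpace ℝ (Fin 4))
    (fun x : M => TangentSpace (𝓡 4) x)]

/-- The second and fourth arguments are those left free in the Ricci tensor. Linearity in `v` is not
formal: `v` enters through its extension, which is additive only near `x`, so the Christoffel
symbols are compared there before differentiating. -/
lemma isBilin_curvatureTensor (hm : nabla.IsMetricCompatible)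
    (h : ∀ v w : TangentSpace (𝓡 4) x, DiffFieldAt (covConst nabla v w) x)
    (u w : TangentSpace (𝓡 4) x) : IsBilin fun v z => curvatureTensor nabla x u v w z := by
  refine .of_forall (fun v v' z => ?_) (fun c v z => ?_) (fun v z z' => ?_) (fun c v z => ?_)
  · have e : mvfderiv (𝓡 4) (christoffel nabla (v + v') w z) x u =
        mvfderiv (𝓡 4) (christoffel nabla v w z) x u
          + mvfderiv (𝓡 4) (christoffel nabla v' w z) x u := by
      have e1 : ∀ᶠ y in 𝓝 x, christoffel nabla (v + v') w z y =
          christoffel nabla v w z y + christoffel nabla v' w z y := by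
        filter_upwards [eventually_covConst_add v v' w] with y hy
        rw [christoffel, hy, inner_add_left, christoffel, christoffel]
      rw [Filter.EventuallyEq.mvfderiv_eq e1 u, mvfderiv_fun_add
        (mdifferentiableAt_christoffel (h v w) z) (mdifferentiableAt_christoffel (h v' w) z)]
      rfl
    simp only [curvatureTensor, inner_curvature hm h, e, map_add,
      (eventually_covConst_add v v' _).self_of_nhds, inner_add_left, inner_add_right]
    ring
  · have e : mvfderiv (𝓡 4) (christoffel nabla (c • v) w z) x u =
        c * mvfderiv (𝓡 4) (christoffel nabla v w z) x u := by
      have e1 : ∀ᶠ y in 𝓝 x, christoffel nabla (c • v) w z y =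
          c * christoffel nabla v w z y := by
        filter_upwards [eventually_covConst_smul c v w] with y hy
        rw [christoffel, hy, real_inner_smul_left, christoffel]
      rw [Filter.EventuallyEq.mvfderiv_eq e1 u, mvfderiv_fun_mul (f := fun _ => c)
        mdifferentiableAt_const (mdifferentiableAt_christoffel (h v w) z), mvfderiv_const]
      simp
    simp only [curvatureTensor, inner_curvature hm h, e, map_smul, smul_eq_mul,
      (eventually_covConst_smul c v _).self_of_nhds, real_inner_smul_left, real_inner_smul_right]
    ring
  · simp only [curvatureTensor, inner_add_right]
    ring
  · simp only [curvatureTensor, real_inner_smul_right]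
    ring

lemma isBilin_ricci (hm : nabla.IsMetricCompatible)
    (h : ∀ v w : TangentSpace (𝓡 4) x, DiffFieldAt (covConst nabla v w) x) :
    IsBilin (ricci o nabla x) :=
  IsBilin.sum fun _ => isBilin_curvatureTensor hm h _ _

lemma isBilin_tracelessRicci (hm : nabla.IsMetricCompatible)
    (h : ∀ v w : TangentSpace (𝓡 4) x, DiffFieldAt (covConst nabla v w) x) :
    IsBilin (tracelessRicci o nabla x) :=
  (isBilin_ricci hm h).symmetrize.sub (isBilin_inner.const_mul _)

lemma isBilin_covOneForm (ho : IsOrientation o) (hH : HasSkewTorsion nabla H)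
    (h : ∀ v w : TangentSpace (𝓡 4) x, DiffFieldAt (covConst nabla v w) x) :
    IsBilin (covOneForm nabla (starField o (k := 3) (l := 1) rfl H) x) := by
  refine .of_forall (fun v v' z => ?_) (fun c v z => ?_) (fun v z z' => ?_) (fun c v z => ?_)
  · rw [covOneForm, covOneForm, covOneForm, map_add, map_add, oneForm_add]
    ring
  · rw [covOneForm, covOneForm, map_smul, map_smul, oneForm_smul, smul_eq_mul]
    ring
  · simp only [covOneForm_starField ho hH h, inner_add_right]
    ring
  -- By `covOneForm_starField` the second argument occurs only inside inner products, although the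
  -- definition differentiates its extension.
  · simp only [covOneForm_starField ho hH h, real_inner_smul_right]
    ring

end Tensors
end SkewTorsion

/-! ### The curvature operator in block form. -/

theorem mainTheorem5 {M : Type*} [TopologicalSpace M] [T2Space M]
    [ChartedSpace (EuclideanSpace ℝ (Fin 4)) M] [IsManifold (𝓡 4) ∞ M]
    [RiemannianBundle (fun x : M => TangentSpace (𝓡 4) x)]
    [IsContMDiffRiemannianBundle (𝓡 4) ∞ (EuclideanSpace ℝ (Fin 4))
      (fun x : M => TangentSpace (𝓡 4) x)]
    (o : ∀ x : M, Orientation ℝ (TangentSpace (𝓡 4) x) (Fin 4)) (ho : IsOrientation o)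
    (nablaG : CovariantDerivative (𝓡 4) (EuclideanSpace ℝ (Fin 4))
      (fun x : M => TangentSpace (𝓡 4) x))
    (hG : IsLeviCivita nablaG)
    (H : ∀ x : M, TangentSpace (𝓡 4) x [⋀^Fin 3]→L[ℝ] ℝ)
    (nabla : CovariantDerivative (𝓡 4) (EuclideanSpace ℝ (Fin 4))
      (fun x : M => TangentSpace (𝓡 4) x))
    [CovariantDerivative.ContMDiffCovariantDerivative nabla ∞]
    (hH : HasSkewTorsion nabla H) (x : M) :
    let R := curvatureOperator o nabla x
    let s : ℝ := scalar o nabla x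
    let starDH : ℝ := starField o (k := 4) (l := 0) rfl (extD H) x ![]
    let codiffH := codiff o (k := 2) (l := 1) rfl rfl H x
    let S := symmetrize (covOneForm nabla (starField o (k := 3) (l := 1) rfl H) x)
    let Z := tracelessRicci o nabla x
    let B := plusPart (o x) ∘ₗ R ∘ₗ minusPart (o x)
    let C := minusPart (o x) ∘ₗ R ∘ₗ plusPart (o x)
    IsCompl (selfDual (o x)) (antiSelfDual (o x)) ∧
    (∀ α ∈ selfDual (o x), plusPart (o x) (R α) =
      weylPlus o nablaG x α + (s / 12 - starDH / 4) • α
        + (1 / 4 : ℝ) • formAction (o x) (plusPart (o x) codiffH) α) ∧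
    (∀ α ∈ antiSelfDual (o x), minusPart (o x) (R α) =
      weylMinus o nablaG x α + (s / 12 + starDH / 4) • α
        - (1 / 4 : ℝ) • formAction (o x) (minusPart (o x) codiffH) α) ∧
    (∀ X Y : TangentSpace (𝓡 4) x, blockTensor (o x) B X Y =
      Z X Y + S X Y + starDH / 4 * ⟪X, Y⟫) ∧
    (∀ X Y : TangentSpace (𝓡 4) x, blockTensor (o x) (transposeOp (o x) C) X Y =
      Z X Y - S X Y - starDH / 4 * ⟪X, Y⟫) := by
  intro R s starDH codiffH S Z B C
  -- From here on, smoothness of the connection is used only in this form.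
  have h (v w : TangentSpace (𝓡 4) x) : DiffFieldAt (covConst nabla v w) x :=
    (smoothFieldAt_covConst nabla v w).diffFieldAt
  set g := fun i j k l => curvatureTensor nablaG x (frame (o x) i) (frame (o x) j)
        (frame (o x) k) (frame (o x) l)
  set t := torsionDual o H x
  set n := torsionDualDeriv o nabla H x
  have hg : IsAlgebraicCurvature g := isAlgebraicCurvature_leviCivita hH hG h
  have hR : ∀ i j k l, curvatureTensor nabla x (frame (o x) i) (frame (o x) j) (frame (o x) k)
      (frame (o x) l) = torsionCurvature g t n i j k l := curvatureTensor_frame ho hH hG h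
  have hW := weylTensor_frame (nabla := nablaG) (o := o) (x := x) (r := g) fun _ _ _ _ => rfl
  have hs : s = scalarOf (torsionCurvature g t n) := scalar_eq_scalarOf hR
  have hd : starDH = -∑ i, n i i := starField_extD ho hH h
  have hc : ∀ i j, codiffH ![frame (o x) i, frame (o x) j] =
    -∑ k, ∑ l, leviCivitaSymbol k l i j * n k l := codiff_frame ho hH h
  have hZ : IsBilin Z := isBilin_tracelessRicci hH.1 h
  have hS : IsBilin S := (isBilin_covOneForm ho hH h).symmetrize
  have hZf (j k : Fin 4) : Z (frame (o x) j) (frame (o x) k) =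
      (ricciOf (torsionCurvature g t n) j k + ricciOf (torsionCurvature g t n) k j) / 2
        - scalarOf (torsionCurvature g t n) / 4 * kronecker j k := by
    simp only [Z, tracelessRicci, symmetrize, ricci_frame hR, scalar_eq_scalarOf hR, inner_frame]
  have hSf (j k : Fin 4) : S (frame (o x) j) (frame (o x) k) = (n j k + n k j) / 2 := rfl
  have hb (j k : Fin 4) := blockTensor_of_skew (o x) hR
    (fun i j k l => torsionCurvature_skew_left hg t n i j k l)
    (fun i j k l => torsionCurvature_skew_right hg t n i j k l) j k
  have hp (j k : Fin 4) := pairSkewContraction_torsionCurvature hg t n j k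
  refine ⟨isCompl_selfDual_antiSelfDual (o x), fun α hα => ?_, fun α hα => ?_, ?_, ?_⟩
  · rw [hs, hd]
    have hα' := plusPart_operatorOf_of_mem_selfDual (o x) hg t n hR hW hc hα
    simp only [R, curvatureOperator, weylPlus, weylOperator, LinearMap.comp_apply]
    refine Eq.trans ?_ (hα'.trans ?_)
    · congr 1
    · congr 1
  · rw [hs, hd]
    have hα' := minusPart_operatorOf_of_mem_antiSelfDual (o x) hg t n hR hW hc hα
    simp only [R, curvatureOperator, weylMinus, weylOperator, LinearMap.comp_apply]
    refine Eq.trans ?_ (hα'.trans ?_)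
    · congr 1
    · congr 1
  -- Both sides are bilinear, so the frame components computed above suffice.
  · refine (isBilin_blockTensor (o x) B).ext_basis ((hZ.add hS).add (isBilin_inner.const_mul _))
      (frame (o x)).toBasis fun j k => ?_
    rw [OrthonormalBasis.coe_toBasis, hZf, hSf, inner_frame, hd]
    refine (hb j k).1.trans ?_
    rw [hp]
    ring
  · refine (isBilin_blockTensor (o x) _).ext_basis ((hZ.sub hS).sub (isBilin_inner.const_mul _))
      (frame (o x)).toBasis fun j k => ?_
    -- The transpose drops out of the block tensor, which leaves the second half of
    -- `blockTensor_of_skew`.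
    rw [OrthonormalBasis.coe_toBasis, hZf, hSf, inner_frame, hd, blockTensor_transposeOp_frame]
    refine (hb j k).2.trans ?_
    rw [hp]
    ring
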